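/- Let $d,\delta\ge 1$ be integers and, for $x\in\mathbb{R}^d$, let $\kappa(x)=\mathcal{L}(Z\mid X=x)$ be the conditional law (a Markov kernel) of a real random variable $Z$ given $X=x$. Let $f(x)=\mathbb{E}(Z\mid X=x)$, assume that $f$ has a unique maximizer $\theta\in\mathbb{R}^d$, and set $\mu=f(\theta)$. Let $(a_n)$, $(c_n)$, $(\tilde a_n)$, $n\ge1$, be positive nonrandom sequences and let $(e_1,\dots,e_d)$ be the canonical basis of $\mathbb{R}^d$. Starting from random $\theta_1\in\mathbb{R}^d$ and $\mu_1\in\mathbb{R}$, let, for $n\ge 1$, $$\theta_{n+1}=\theta_n+\frac{a_n}{2c_n}\bigl\{Z(\theta_n+c_ne_i)-Z(\theta_n-c_ne_i)\bigr\}_{1\le i\le d},\qquad \mu_{n+1}=(1-\tilde a_n)\mu_n+\frac{\tilde a_n}{\delta}\sum_{k=1}^{\delta}Z_k(\theta_n),$$ where $Z(\theta_n\pm c_ne_i)$ and $Z_k(\theta_n)$ are observations of $f$ at the indicated points. Write $W^{\pm}_{n,i}=Z(\theta_n\pm c_ne_i)-f(\theta_n\pm c_ne_i)$ and $\mathcal{W}_{n,k}=Z_k(\theta_n)-f(\theta_n)$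 for the observation errors, and let $\mathcal{G}_n$ be the $\sigma$-field spanned by all errors of the steps $1,\dots,n-1$; given $\mathcal{G}_n$ and $\theta_n$, an observation made at the point $x$ has law $\kappa(x)$. For $r\in\mathbb{R}$, a positive sequence $(v_n)$ belongs to $\mathcal{GS}(r)$ if $\lim_{n\to\infty} n(1-v_{n-1}/v_n)=r$. Assume: (A1) $\theta_n\to\theta$ almost surely. (A2) $f$ is three times continuously differentiable in a neighbourhood of $\theta$, and $D^2f(\theta)$ is negative definite with maximal eigenvalue $-L<0$. (A3) For each $n\ge1$ the $2d+\delta$ errors $W^{+}_{n,i},W^{-}_{n,j},\mathcal{W}_{n,k}$ of step $n$ are independent conditionally on $\mathcal{G}_n$; for some $\sigma>0$, $\mathrm{Var}(Z\mid X=x)=\sigma^2$ for all $x$; and for some $m>2$, $\sup_x\mathbb{E}(|Z|^m\mid X=x)<\infty$. (A4) For some $\alpha,\tilde\alpha\in(\max\{1/2,2/m\},1]$ and $\tau\in(0,\alpha/2)$: $(a_n)\in\mathcal{GS}(-\alpha)$, $(c_n)\in\mathcal{GS}(-\tau)$, $(\tilde a_n)\in\mathcal{GS}(-\tilde\alpha)$;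 the limits $\lim na_n\in\bigl(\max\{\tfrac{1-2\tau}{2L},\tfrac{2\tau}{L}\},\infty\bigr]$ and $\lim n\tilde a_n\in(\tfrac12,\infty]$ exist; $\lim \tilde a_n^{-1/2}a_n\log(\sum_{k=1}^na_k)/c_n^2=0$ and $\lim\tilde a_n^{-1}c_n^8=0$. Set $\xi^{(\theta)}=(1-2\tau)\lim(na_n)^{-1}$, $\zeta^{(\theta)}=4\tau\lim(na_n)^{-1}$, $\xi^{(\mu)}=\lim(n\tilde a_n)^{-1}$ and $$\Sigma^{(\theta)}=-\frac{\sigma^2}{4}\Bigl[D^2f(\theta)+\frac{\xi^{(\theta)}}{2}I_d\Bigr]^{-1},\quad \Delta^{(\theta)}=-\frac16\Bigl[D^2f(\theta)+\frac{\zeta^{(\theta)}}{2}I_d\Bigr]^{-1}\Bigl\{\frac{\partial^3f}{\partial x_i^3}(\theta)\Bigr\}_{1\le i\le d},\quad \Sigma^{(\mu)}=\frac{\sigma^2}{\delta(2-\xi^{(\mu)})}.$$ (1) If $\lim a_n^{-1}c_n^6=\infty$, then $$\begin{pmatrix}c_n^{-2}(\theta_n-\theta)\\ \sqrt{\tilde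 a_n^{-1}}(\mu_n-\mu)\end{pmatrix}\xrightarrow{\mathcal{D}}\begin{pmatrix}\Delta^{(\theta)}\\ \mathcal{Z}'\end{pmatrix},\qquad \mathcal{Z}'\sim\mathcal{N}(0,\Sigma^{(\mu)}).$$ (2) If $\lim a_n^{-1}c_n^6=\gamma_1$ for some $\gamma_1\ge0$, then $$\begin{pmatrix}\sqrt{a_n^{-1}c_n^2}(\theta_n-\theta)\\ \sqrt{\tilde a_n^{-1}}(\mu_n-\mu)\end{pmatrix}\xrightarrow{\mathcal{D}}\mathcal{N}\left(\begin{pmatrix}\sqrt{\gamma_1}\Delta^{(\theta)}\\0\end{pmatrix},\begin{pmatrix}\Sigma^{(\theta)}&0\\0&\Sigma^{(\mu)}\end{pmatrix}\right).$$ (3) In particular, if $a_n=a_0n^{-1}$, $c_n=c_0n^{-1/6}$ and $\tilde a_n=\tilde a_0n^{-1}$ for $n\ge 1$, with $a_0,c_0,\tilde a_0>0$, then $\mu_n$ has the parametric rate: $$\begin{pmatrix}n^{1/3}(\theta_n-\theta)\\ \sqrt{n}(\mu_n-\mu)\end{pmatrix}\xrightarrow{\mathcal{D}}\mathcal{N}\left(\begin{pmatrix}c_0^2\Delta^{(\theta)}\\0\end{pmatrix},\begin{pmatrix}a_0c_0^{-2}\Sigma^{(\theta)}&0\\0&\tilde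 a_0\Sigma^{(\mu)}\end{pmatrix}\right).$$ -/

import Mathlib

open MeasureTheory ProbabilityTheory Filter Topology

namespace KieferWolfowitz

noncomputable section

/-- The class of positive sequences `(v_n)_{n ≥ 1}` such that `n (1 - v_{n-1} / v_n) → r`.
All sequences are indexed by `n ≥ 1`; the term of index `0` plays no role. -/
def GS (r : ℝ) (v : ℕ → ℝ) : Prop :=
  (∀ n : ℕ, 1 ≤ n → 0 < v n) ∧
    Tendsto (fun n : ℕ => (n : ℝ) * (1 - v (n - 1) / v n)) atTop (𝓝 r)

/-- The `i`-th vector of the canonical basis of `ℝ^d`. -/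
def basisVec {d : ℕ} (i : Fin d) : EuclideanSpace ℝ (Fin d) := EuclideanSpace.single i 1

/-- The regression function `f(x) = E(Z | X = x)`, where `κ x` is the conditional law of `Z`
given `X = x`. -/
def regression {d : ℕ} (κ : Kernel (EuclideanSpace ℝ (Fin d)) ℝ)
    (x : EuclideanSpace ℝ (Fin d)) : ℝ := ∫ z, z ∂(κ x)

/-- Labels of the `2 d + δ` observations made at each step. -/
abbrev Label (d δ : ℕ) := Fin d ⊕ Fin d ⊕ Fin δ

/-- The label of the observation at `θ_n + c_n e_i`. -/
abbrev Label.plus {d δ : ℕ} (i : Fin d) : Label d δ := Sum.inl i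

/-- The label of the observation at `θ_n - c_n e_i`. -/
abbrev Label.minus {d δ : ℕ} (i : Fin d) : Label d δ := Sum.inr (Sum.inl i)

/-- The label of the `k`-th additional observation at `θ_n`. -/
abbrev Label.extra {d δ : ℕ} (k : Fin δ) : Label d δ := Sum.inr (Sum.inr k)

/-- The point at which the observation with a given label is made, when the current value of the
algorithm is `t` and the current width is `h`. -/
def queryPoint {d δ : ℕ} (h : ℝ) (t : EuclideanSpace ℝ (Fin d)) :
    Label d δ → EuclideanSpace ℝ (Fin d)
  | Sum.inl i => t + h • basisVec i
  | Sum.inr (Sum.inl i) => t - h • basisVec i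
  | Sum.inr (Sum.inr _) => t

section Algorithm

variable {Ω : Type*} {d δ : ℕ}

/-- The observation errors: the observation `Z n s` minus the value of the regression function at
the point where the observation is made. -/
def noise (κ : Kernel (EuclideanSpace ℝ (Fin d)) ℝ) (c : ℕ → ℝ)
    (T : ℕ → Ω → EuclideanSpace ℝ (Fin d)) (Z : ℕ → Label d δ → Ω → ℝ)
    (n : ℕ) (s : Label d δ) (ω : Ω) : ℝ :=
  Z n s ω - regression κ (queryPoint (c n) (T n ω) s)

/-- The sigma-algebra spanned by the observation errors of the steps `1, …, n - 1`. -/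
abbrev past (κ : Kernel (EuclideanSpace ℝ (Fin d)) ℝ) (c : ℕ → ℝ)
    (T : ℕ → Ω → EuclideanSpace ℝ (Fin d)) (Z : ℕ → Label d δ → Ω → ℝ)
    (n : ℕ) : MeasurableSpace Ω :=
  ⨆ p : {q : ℕ // 1 ≤ q ∧ q < n} × Label d δ,
    MeasurableSpace.comap (noise κ c T Z p.1 p.2) inferInstance

/-- The finite-difference approximation of the gradient at `θ_n`. -/
def gradEstimate (c : ℕ → ℝ) (Z : ℕ → Label d δ → Ω → ℝ) (n : ℕ) (ω : Ω) :
    EuclideanSpace ℝ (Fin d) :=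
  (1 / (2 * c n)) • WithLp.toLp 2 fun i => Z n (Label.plus i) ω - Z n (Label.minus i) ω

/-- The average of the `δ` additional observations at `θ_n`. -/
def valueEstimate (Z : ℕ → Label d δ → Ω → ℝ) (n : ℕ) (ω : Ω) : ℝ :=
  (1 / (δ : ℝ)) * ∑ k : Fin δ, Z n (Label.extra k) ω

/-- Conditional independence of a finite family of real random variables given `𝒢`, on an
arbitrary probability space: the conditional probabilities of the events
`{W_s ∈ B_s for all s}` factorize. -/
def CondIndepFamily {mΩ : MeasurableSpace Ω} {ι : Type*} [Fintype ι] (P : Measure Ω)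
    (𝒢 : MeasurableSpace Ω) (W : ι → Ω → ℝ) : Prop :=
  ∀ B : ι → Set ℝ, (∀ s, MeasurableSet (B s)) →
    P⟦⋂ s, W s ⁻¹' B s | 𝒢⟧ =ᵐ[P] fun ω => ∏ s, (P⟦W s ⁻¹' B s | 𝒢⟧) ω

/-- The processes `T = (θ_n)` and `M = (μ_n)` are produced by the double algorithm
`θ_{n+1} = θ_n + a_n Y_n`, `μ_{n+1} = (1 - a'_n) μ_n + a'_n Y'_n`, `n ≥ 1`, with arbitrary
(possibly random) starting values; given the past and the current point, an observation made at
the point `x` has the law `κ x`. -/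
structure IsCompanionAlgorithm [MeasurableSpace Ω] (P : Measure Ω)
    (κ : Kernel (EuclideanSpace ℝ (Fin d)) ℝ) (a c a' : ℕ → ℝ)
    (Z : ℕ → Label d δ → Ω → ℝ)
    (T : ℕ → Ω → EuclideanSpace ℝ (Fin d)) (M : ℕ → Ω → ℝ) : Prop where
  measurable_obs : ∀ n s, Measurable (Z n s)
  measurable_T : ∀ n, Measurable (T n)
  measurable_M : ∀ n, Measurable (M n)
  step_T : ∀ n, 1 ≤ n → ∀ ω, T (n + 1) ω = T n ω + a n • gradEstimate c Z n ω
  step_M : ∀ n, 1 ≤ n → ∀ ω, M (n + 1) ω = (1 - a' n) * M n ω + a' n * valueEstimate Z n ω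
  obs_law : ∀ n, 1 ≤ n → ∀ s, ∀ B : Set ℝ, MeasurableSet B →
    P⟦Z n s ⁻¹' B | past κ c T Z n ⊔ MeasurableSpace.comap (T n) inferInstance⟧
      =ᵐ[P] fun ω => (κ (queryPoint (c n) (T n ω) s)).real B

/-- Assumptions on the observation errors: conditional independence given the past, constant
conditional variance `σ²`, and bounded conditional moments of order `m > 2`. -/
structure NoiseAssumption [MeasurableSpace Ω] (P : Measure Ω)
    (κ : Kernel (EuclideanSpace ℝ (Fin d)) ℝ) (c : ℕ → ℝ)
    (Z : ℕ → Label d δ → Ω → ℝ) (T : ℕ → Ω → EuclideanSpace ℝ (Fin d))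
    (σ m : ℝ) : Prop where
  condIndep : ∀ n, 1 ≤ n → CondIndepFamily P (past κ c T Z n) (noise κ c T Z n)
  sigma_pos : 0 < σ
  variance_eq : ∀ x, Var[fun z => z; κ x] = σ ^ 2
  two_lt_m : 2 < m
  moment : ⨆ x, ∫⁻ z, ENNReal.ofReal (|z| ^ m) ∂(κ x) < ⊤

end Algorithm

/-- The Hessian matrix of `f` at `x`. -/
def hessian {d : ℕ} (f : EuclideanSpace ℝ (Fin d) → ℝ) (x : EuclideanSpace ℝ (Fin d)) :
    Matrix (Fin d) (Fin d) ℝ :=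
  Matrix.of fun i j => iteratedFDeriv ℝ 2 f x ![basisVec i, basisVec j]

/-- The vector of the pure third partial derivatives of `f` at `x`. -/
def thirdPartials {d : ℕ} (f : EuclideanSpace ℝ (Fin d) → ℝ) (x : EuclideanSpace ℝ (Fin d)) :
    Fin d → ℝ :=
  fun i => iteratedFDeriv ℝ 3 f x fun _ => basisVec i

/-- `θ` is the unique maximizer of `f`, near which `f` is three times continuously
differentiable, and the Hessian at `θ` is negative definite with maximal eigenvalue `-L`. -/
structure RegularMaximum {d : ℕ} (f : EuclideanSpace ℝ (Fin d) → ℝ)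
    (θ : EuclideanSpace ℝ (Fin d)) (L : ℝ) : Prop where
  unique_max : ∀ x, x ≠ θ → f x < f θ
  smooth : ∃ U : Set (EuclideanSpace ℝ (Fin d)), IsOpen U ∧ θ ∈ U ∧ ContDiffOn ℝ 3 f U
  neg_def : (-hessian f θ).PosDef
  max_eigenvalue : IsGreatest (spectrum ℝ (hessian f θ)) (-L)
  L_pos : 0 < L

/-- Assumptions on the step sizes. Here `l = lim n a_n` and `l' = lim n a'_n` may be `+∞`. -/
structure StepAssumption (a c a' : ℕ → ℝ) (m L α τ α' : ℝ) (l l' : EReal) : Prop where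
  alpha_mem : max (1 / 2) (2 / m) < α ∧ α ≤ 1
  a_GS : GS (-α) a
  tau_mem : 0 < τ ∧ τ < α / 2
  c_GS : GS (-τ) c
  lim_a : Tendsto (fun n : ℕ => (((n : ℝ) * a n : ℝ) : EReal)) atTop (𝓝 l)
  lt_l : ((max ((1 - 2 * τ) / (2 * L)) (2 * τ / L) : ℝ) : EReal) < l
  alpha'_mem : max (1 / 2) (2 / m) < α' ∧ α' ≤ 1
  a'_GS : GS (-α') a'
  rate_a : Tendsto (fun n : ℕ =>
    (√(a' n))⁻¹ * (a n * Real.log (∑ k ∈ Finset.Icc 1 n, a k) / c n ^ 2)) atTop (𝓝 0)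
  rate_c : Tendsto (fun n : ℕ => (a' n)⁻¹ * c n ^ 8) atTop (𝓝 0)
  lim_a' : Tendsto (fun n : ℕ => (((n : ℝ) * a' n : ℝ) : EReal)) atTop (𝓝 l')
  lt_l' : ((1 / 2 : ℝ) : EReal) < l'

/-- `Σ^(θ) = -(σ²/4) [D²f(θ) + (ξ/2) I]⁻¹` with `ξ = (1 - 2τ) lim (n a_n)⁻¹`, `l = lim n a_n`. -/
def covTheta {d : ℕ} (f : EuclideanSpace ℝ (Fin d) → ℝ) (θ : EuclideanSpace ℝ (Fin d))
    (σ τ : ℝ) (l : EReal) : Matrix (Fin d) (Fin d) ℝ :=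
  (-(σ ^ 2 / 4)) • (hessian f θ + (((1 - 2 * τ) * l⁻¹.toReal) / 2) • 1)⁻¹

/-- `Δ^(θ) = -(1/6) [D²f(θ) + (ζ/2) I]⁻¹ {∂³f/∂x_i³ (θ)}_i` with `ζ = 4τ lim (n a_n)⁻¹`,
`l = lim n a_n`. -/
def biasTheta {d : ℕ} (f : EuclideanSpace ℝ (Fin d) → ℝ) (θ : EuclideanSpace ℝ (Fin d))
    (τ : ℝ) (l : EReal) : EuclideanSpace ℝ (Fin d) :=
  WithLp.toLp 2 ((-(1 / 6 : ℝ)) •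
    ((hessian f θ + ((4 * τ * l⁻¹.toReal) / 2) • 1)⁻¹).mulVec (thirdPartials f θ))

/-- `Σ^(μ) = σ² / (δ (2 - ξ))` with `ξ = lim (n a'_n)⁻¹`, `l' = lim n a'_n`. -/
def varMu (δ : ℕ) (σ : ℝ) (l' : EReal) : ℝ := σ ^ 2 / (δ * (2 - l'⁻¹.toReal))

/-- The column vector of `ℝ^(d+1)` with blocks `x ∈ ℝ^d` and `y ∈ ℝ`. -/
def stack {d : ℕ} (x : EuclideanSpace ℝ (Fin d)) (y : ℝ) :
    EuclideanSpace ℝ (Fin d ⊕ Unit) :=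
  WithLp.toLp 2 (Sum.elim (fun i => x i) fun _ => y)

/-- The block-diagonal matrix with diagonal blocks `S` and `v`. -/
def blockCov {d : ℕ} (S : Matrix (Fin d) (Fin d) ℝ) (v : ℝ) :
    Matrix (Fin d ⊕ Unit) (Fin d ⊕ Unit) ℝ :=
  Matrix.fromBlocks S 0 0 (Matrix.of fun _ _ => v)

end

end KieferWolfowitz

/-! Write `H` for the Hessian at `θ`. The error splits as `θ_n - θ = ell_n + b_n + ρ_n`. The process
`ell` follows the linear recursion with matrix `1 + a_n H`, driven by the observation errors times
`a_n / (2 c_n)`. The deterministic sequence `b` follows the same recursion, driven by the bias `c_n²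
· biasVec` of the symmetric difference quotient. The rest `ρ` collects the Taylor errors. Their
natural sizes are `s_n = √a_n / c_n` for `ell` and `c_n²` for `b`; since `a_n⁻¹ c_n⁶ = (c_n² /
s_n)²`, the limit of this quantity decides whether bias or noise wins. In the same way `μ_n - μ` is
a linear noise-driven process `Lam` of size `√a'_n`, plus the effect of `f(θ_n) - f(θ)`, which is
quadratic in `θ_n - θ` because the gradient vanishes at the maximizer.

Everything rests on one scalar averaging principle (`eventually_le_of_recursion`,
`tendsto_of_recursion`): if `x_{n+1} = p_n x_n + γ_n h_n` with `1 - p_n ~ lam γ_n`, `v_n / v_{n+1} =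
1 + κ γ_n + o(γ_n)`, `κ < lam` and `h_n / v_n → h0`, then `x_n / v_n → h0 / (lam - κ)`. It gives the
limiting bias, the limiting variances, the moment bounds and the negligibility of the remainders;
the shifts `ξ/2` and `ζ/2` in the limits are the numbers `κ` of the normalizations.

For the Gaussian limit, an eigenbasis of `H` turns `ell` and `Lam` into a single diagonal recursion
whose noise has a nonrandom diagonal conditional covariance (`isWhiteNoise_noise`,
`sum_noiseCoeff_mul`). Its characteristic function is compared one step at a time with a Gaussian
one, and the accumulated error obeys a contracting recursion with negligible forcing
(`IsWhiteNoise.exists_charFun_error`). As the components are conditionally uncorrelated at each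
step, the two step sizes `a` and `a'` may be of different orders, and the two blocks are independent
in the limit.

The remainder needs no almost sure rate (`Rates.exists_dominating`). In the quadratic error `C ‖θ_n
- θ‖²` one factor tends to zero almost surely and the other is split along the decomposition: the
part in `ρ` is absorbed by the contraction, the part in `b` is `o(c_n²)`, and the part in `ell`
drives a scalar process `D` whose mean is `o(s_n)` by Cauchy-Schwarz. For the values, `‖ell‖² + D²`
has mean `O(a_n / c_n²) = o(√a'_n)`, and the other terms are `O(c_n⁴) = o(√a'_n)`. Then
`tendstoInDistribution_normalized` treats arbitrary normalizations, and the three assertions differ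
only in the limits `A`, `B`, `A'` inserted there. -/

namespace KieferWolfowitz

/-! ### Contracting scalar recursions -/

/-- A recursion contracting with rates `g n ≥ k / n` forgets its initial value. -/
lemma eventually_le_of_contracting {y g : ℕ → ℝ} {k δ : ℝ} (hk : 0 < k)
    (hg : ∀ᶠ n : ℕ in atTop, k / (n : ℝ) ≤ g n) (hg1 : ∀ᶠ n in atTop, g n ≤ 1)
    (hy : ∀ᶠ n in atTop, y (n + 1) ≤ (1 - g n) * y n + g n * δ) {ε : ℝ} (hε : 0 < ε) :
    ∀ᶠ n in atTop, y n ≤ δ + ε := by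
  obtain ⟨N, hN⟩ := eventually_atTop.1 ((hg.and hg1).and (hy.and (eventually_ge_atTop 1)))
  -- The positive part makes the bound nonnegative, so that `1 - g` may be replaced by the larger
  -- exponential. The exponents then add up to a tail of the harmonic series, which diverges.
  set A : ℝ := max (y N - δ) 0
  have key : ∀ j, y (N + j) - δ ≤ A * Real.exp (-∑ i ∈ Finset.range j, k / ((N + i : ℕ) : ℝ)) := by
    intro j
    induction j with
    | zero => simp [A]
    | succ j ih =>
      obtain ⟨⟨h1, h2⟩, h3, h4⟩ := hN (N + j) (by omega)
      have hA : 0 ≤ A := le_max_right _ _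
      have e1 : y (N + (j + 1)) - δ ≤ (1 - g (N + j)) * (y (N + j) - δ) := by
        have : N + (j + 1) = N + j + 1 := by ring
        rw [this]; linarith
      have e2 : 1 - g (N + j) ≤ Real.exp (-(k / ((N + j : ℕ) : ℝ))) := by
        have := Real.add_one_le_exp (-(k / ((N + j : ℕ) : ℝ)))
        linarith
      rw [Finset.sum_range_succ, neg_add, Real.exp_add, ← mul_assoc]
      refine e1.trans ((mul_le_mul_of_nonneg_left ih (by linarith)).trans ?_)
      rw [mul_comm]
      exact mul_le_mul_of_nonneg_left e2 (by positivity)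
  have hdiv : Tendsto (fun j => ∑ i ∈ Finset.range j, k / ((N + i : ℕ) : ℝ)) atTop atTop := by
    refine (not_summable_iff_tendsto_nat_atTop_of_nonneg (fun i => by positivity)).1 ?_
    intro hs
    have h1 : Summable fun i : ℕ => k / (i : ℝ) := by
      refine (summable_nat_add_iff N).1 ?_
      refine hs.congr fun i => ?_
      rw [add_comm]
    have h2 : Summable fun i : ℕ => (1 : ℝ) / (i : ℝ) := by
      refine (h1.mul_left k⁻¹).congr fun i => ?_
      field_simp
    exact Real.not_summable_one_div_natCast h2
  have hlim : Tendsto (fun j => A * Real.exp (-∑ i ∈ Finset.range j, k / ((N + i : ℕ) : ℝ)))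
      atTop (𝓝 0) := by
    have := (Real.tendsto_exp_neg_atTop_nhds_zero.comp hdiv).const_mul A
    simpa using this
  obtain ⟨J, hJ⟩ := eventually_atTop.1 (hlim.eventually (gt_mem_nhds hε))
  filter_upwards [eventually_ge_atTop (N + J)] with n hn
  obtain ⟨i, rfl⟩ := Nat.exists_eq_add_of_le (show N ≤ n by omega)
  have := key i
  have := hJ i (by omega)
  linarith

/-- Step sizes tending to zero at most as fast as `1 / n`. -/
structure IsStep (γ : ℕ → ℝ) : Prop where
  pos : ∀ n, 1 ≤ n → 0 < γ n
  tendsto_zero : Tendsto γ atTop (𝓝 0)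
  lower : ∃ k > 0, ∀ᶠ n : ℕ in atTop, k / (n : ℝ) ≤ γ n

/-- The positive sequence `v` satisfies `v n / v (n + 1) = 1 + κ γ n + o (γ n)`. -/
structure RegVar (γ v : ℕ → ℝ) (κ : ℝ) : Prop where
  pos : ∀ n, 1 ≤ n → 0 < v n
  lim : Tendsto (fun n => (v n / v (n + 1) - 1) / γ n) atTop (𝓝 κ)

lemma IsStep.eventually_pos {γ : ℕ → ℝ} (h : IsStep γ) : ∀ᶠ n in atTop, 0 < γ n :=
  (eventually_ge_atTop 1).mono h.pos

lemma RegVar.eventually_pos {γ v : ℕ → ℝ} {κ : ℝ} (h : RegVar γ v κ) : ∀ᶠ n in atTop, 0 < v n :=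
  (eventually_ge_atTop 1).mono h.pos

lemma RegVar.one (γ : ℕ → ℝ) : RegVar γ (fun _ => 1) 0 :=
  ⟨fun _ _ => one_pos, by simp⟩

lemma RegVar.tendsto_ratio {γ v : ℕ → ℝ} {κ : ℝ} (h : RegVar γ v κ) (hγ : IsStep γ) :
    Tendsto (fun n => v n / v (n + 1)) atTop (𝓝 1) := by
  have := (h.lim.mul hγ.tendsto_zero).add_const 1
  simp only [mul_zero, zero_add] at this
  refine this.congr' ?_
  filter_upwards [hγ.eventually_pos] with n hn
  field_simp; ring

/-- One-sided averaging lemma for contracting recursions. -/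
lemma eventually_le_of_recursion {γ v p h x : ℕ → ℝ} {lam κ h0 : ℝ} (hγ : IsStep γ)
    (hv : RegVar γ v κ) (hp : Tendsto (fun n => (1 - p n) / γ n) atTop (𝓝 lam)) (hκ : κ < lam)
    (hh : Tendsto (fun n => h n / v n) atTop (𝓝 h0))
    (hx : ∀ᶠ n in atTop, x (n + 1) ≤ p n * x n + γ n * h n) {ε : ℝ} (hε : 0 < ε) :
    ∀ᶠ n in atTop, x n / v n ≤ h0 / (lam - κ) + ε := by
  have hr := hv.tendsto_ratio hγ
  -- `g` is the contraction rate of the normalized sequence `x n / v n`; the drift of `v` lowers it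
  -- from `lam γ` to `(lam - κ) γ` to first order. After factoring out `g`, the forcing term tends
  -- to `h0 / (lam - κ)`.
  set g : ℕ → ℝ := fun n => 1 - p n * (v n / v (n + 1)) with hgdef
  have hlk : 0 < lam - κ := by linarith
  have hgγ : Tendsto (fun n => g n / γ n) atTop (𝓝 (lam - κ)) := by
    have := (hp.mul hr).sub hv.lim
    rw [mul_one] at this
    refine this.congr' ?_
    filter_upwards [hγ.eventually_pos] with n hn
    simp only [hgdef]; field_simp; ring
  have hg0 : Tendsto g atTop (𝓝 0) := by
    have := hgγ.mul hγ.tendsto_zero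
    simp only [mul_zero] at this
    refine this.congr' ?_
    filter_upwards [hγ.eventually_pos] with n hn
    field_simp
  obtain ⟨k, hk, hkγ⟩ := hγ.lower
  have hgl : ∀ᶠ n : ℕ in atTop, (k * ((lam - κ) / 2)) / (n : ℝ) ≤ g n := by
    filter_upwards [hkγ, hγ.eventually_pos, hgγ.eventually (lt_mem_nhds (half_lt_self hlk))]
      with n h1 h2 h3
    rw [lt_div_iff₀ h2] at h3
    calc k * ((lam - κ) / 2) / (n : ℝ) = ((lam - κ) / 2) * (k / n) := by ring
      _ ≤ ((lam - κ) / 2) * γ n := by gcongr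
      _ ≤ g n := h3.le
  have hg1 : ∀ᶠ n in atTop, g n ≤ 1 := (hg0.eventually (gt_mem_nhds one_pos)).mono fun _ h => h.le
  have hgpos : ∀ᶠ n in atTop, 0 < g n := by
    filter_upwards [hγ.eventually_pos, hgγ.eventually (lt_mem_nhds hlk)] with n h2 h3
    rw [lt_div_iff₀ h2] at h3
    simpa using h3
  have hδ : Tendsto (fun n => (v n / v (n + 1)) * (h n / v n) / (g n / γ n)) atTop
      (𝓝 (h0 / (lam - κ))) := by
    have := (hr.mul hh).div hgγ hlk.ne'
    rw [one_mul] at this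
    exact this
  have hrec : ∀ᶠ n in atTop, x (n + 1) / v (n + 1) ≤
      (1 - g n) * (x n / v n) + g n * (h0 / (lam - κ) + ε / 2) := by
    filter_upwards [hx, hγ.eventually_pos, hgpos, eventually_ge_atTop 1,
      hδ.eventually (gt_mem_nhds (show h0 / (lam - κ) < h0 / (lam - κ) + ε / 2 by linarith))]
      with n h1 h2 h3 h4 h5
    have hv0 := hv.pos n h4
    have hv1 := hv.pos (n + 1) (by omega)
    have e1 : x (n + 1) / v (n + 1) ≤ (p n * x n + γ n * h n) / v (n + 1) := by gcongr
    have e2 : (p n * x n + γ n * h n) / v (n + 1) = (1 - g n) * (x n / v n) +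
        g n * ((v n / v (n + 1)) * (h n / v n) / (g n / γ n)) := by
      have : 1 - g n = p n * (v n / v (n + 1)) := by simp [hgdef]
      rw [this]; field_simp
    rw [e2] at e1
    refine e1.trans ?_
    gcongr
  have := eventually_le_of_contracting (y := fun n => x n / v n) (by positivity) hgl hg1 hrec
    (half_pos hε)
  filter_upwards [this] with n hn
  linarith

/-- The one-sided bound applied to `x` and to `-x`. The limit is the fixed point of the averaged
recursion. -/
lemma tendsto_of_recursion {γ v p h x : ℕ → ℝ} {lam κ h0 : ℝ} (hγ : IsStep γ)
    (hv : RegVar γ v κ) (hp : Tendsto (fun n => (1 - p n) / γ n) atTop (𝓝 lam)) (hκ : κ < lam)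
    (hh : Tendsto (fun n => h n / v n) atTop (𝓝 h0))
    (hx : ∀ᶠ n in atTop, x (n + 1) = p n * x n + γ n * h n) :
    Tendsto (fun n => x n / v n) atTop (𝓝 (h0 / (lam - κ))) := by
  rw [Metric.tendsto_nhds]
  intro ε hε
  have h1 := eventually_le_of_recursion hγ hv hp hκ hh (hx.mono fun n h => h.le) (half_pos hε)
  have h2 := eventually_le_of_recursion (x := fun n => -x n) (h := fun n => -h n) (h0 := -h0)
    hγ hv hp hκ (by simpa [neg_div] using hh.neg)
    (hx.mono fun n h => by simp only [h]; linarith) (half_pos hε)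
  filter_upwards [h1, h2] with n h1 h2
  rw [Real.dist_eq, abs_lt]
  simp only [neg_div] at h2
  constructor <;> linarith

lemma tendsto_zero_of_recursion {γ v p h x : ℕ → ℝ} {lam κ : ℝ} (hγ : IsStep γ)
    (hv : RegVar γ v κ) (hp : Tendsto (fun n => (1 - p n) / γ n) atTop (𝓝 lam)) (hκ : κ < lam)
    (hh : Tendsto (fun n => h n / v n) atTop (𝓝 0)) (hx0 : ∀ n, 0 ≤ x n)
    (hx : ∀ᶠ n in atTop, x (n + 1) ≤ p n * x n + γ n * h n) :
    Tendsto (fun n => x n / v n) atTop (𝓝 0) := by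
  rw [Metric.tendsto_nhds]
  intro ε hε
  have h1 := eventually_le_of_recursion hγ hv hp hκ hh hx (half_pos hε)
  filter_upwards [h1, hv.eventually_pos] with n h1 h2
  rw [Real.dist_eq, sub_zero, abs_of_nonneg (div_nonneg (hx0 n) h2.le)]
  rw [zero_div, zero_add] at h1
  linarith

/-- Eventual domination by a multiple of `v` of a nonnegative sequence, extended to all `n ≥ 1`. -/
lemma exists_bound_of_eventually_le {v x : ℕ → ℝ} {K : ℝ} (hv : ∀ n, 1 ≤ n → 0 < v n)
    (h : ∀ᶠ n in atTop, x n / v n ≤ K) : ∃ K' > 0, ∀ n, 1 ≤ n → x n ≤ K' * v n := by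
  obtain ⟨N, hN⟩ := eventually_atTop.1 h
  refine ⟨|K| + ∑ i ∈ Finset.range N, |x i / v i| + 1, by positivity, fun n hn => ?_⟩
  have hv := hv n hn
  rw [← div_le_iff₀ hv]
  by_cases hnN : N ≤ n
  · have := hN n hnN
    have := le_abs_self K
    have : 0 ≤ ∑ i ∈ Finset.range N, |x i / v i| := by positivity
    linarith
  · have h1 := Finset.single_le_sum (f := fun i => |x i / v i|) (fun i _ => abs_nonneg _)
      (Finset.mem_range.2 (not_le.1 hnN))
    have := le_abs_self (x n / v n)
    have := abs_nonneg K
    linarith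

lemma bound_of_recursion {γ v p x : ℕ → ℝ} {lam κ K : ℝ} (hγ : IsStep γ)
    (hv : RegVar γ v κ) (hp : Tendsto (fun n => (1 - p n) / γ n) atTop (𝓝 lam)) (hκ : κ < lam)
    (hx : ∀ᶠ n in atTop, x (n + 1) ≤ p n * x n + γ n * (K * v n)) :
    ∃ K' > 0, ∀ n, 1 ≤ n → x n ≤ K' * v n := by
  refine exists_bound_of_eventually_le hv.pos
    (eventually_le_of_recursion (h0 := K) (h := fun n => K * v n) hγ hv hp hκ ?_ hx one_pos)
  refine tendsto_const_nhds.congr' ?_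
  filter_upwards [hv.eventually_pos] with n hn
  field_simp

/-! ### The classes `GS` -/

lemma GS.tendsto_ratio {r : ℝ} {v : ℕ → ℝ} (h : GS r v) :
    Tendsto (fun n : ℕ => v (n - 1) / v n) atTop (𝓝 1) := by
  have h1 : Tendsto (fun n : ℕ => 1 - (n : ℝ) * (1 - v (n - 1) / v n) * (n : ℝ)⁻¹) atTop
      (𝓝 (1 - r * 0)) := (h.2.mul tendsto_inv_atTop_nhds_zero_nat).const_sub 1
  simp only [mul_zero, sub_zero] at h1
  refine h1.congr' ?_
  filter_upwards [eventually_ge_atTop 1] with n hn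
  have : (n : ℝ) ≠ 0 := by positivity
  field_simp; ring

lemma GS.mul {r s : ℝ} {v w : ℕ → ℝ} (hv : GS r v) (hw : GS s w) :
    GS (r + s) (fun n => v n * w n) := by
  refine ⟨fun n hn => mul_pos (hv.1 n hn) (hw.1 n hn), ?_⟩
  have := hv.2.add (hw.2.mul hv.tendsto_ratio)
  rw [mul_one] at this
  refine this.congr fun n => ?_
  rw [mul_div_mul_comm]; ring

lemma GS.inv {r : ℝ} {v : ℕ → ℝ} (hv : GS r v) : GS (-r) (fun n => (v n)⁻¹) := by
  refine ⟨fun n hn => inv_pos.2 (hv.1 n hn), ?_⟩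
  have := (hv.2.neg).div hv.tendsto_ratio one_ne_zero
  rw [div_one] at this
  refine this.congr' ?_
  filter_upwards [eventually_ge_atTop 2] with n hn
  have h1 := hv.1 n (by omega)
  have h2 := hv.1 (n - 1) (by omega)
  simp only [Pi.div_apply]
  field_simp; ring

/-- The exponent is halved because `1 - √x = (1 - x) / (1 + √x)` and the ratio `x` tends to one. -/
lemma GS.sqrt {r : ℝ} {v : ℕ → ℝ} (hv : GS r v) : GS (r / 2) (fun n => √(v n)) := by
  refine ⟨fun n hn => Real.sqrt_pos.2 (hv.1 n hn), ?_⟩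
  have h1 : Tendsto (fun n : ℕ => 1 + √(v (n - 1) / v n)) atTop (𝓝 (1 + √1)) :=
    ((Real.continuous_sqrt.tendsto 1).comp hv.tendsto_ratio).const_add 1
  have := hv.2.div h1 (by norm_num)
  rw [Real.sqrt_one, one_add_one_eq_two] at this
  refine this.congr' ?_
  filter_upwards [eventually_ge_atTop 2] with n hn
  have h1 := hv.1 n (by omega)
  have h2 := hv.1 (n - 1) (by omega)
  have h3 : 0 ≤ v (n - 1) / v n := by positivity
  rw [← Real.sqrt_div h2.le, Pi.div_apply, div_eq_iff (by positivity)]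
  nth_rw 1 [← Real.sq_sqrt h3]
  ring

lemma GS.sq {r : ℝ} {v : ℕ → ℝ} (hv : GS r v) : GS (2 * r) (fun n => v n ^ 2) := by
  have := hv.mul hv
  simpa only [two_mul, pow_two] using this

/-- A sequence of `GS (-r)` with `r > 0` tends to zero. -/
lemma GS.tendsto_zero {r : ℝ} {v : ℕ → ℝ} (hr : 0 < r) (hv : GS (-r) v) :
    Tendsto v atTop (𝓝 0) := by
  have hn : Tendsto (fun n : ℕ => (n : ℝ) * (1 - v n / v (n + 1))) atTop (𝓝 (-r)) := by
    have h1 := hv.2.comp (tendsto_add_atTop_nat 1)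
    have h2 := h1.sub ((hv.tendsto_ratio.comp (tendsto_add_atTop_nat 1)).const_sub 1)
    simp only [sub_self, sub_zero] at h2
    refine h2.congr fun n => ?_
    simp; ring
  have hinv : Tendsto (fun n : ℕ => v (n + 1) / v n) atTop (𝓝 1) := by
    have := (hv.tendsto_ratio.comp (tendsto_add_atTop_nat 1)).inv₀ one_ne_zero
    simpa using this
  have hm : Tendsto (fun n : ℕ => (n : ℝ) * (1 - v (n + 1) / v n)) atTop (𝓝 r) := by
    have := (hn.mul hinv).neg
    rw [mul_one, neg_neg] at this
    refine this.congr' ?_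
    filter_upwards [eventually_ge_atTop 1] with n hn
    have h1 := hv.1 n hn
    have h2 := hv.1 (n + 1) (by omega)
    field_simp; ring
  have hg0 : Tendsto (fun n : ℕ => 1 - v (n + 1) / v n) atTop (𝓝 0) := by
    simpa using hinv.const_sub 1
  rw [Metric.tendsto_nhds]
  intro ε hε
  -- The sequence `v` itself solves a contracting recursion without forcing, at the rate `1 - v (n +
  -- 1) / v n ~ r / n`.
  have := eventually_le_of_contracting (y := v) (g := fun n => 1 - v (n + 1) / v n) (δ := 0)
    (half_pos hr) (by
      filter_upwards [hm.eventually (lt_mem_nhds (half_lt_self hr)), eventually_ge_atTop 1]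
        with n h1 h2
      have : (0 : ℝ) < n := by positivity
      rw [div_le_iff₀ this, mul_comm]; exact h1.le)
    ((hg0.eventually (gt_mem_nhds one_pos)).mono fun _ h => h.le) (by
      filter_upwards [eventually_ge_atTop 1] with n hn
      have h1 := hv.1 n hn
      apply le_of_eq; field_simp; ring) (half_pos hε)
  filter_upwards [this, eventually_ge_atTop 1] with n h1 h2
  rw [Real.dist_eq, sub_zero, abs_of_pos (hv.1 n h2)]
  linarith

/-- This changes the clock from `1 / n` to `γ n`: relative increments of order `-r / n` become `-r
q` when measured in units of `γ n`. -/
lemma GS.regVar {r q : ℝ} {v γ : ℕ → ℝ} (hv : GS r v) (hγ : ∀ n, 1 ≤ n → 0 < γ n)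
    (hq : Tendsto (fun n : ℕ => ((n : ℝ) * γ n)⁻¹) atTop (𝓝 q)) : RegVar γ v (-r * q) := by
  refine ⟨hv.1, ?_⟩
  have h1 := hv.2.comp (tendsto_add_atTop_nat 1)
  have h2 := h1.sub ((hv.tendsto_ratio.comp (tendsto_add_atTop_nat 1)).const_sub 1)
  have h3 := h2.neg.mul hq
  simp only [sub_self, sub_zero] at h3
  refine h3.congr' ?_
  filter_upwards [eventually_ge_atTop 1] with n hn
  have := hγ n hn
  have : (0 : ℝ) < n := by positivity
  simp only [Function.comp, Nat.add_sub_cancel, Nat.cast_add, Nat.cast_one]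
  field_simp; ring

/-- The inverse of the limit `l` of `n a_n`, in the extended sense. -/
lemma tendsto_inv_of_ereal {a : ℕ → ℝ} {l : EReal} (hl : 0 < l)
    (h : Tendsto (fun n : ℕ => (((n : ℝ) * a n : ℝ) : EReal)) atTop (𝓝 l)) :
    Tendsto (fun n : ℕ => ((n : ℝ) * a n)⁻¹) atTop (𝓝 l⁻¹.toReal) := by
  induction l with
  | bot => simp at hl
  | coe x =>
    rw [EReal.tendsto_coe] at h
    rw [← EReal.coe_inv, EReal.toReal_coe]
    exact h.inv₀ (by exact_mod_cast hl.ne')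
  | top =>
    rw [EReal.tendsto_coe_nhds_top_iff] at h
    simpa only [EReal.inv_top, EReal.toReal_zero] using! h.inv_tendsto_atTop

lemma isStep_of_ereal {a : ℕ → ℝ} {l : EReal} {r : ℝ} (hr : 0 < r) (ha : GS (-r) a) (hl : 0 < l)
    (h : Tendsto (fun n : ℕ => (((n : ℝ) * a n : ℝ) : EReal)) atTop (𝓝 l)) : IsStep a := by
  refine ⟨ha.1, ha.tendsto_zero hr, ?_⟩
  obtain ⟨k, hk0, hkl⟩ := EReal.lt_iff_exists_real_btwn.1 hl
  refine ⟨k, by exact_mod_cast hk0, ?_⟩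
  filter_upwards [h.eventually (lt_mem_nhds hkl), eventually_ge_atTop 1] with n h1 h2
  have : (0 : ℝ) < n := by positivity
  rw [div_le_iff₀ this, mul_comm]
  exact_mod_cast h1.le

/-- If `n a_n` has a finite positive limit, then the exponent of `a` is one. -/
lemma one_sub_mul_inv_limit {a : ℕ → ℝ} {q r : ℝ} (hr : r ≤ 1) (ha : GS (-r) a)
    (hq : Tendsto (fun n : ℕ => ((n : ℝ) * a n)⁻¹) atTop (𝓝 q)) : (1 - r) * q = 0 := by
  -- For an exponent `r < 1` the sequence `(n a_n)⁻¹` has the negative exponent `-(1 - r)`, hence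
  -- tends to zero and `q = 0`.
  rcases hr.lt_or_eq with hr | rfl
  · have hn : GS (-1) (fun n : ℕ => (n : ℝ)⁻¹) := by
      have : GS 1 (fun n : ℕ => (n : ℝ)) := by
        refine ⟨fun n hn => by positivity, tendsto_const_nhds.congr' ?_⟩
        filter_upwards [eventually_ge_atTop 1] with n hn
        have : (n : ℝ) ≠ 0 := by positivity
        rw [Nat.cast_sub hn]
        field_simp; simp
      exact this.inv
    have h1 : GS (-(1 - r)) fun n : ℕ => (n : ℝ)⁻¹ * (a n)⁻¹ := by
      have := hn.mul ha.inv
      convert this using 1; ring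
    have h2 := h1.tendsto_zero (by linarith)
    have h3 : q = 0 := tendsto_nhds_unique hq (h2.congr fun n => by rw [mul_inv])
    simp [h3]
  · simp


/-- Sequences indexed by `n ≥ 1` defined by recursion. -/
lemma exists_seq_from_one {α : Type*} (x0 : α) (F : ℕ → α → α) :
    ∃ s : ℕ → α, s 0 = x0 ∧ s 1 = x0 ∧ ∀ n, 1 ≤ n → s (n + 1) = F n (s n) := by
  -- Truncated subtraction gives the unused index `0` the starting value too, so that measurability
  -- and integrability hold for every index.
  refine ⟨fun n => Nat.rec x0 (fun k y => F (k + 1) y) (n - 1), rfl, rfl, fun n hn => ?_⟩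
  obtain ⟨k, rfl⟩ := Nat.exists_eq_add_of_le' hn
  rfl

/-! ### A central limit theorem for linear recursions -/

/-- A family of square integrable martingale increments with constant, diagonal conditional
covariance and bounded moments of order `p ∈ (2, 3]`. Indexing starts at `n = 1`. -/
structure IsWhiteNoise {Ω J : Type*} [DecidableEq J] {mΩ : MeasurableSpace Ω} (P : Measure Ω)
    (𝓖 : ℕ → MeasurableSpace Ω) (ξ : ℕ → J → Ω → ℝ) (v : J → ℝ) (p : ℝ) : Prop where
  mono : Monotone 𝓖
  le : ∀ n, 𝓖 n ≤ mΩ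
  meas : ∀ n, 1 ≤ n → ∀ j, Measurable[𝓖 (n + 1)] (ξ n j)
  memLp_two : ∀ n, 1 ≤ n → ∀ j, MemLp (ξ n j) 2 P
  centered : ∀ n, 1 ≤ n → ∀ j, P[ξ n j|𝓖 n] =ᵐ[P] fun _ => 0
  cov : ∀ n, 1 ≤ n → ∀ j k, P[fun ω => ξ n j ω * ξ n k ω|𝓖 n] =ᵐ[P]
    fun _ => if j = k then v j else 0
  two_lt : 2 < p
  le_three : p ≤ 3
  integrable_moment : ∀ n, 1 ≤ n → ∀ j, Integrable (fun ω => |ξ n j ω| ^ p) P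
  moment : ∃ K > 0, ∀ n, 1 ≤ n → ∀ j, ∫ ω, |ξ n j ω| ^ p ∂P ≤ K

/-- A nonrandom conditional expectation factors out of an integral against anything known to `m`.
This serves for real `G` (cross terms of second moments) and complex `G` (characteristic functions).
-/
lemma integral_smul_of_condExp_const {Ω E : Type*} {m mΩ : MeasurableSpace Ω} {P : Measure Ω}
    [IsProbabilityMeasure P] [NormedAddCommGroup E] [NormedSpace ℝ E] [CompleteSpace E]
    (hm : m ≤ mΩ) {f : Ω → ℝ} (hf : Integrable f P) {c : ℝ}
    (hc : P[f|m] =ᵐ[P] fun _ => c) {G : Ω → E} (hG : StronglyMeasurable[m] G)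
    (hfG : Integrable (f • G) P) :
    ∫ ω, f ω • G ω ∂P = c • ∫ ω, G ω ∂P := by
  have h1 := condExp_smul_of_aestronglyMeasurable_right (μ := P) hf hfG hG.aestronglyMeasurable
  have h2 : ∫ ω, f ω • G ω ∂P = ∫ ω, (P[f • G|m]) ω ∂P := (integral_condExp hm).symm
  rw [h2, integral_congr_ae h1, ← integral_smul]
  refine integral_congr_ae ?_
  filter_upwards [hc] with ω hω
  simp [hω]

/-- For `|x| ≤ 1` the cubic Taylor error is at most a multiple of `|x| ^ p` since `p ≤ 3`; for `|x|
> 1` all terms are at most quadratic and `2 < p` suffices. -/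
lemma norm_exp_mul_I_sub_le {p : ℝ} (hp : 2 < p) (hp3 : p ≤ 3) (x : ℝ) :
    ‖Complex.exp (x * Complex.I) - (1 + x * Complex.I - (x : ℂ) ^ 2 / 2)‖ ≤ 4 * |x| ^ p := by
  have hnx : ‖(x : ℂ) * Complex.I‖ = |x| := by simp
  rcases le_or_gt |x| 1 with hx | hx
  · have h := Complex.exp_bound (x := (x : ℂ) * Complex.I) (by rw [hnx]; exact hx)
      (n := 3) (by norm_num)
    rw [hnx] at h
    have e : ∑ m ∈ Finset.range 3, ((x : ℂ) * Complex.I) ^ m / (m.factorial : ℂ) =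
        1 + x * Complex.I - (x : ℂ) ^ 2 / 2 := by
      simp [Finset.sum_range_succ, mul_pow, Nat.factorial]
      ring
    rw [e] at h
    refine h.trans ?_
    have h1 : |x| ^ (3 : ℕ) ≤ |x| ^ p := by
      rcases (abs_nonneg x).eq_or_lt with h0 | h0
      · rw [← h0, Real.zero_rpow (by linarith)]; norm_num
      · rw [← Real.rpow_natCast]
        exact Real.rpow_le_rpow_of_exponent_ge h0 hx (by exact_mod_cast hp3)
    have h2 : ((Nat.succ 3 : ℕ) : ℝ) * (((Nat.factorial 3 : ℕ) : ℝ) * ((3 : ℕ) : ℝ))⁻¹ ≤ 4 := by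
      norm_num [Nat.factorial]
    have h3 : 0 ≤ |x| ^ p := by positivity
    nlinarith [pow_nonneg (abs_nonneg x) 3]
  · have h1 : |x| ^ (2 : ℕ) ≤ |x| ^ p := by
      rw [← Real.rpow_natCast]
      exact Real.rpow_le_rpow_of_exponent_le hx.le (by exact_mod_cast hp.le)
    have h2 : ‖Complex.exp (x * Complex.I)‖ = 1 := Complex.norm_exp_ofReal_mul_I x
    have h3 : ‖(1 + x * Complex.I - (x : ℂ) ^ 2 / 2)‖ ≤ 1 + |x| + |x| ^ 2 / 2 := by
      refine (norm_sub_le _ _).trans (add_le_add ((norm_add_le _ _).trans ?_) ?_)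
      · simp
      · simp
    have h4 := norm_sub_le (Complex.exp (x * Complex.I)) (1 + x * Complex.I - (x : ℂ) ^ 2 / 2)
    nlinarith

section

variable {Ω J : Type*} [DecidableEq J] {mΩ : MeasurableSpace Ω} {P : Measure Ω}
  {𝓖 : ℕ → MeasurableSpace Ω} {ξ : ℕ → J → Ω → ℝ} {v : J → ℝ} {p : ℝ}

lemma IsWhiteNoise.integrable [IsProbabilityMeasure P] (h : IsWhiteNoise P 𝓖 ξ v p) {n : ℕ}
    (hn : 1 ≤ n) (j : J) : Integrable (ξ n j) P :=
  (h.memLp_two n hn j).integrable (by norm_num)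

lemma IsWhiteNoise.integrable_mul (h : IsWhiteNoise P 𝓖 ξ v p) {n : ℕ}
    (hn : 1 ≤ n) (j k : J) : Integrable (fun ω => ξ n j ω * ξ n k ω) P :=
  (h.memLp_two n hn j).integrable_mul (h.memLp_two n hn k)

/-- Adaptedness of the solution of a linear recursion. -/
lemma IsWhiteNoise.measurable_linear (h : IsWhiteNoise P 𝓖 ξ v p) {j : J} {x : ℕ → Ω → ℝ}
    {ρ b : ℕ → ℝ} (hx1 : x 1 = 0)
    (hx : ∀ n, 1 ≤ n → ∀ ω, x (n + 1) ω = ρ n * x n ω + b n * ξ n j ω) {n : ℕ} (hn : 1 ≤ n) :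
    Measurable[𝓖 n] (x n) := by
  induction n, hn using Nat.le_induction with
  | base => rw [hx1]; exact measurable_const
  | succ n hn ih =>
    have e : x (n + 1) = fun ω => ρ n * x n ω + b n * ξ n j ω := funext (hx n hn)
    rw [e]
    exact ((ih.mono (h.mono n.le_succ) le_rfl).const_mul _).add ((h.meas n hn j).const_mul _)

lemma IsWhiteNoise.memLp_linear (h : IsWhiteNoise P 𝓖 ξ v p) {j : J} {x : ℕ → Ω → ℝ}
    {ρ b : ℕ → ℝ} (hx1 : x 1 = 0)
    (hx : ∀ n, 1 ≤ n → ∀ ω, x (n + 1) ω = ρ n * x n ω + b n * ξ n j ω) {n : ℕ} (hn : 1 ≤ n) :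
    MemLp (x n) 2 P := by
  induction n, hn using Nat.le_induction with
  | base => rw [hx1]; exact MemLp.zero
  | succ n hn ih =>
    have e : x (n + 1) = fun ω => ρ n * x n ω + b n * ξ n j ω := funext (hx n hn)
    rw [e]
    exact (ih.const_mul _).add ((h.memLp_two n hn j).const_mul _)

/-- The second moment of the solution of a linear recursion. -/
lemma IsWhiteNoise.integral_sq_linear [IsProbabilityMeasure P] (h : IsWhiteNoise P 𝓖 ξ v p) {j : J}
    {x : ℕ → Ω → ℝ} {ρ b : ℕ → ℝ} (hx1 : x 1 = 0)
    (hx : ∀ n, 1 ≤ n → ∀ ω, x (n + 1) ω = ρ n * x n ω + b n * ξ n j ω) {n : ℕ} (hn : 1 ≤ n) :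
    ∫ ω, x (n + 1) ω ^ 2 ∂P = ρ n ^ 2 * ∫ ω, x n ω ^ 2 ∂P + b n ^ 2 * v j := by
  have hm := h.measurable_linear hx1 hx hn
  have hL := h.memLp_linear hx1 hx hn
  have hξ := h.memLp_two n hn j
  have hcross : ∫ ω, ξ n j ω * x n ω ∂P = 0 := by
    have := integral_smul_of_condExp_const (h.le n) (h.integrable hn j) (h.centered n hn j)
      (G := x n) hm.stronglyMeasurable (hξ.integrable_mul hL)
    simpa using this
  have hsq : ∫ ω, ξ n j ω * ξ n j ω ∂P = v j := by
    have := integral_smul_of_condExp_const (h.le n) (h.integrable_mul hn j j) (h.cov n hn j j)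
      (G := fun _ => (1 : ℝ)) stronglyMeasurable_const (by
        simpa [Pi.mul_def] using h.integrable_mul hn j j)
    simpa using this
  have e : ∀ ω, x (n + 1) ω ^ 2 = (ρ n ^ 2 * x n ω ^ 2 + 2 * ρ n * b n * (ξ n j ω * x n ω)) +
      b n ^ 2 * (ξ n j ω * ξ n j ω) := fun ω => by rw [hx n hn]; ring
  simp_rw [e]
  have i1 : Integrable (fun ω => ρ n ^ 2 * x n ω ^ 2) P := hL.integrable_sq.const_mul _
  have i2 : Integrable (fun ω => 2 * ρ n * b n * (ξ n j ω * x n ω)) P :=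
    (hξ.integrable_mul hL).const_mul _
  have i3 : Integrable (fun ω => b n ^ 2 * (ξ n j ω * ξ n j ω)) P :=
    (hξ.integrable_mul hξ).const_mul _
  have i12 : Integrable (fun ω => ρ n ^ 2 * x n ω ^ 2 + 2 * ρ n * b n * (ξ n j ω * x n ω)) P :=
    i1.add i2
  rw [integral_add i12 i3, integral_add i1 i2, integral_const_mul, integral_const_mul,
    integral_const_mul, hcross, hsq]
  ring

variable [Fintype J]

lemma IsWhiteNoise.abs_sum_rpow_le (h : IsWhiteNoise P 𝓖 ξ v p) (β : J → ℝ) (n : ℕ) (ω : Ω) :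
    |∑ j, β j * ξ n j ω| ^ p ≤
      (Fintype.card J : ℝ) ^ (p - 1) * ∑ j, |β j| ^ p * |ξ n j ω| ^ p := by
  have hp := h.two_lt
  have h2 := Real.rpow_sum_le_const_mul_sum_rpow (p := p) Finset.univ (fun j => β j * ξ n j ω)
    (by linarith)
  simp only [abs_mul] at h2
  refine (Real.rpow_le_rpow (abs_nonneg _) (Finset.abs_sum_le_sum_abs _ _) (by linarith)).trans ?_
  simp only [abs_mul]
  refine h2.trans (le_of_eq ?_)
  rw [Finset.card_univ]
  congr 1
  exact Finset.sum_congr rfl fun j _ => Real.mul_rpow (abs_nonneg _) (abs_nonneg _)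

lemma IsWhiteNoise.integrable_abs_sum_rpow (h : IsWhiteNoise P 𝓖 ξ v p) (β : J → ℝ) {n : ℕ}
    (hn : 1 ≤ n) : Integrable (fun ω => |∑ j, β j * ξ n j ω| ^ p) P := by
  have hp := h.two_lt
  have hmeas : Measurable fun ω => ∑ j, β j * ξ n j ω :=
    Finset.measurable_sum _ fun j _ => ((h.meas n hn j).mono (h.le _) le_rfl).const_mul _
  refine Integrable.mono' (g := fun ω =>
    (Fintype.card J : ℝ) ^ (p - 1) * ∑ j, |β j| ^ p * |ξ n j ω| ^ p) ?_ ?_ ?_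
  · exact (integrable_finsetSum _ fun j _ => (h.integrable_moment n hn j).const_mul _).const_mul _
  · exact (hmeas.norm.pow_const p).aestronglyMeasurable
  · refine ae_of_all _ fun ω => ?_
    rw [Real.norm_of_nonneg (by positivity)]
    exact h.abs_sum_rpow_le β n ω

/-- One step of the characteristic function method. -/
lemma IsWhiteNoise.norm_integral_exp_add_sub_le [IsProbabilityMeasure P]
    (h : IsWhiteNoise P 𝓖 ξ v p) {n : ℕ} (hn : 1 ≤ n) {S : Ω → ℝ} (hS : Measurable[𝓖 n] S)
    (β : J → ℝ) :
    ‖∫ ω, Complex.exp (((S ω + ∑ j, β j * ξ n j ω : ℝ) : ℂ) * Complex.I) ∂P -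
      (1 - ((∑ j, β j ^ 2 * v j : ℝ) : ℂ) / 2) * ∫ ω, Complex.exp ((S ω : ℂ) * Complex.I) ∂P‖ ≤
      4 * ∫ ω, |∑ j, β j * ξ n j ω| ^ p ∂P := by
  set x : Ω → ℝ := fun ω => ∑ j, β j * ξ n j ω with hx
  set G : Ω → ℂ := fun ω => Complex.exp ((S ω : ℂ) * Complex.I) with hG
  have hGm : Measurable[𝓖 n] G := by
    refine Complex.measurable_exp.comp ?_
    exact (Complex.measurable_ofReal.comp hS).mul_const _
  have hGm' : Measurable G := hGm.mono (h.le n) le_rfl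
  have hGb : ∀ ω, ‖G ω‖ ≤ 1 := fun ω => (Complex.norm_exp_ofReal_mul_I _).le
  have hGi : Integrable G P := Integrable.of_bound hGm'.aestronglyMeasurable 1 (ae_of_all _ hGb)
  have hxm : Measurable x :=
    Finset.measurable_sum _ fun j _ => ((h.meas n hn j).mono (h.le _) le_rfl).const_mul _
  have hxL : MemLp x 2 P :=
    memLp_finsetSum _ fun j _ => (h.memLp_two n hn j).const_mul _
  have hxi : Integrable x P := hxL.integrable (by norm_num)
  have hx2i : Integrable (fun ω => x ω ^ 2) P := hxL.integrable_sq
  have hsm : ∀ {f : Ω → ℝ}, Integrable f P → Integrable (f • G) P := fun {f} hf =>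
    hf.smul_of_top_left (memLp_top_of_bound hGm'.aestronglyMeasurable 1 (ae_of_all _ hGb))
  have hx0 : P[x|𝓖 n] =ᵐ[P] fun _ => 0 := by
    have e : x = ∑ j, β j • ξ n j := by ext ω; simp [hx]
    rw [e]
    refine (condExp_finsetSum (fun j _ => (h.integrable hn j).smul (β j)) _).trans ?_
    have := fun j => (condExp_smul (μ := P) (β j) (ξ n j) (𝓖 n)).trans
      ((h.centered n hn j).const_smul (β j))
    have h2 := eventually_all.2 this
    filter_upwards [h2] with ω hω
    simp [Finset.sum_apply, hω]
  have hx2 : P[fun ω => x ω ^ 2|𝓖 n] =ᵐ[P] fun _ => ∑ j, β j ^ 2 * v j := by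
    have e : (fun ω => x ω ^ 2) =
        ∑ j, ∑ k, (β j * β k) • (fun ω => ξ n j ω * ξ n k ω) := by
      ext ω
      simp only [hx, sq, Finset.sum_mul_sum, Finset.sum_apply, Pi.smul_apply, smul_eq_mul]
      refine Finset.sum_congr rfl fun j _ => Finset.sum_congr rfl fun k _ => ?_
      ring
    rw [e]
    have i1 : ∀ j k, Integrable ((β j * β k) • (fun ω => ξ n j ω * ξ n k ω)) P :=
      fun j k => (h.integrable_mul hn j k).smul _
    refine (condExp_finsetSum (fun j _ => integrable_finsetSum' _ fun k _ => i1 j k) _).trans ?_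
    have h1 : ∀ j, P[∑ k, (β j * β k) • (fun ω => ξ n j ω * ξ n k ω)|𝓖 n] =ᵐ[P]
        ∑ k, P[(β j * β k) • (fun ω => ξ n j ω * ξ n k ω)|𝓖 n] :=
      fun j => condExp_finsetSum (fun k _ => i1 j k) _
    have h2 : ∀ j k, P[(β j * β k) • (fun ω => ξ n j ω * ξ n k ω)|𝓖 n] =ᵐ[P]
        fun _ => if j = k then β j ^ 2 * v j else 0 := by
      intro j k
      refine (condExp_smul _ _ _).trans ?_
      filter_upwards [h.cov n hn j k] with ω hω
      simp only [Pi.smul_apply, hω, smul_eq_mul]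
      split_ifs with hjk
      · subst hjk; ring
      · simp
    filter_upwards [eventually_all.2 h1, eventually_all.2 fun j => eventually_all.2 (h2 j)]
      with ω hω1 hω2
    simp [Finset.sum_apply, hω1, hω2]
  -- In the second order expansion of the exponential of the increment, centering removes the linear
  -- term, and the nonrandom conditional covariance makes the quadratic term a multiple of the
  -- previous characteristic function.
  have I1 : ∫ ω, x ω • G ω ∂P = 0 := by
    rw [integral_smul_of_condExp_const (h.le n) hxi hx0 hGm.stronglyMeasurable (hsm hxi), zero_smul]
  have I2 : ∫ ω, (x ω ^ 2) • G ω ∂P = ((∑ j, β j ^ 2 * v j : ℝ) : ℂ) * ∫ ω, G ω ∂P := by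
    have := integral_smul_of_condExp_const (h.le n) hx2i hx2 hGm.stronglyMeasurable (hsm hx2i)
    simpa using this
  have hEi : Integrable (fun ω => Complex.exp (((S ω + x ω : ℝ) : ℂ) * Complex.I)) P := by
    refine Integrable.of_bound (C := 1) ?_ (ae_of_all _ fun ω =>
      (Complex.norm_exp_ofReal_mul_I _).le)
    refine (Complex.measurable_exp.comp ?_).aestronglyMeasurable
    exact (Complex.measurable_ofReal.comp ((hS.mono (h.le n) le_rfl).add hxm)).mul_const _
  have key : ∫ ω, Complex.exp (((S ω + x ω : ℝ) : ℂ) * Complex.I) ∂P -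
      (1 - ((∑ j, β j ^ 2 * v j : ℝ) : ℂ) / 2) * ∫ ω, G ω ∂P =
      ∫ ω, (Complex.exp ((x ω : ℂ) * Complex.I) -
        (1 + x ω * Complex.I - (x ω : ℂ) ^ 2 / 2)) * G ω ∂P := by
    have e : ∀ ω, (Complex.exp ((x ω : ℂ) * Complex.I) -
        (1 + x ω * Complex.I - (x ω : ℂ) ^ 2 / 2)) * G ω =
        Complex.exp (((S ω + x ω : ℝ) : ℂ) * Complex.I) -
          ((G ω + Complex.I * (x ω • G ω)) - (1 / 2 : ℂ) * ((x ω ^ 2) • G ω)) := by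
      intro ω
      simp only [hG, Complex.real_smul]
      push_cast
      rw [add_mul, Complex.exp_add]
      ring
    simp_rw [e]
    have j1 : Integrable (fun ω => Complex.I * (x ω • G ω)) P := (hsm hxi).const_mul _
    have j2 : Integrable (fun ω => (1 / 2 : ℂ) * ((x ω ^ 2) • G ω)) P := (hsm hx2i).const_mul _
    have j3 : Integrable (fun ω => G ω + Complex.I * (x ω • G ω)) P := hGi.add j1
    have j4 : Integrable (fun ω => G ω + Complex.I * (x ω • G ω) -
      (1 / 2 : ℂ) * ((x ω ^ 2) • G ω)) P := j3.sub j2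
    rw [integral_sub hEi j4, integral_sub j3 j2,
      integral_add hGi j1, integral_const_mul, integral_const_mul, I1, I2]
    ring
  rw [key]
  refine (norm_integral_le_integral_norm _).trans ?_
  rw [← integral_const_mul]
  refine integral_mono_of_nonneg (ae_of_all _ fun ω => norm_nonneg _)
    ((h.integrable_abs_sum_rpow β hn).const_mul _) (ae_of_all _ fun ω => ?_)
  simp only [norm_mul]
  have := norm_exp_mul_I_sub_le h.two_lt h.le_three (x ω)
  calc _ ≤ (4 * |x ω| ^ p) * 1 := by
        gcongr
        exact hGb ω
    _ = _ := mul_one _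

/-- The cost of turning the factor `1 - u` contributed by one step into the Gaussian factor `exp
(-u)`. -/
lemma abs_one_sub_sub_exp_neg_le {u : ℝ} (hu : 0 ≤ u) : |1 - u - Real.exp (-u)| ≤ u ^ 2 := by
  have h1 := Real.one_sub_le_exp_neg u
  rw [abs_of_nonpos (by linarith)]
  rcases le_or_gt u 1 with h | h
  · have h2 : Real.exp (-u) ≤ 1 + (-u) + (-u) ^ 2 := by
      have := Real.abs_exp_sub_one_sub_id_le (x := -u) (by rw [abs_neg, abs_of_nonneg hu]; exact h)
      have := (abs_le.1 this).2
      linarith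
    nlinarith
  · have : Real.exp (-u) ≤ 1 := Real.exp_le_one_iff.2 (by linarith)
    nlinarith

/-- The error made when the Gaussian characteristic function replaces the actual one. -/
lemma IsWhiteNoise.exists_charFun_error [IsProbabilityMeasure P] (h : IsWhiteNoise P 𝓖 ξ v p)
    (hv0 : ∀ j, 0 ≤ v j) {X : ℕ → J → Ω → ℝ} {ρ b V : J → ℕ → ℝ} (hX1 : ∀ j, X 1 j = 0)
    (hX : ∀ n, 1 ≤ n → ∀ j ω, X (n + 1) j ω = ρ j n * X n j ω + b j n * ξ n j ω)
    (hV1 : ∀ j, V j 1 = 0)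
    (hV : ∀ n, 1 ≤ n → ∀ j, V j (n + 1) = ρ j n ^ 2 * V j n + b j n ^ 2 * v j) :
    ∃ C > 0, ∀ η : J → ℕ → ℝ, (∀ j, η j 1 = 0) →
      (∀ n, 1 ≤ n → ∀ j, η j (n + 1) = max (ρ j n ^ 2) (ρ j n ^ 4) * η j n +
        C * (|b j n| ^ p + b j n ^ 4)) →
      ∀ n, 1 ≤ n → ∀ t : J → ℝ,
        ‖∫ ω, Complex.exp (((∑ j, t j * X n j ω : ℝ) : ℂ) * Complex.I) ∂P -
          Complex.exp (-((∑ j, t j ^ 2 * V j n : ℝ) : ℂ) / 2)‖ ≤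
        ∑ j, η j n * (|t j| ^ p + t j ^ 4) := by
  have hp := h.two_lt
  have hp3 := h.le_three
  obtain ⟨K, hK0, hK⟩ := h.moment
  set C1 : ℝ := 4 * (Fintype.card J : ℝ) ^ (p - 1) * K with hC1
  set C2 : ℝ := Fintype.card J * ∑ j, v j ^ 2 with hC2
  have hC1' : 0 ≤ C1 := by positivity
  have hC2' : 0 ≤ C2 := by positivity
  -- `C1` pays for the Taylor error and `C2` for replacing `1 - u` by `exp (-u)`; the `1` only
  -- ensures positivity.
  refine ⟨C1 + C2 + 1, by positivity, fun η hη1 hη n hn => ?_⟩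
  have hη0 : ∀ n, 1 ≤ n → ∀ j, 0 ≤ η j n := by
    intro n hn
    induction n, hn using Nat.le_induction with
    | base => intro j; rw [hη1]
    | succ n hn ih =>
      intro j
      rw [hη n hn]
      have := ih j
      have : 0 ≤ b j n ^ 4 := by positivity
      have : 0 ≤ max (ρ j n ^ 2) (ρ j n ^ 4) := le_max_of_le_left (sq_nonneg _)
      positivity
  induction n, hn using Nat.le_induction with
  | base =>
    intro t
    simp [hX1, hV1, hη1]
  | succ n hn ih =>
    intro t
    -- One step of the recursion moves the frequency from `t` to `t'`, which is why the induction
    -- hypothesis is kept for all frequencies.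
    set t' : J → ℝ := fun j => t j * ρ j n
    set β : J → ℝ := fun j => t j * b j n
    set S : Ω → ℝ := fun ω => ∑ j, t' j * X n j ω
    have hS : Measurable[𝓖 n] S := Finset.measurable_sum _ fun j _ =>
      (h.measurable_linear (x := fun n => X n j) (hX1 j) (fun n hn ω => hX n hn j ω) hn).const_mul _
    have e1 : ∀ ω, ∑ j, t j * X (n + 1) j ω = S ω + ∑ j, β j * ξ n j ω := by
      intro ω
      simp only [S, β, t', ← Finset.sum_add_distrib]
      refine Finset.sum_congr rfl fun j _ => ?_
      rw [hX n hn]; ring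
    set u : ℝ := (∑ j, β j ^ 2 * v j) / 2 with hu
    have hu0 : 0 ≤ u := by
      have : 0 ≤ ∑ j, β j ^ 2 * v j :=
        Finset.sum_nonneg fun j _ => mul_nonneg (sq_nonneg _) (hv0 j)
      positivity
    have e2 : Complex.exp (-((∑ j, t j ^ 2 * V j (n + 1) : ℝ) : ℂ) / 2) =
        ((Real.exp (-u) : ℝ) : ℂ) * Complex.exp (-((∑ j, t' j ^ 2 * V j n : ℝ) : ℂ) / 2) := by
      rw [Complex.ofReal_exp, ← Complex.exp_add]
      congr 1
      have : ∑ j, t j ^ 2 * V j (n + 1) = (∑ j, t' j ^ 2 * V j n) + 2 * u := by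
        rw [hu, mul_div_cancel₀ _ (two_ne_zero), ← Finset.sum_add_distrib]
        refine Finset.sum_congr rfl fun j _ => ?_
        simp only [t', β]
        rw [hV n hn]; ring
      rw [this]; push_cast; ring
    simp_rw [e1]
    rw [e2]
    set φ : ℂ := ∫ ω, Complex.exp ((S ω : ℂ) * Complex.I) ∂P with hφ
    set g : ℂ := Complex.exp (-((∑ j, t' j ^ 2 * V j n : ℝ) : ℂ) / 2)
    have s1 := h.norm_integral_exp_add_sub_le hn hS β
    rw [← hφ] at s1
    have s2 : ‖φ - g‖ ≤ ∑ j, η j n * (|t' j| ^ p + t' j ^ 4) := ih t'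
    have hφ1 : ‖φ‖ ≤ 1 := by
      refine (norm_integral_le_integral_norm _).trans (le_of_eq ?_)
      simp [Complex.norm_exp_ofReal_mul_I]
    have s3 : ‖((1 - u - Real.exp (-u) : ℝ) : ℂ)‖ ≤ u ^ 2 := by
      rw [Complex.norm_real]; exact abs_one_sub_sub_exp_neg_le hu0
    have s4 : ‖((Real.exp (-u) : ℝ) : ℂ)‖ ≤ 1 := by
      rw [Complex.norm_real, Real.norm_of_nonneg (Real.exp_pos _).le]
      exact Real.exp_le_one_iff.2 (by linarith)
    -- The three sources of error: the expansion of the last increment, the passage from `1 - u` to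
    -- `exp (-u)`, and the inherited error at frequency `t'`.
    have dec : ∀ A : ℂ, A - ((Real.exp (-u) : ℝ) : ℂ) * g =
        (A - (1 - ((∑ j, β j ^ 2 * v j : ℝ) : ℂ) / 2) * φ) +
          ((1 - u - Real.exp (-u) : ℝ) : ℂ) * φ + ((Real.exp (-u) : ℝ) : ℂ) * (φ - g) := by
      intro A
      have : ((∑ j, β j ^ 2 * v j : ℝ) : ℂ) / 2 = (u : ℂ) := by rw [hu]; push_cast; ring
      rw [this]; push_cast; ring
    rw [dec]
    have m1 : ∫ ω, |∑ j, β j * ξ n j ω| ^ p ∂P ≤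
        (Fintype.card J : ℝ) ^ (p - 1) * ∑ j, |β j| ^ p * K := by
      have := integral_mono (h.integrable_abs_sum_rpow β hn)
        ((integrable_finsetSum Finset.univ fun j _ =>
          (h.integrable_moment n hn j).const_mul (|β j| ^ p)).const_mul
          ((Fintype.card J : ℝ) ^ (p - 1))) (fun ω => h.abs_sum_rpow_le β n ω)
      refine this.trans ?_
      rw [integral_const_mul, integral_finsetSum _ fun j _ =>
          (h.integrable_moment n hn j).const_mul (|β j| ^ p)]
      gcongr with j
      rw [integral_const_mul]
      gcongr
      exact hK n hn j
    have m2 : u ^ 2 ≤ C2 * ∑ j, β j ^ 4 := by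
      have h1 : (∑ j, β j ^ 2 * v j) ^ 2 ≤ (∑ j, (β j ^ 2) ^ 2) * ∑ j, v j ^ 2 :=
        Finset.sum_mul_sq_le_sq_mul_sq _ _ _
      have h2 : (∑ j, (β j ^ 2) ^ 2) = ∑ j, β j ^ 4 :=
        Finset.sum_congr rfl fun j _ => by ring
      rw [h2] at h1
      rcases isEmpty_or_nonempty J with hJ | hJ
      · simp [hu]
      have h3 : (1 : ℝ) ≤ Fintype.card J := by exact_mod_cast Fintype.card_pos
      have h4 : 0 ≤ (∑ j, β j ^ 4) * ∑ j, v j ^ 2 :=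
        mul_nonneg (Finset.sum_nonneg fun j _ => by positivity)
          (Finset.sum_nonneg fun j _ => by positivity)
      have h5 : C2 * ∑ j, β j ^ 4 = Fintype.card J * ((∑ j, β j ^ 4) * ∑ j, v j ^ 2) := by
        rw [hC2]; ring
      rw [h5, hu, div_pow]
      nlinarith
    -- The inherited error contracts: as `2 < p ≤ 4`, the power `|ρ| ^ p` is at most `ρ ^ 2` when
    -- `|ρ| ≤ 1` and at most `ρ ^ 4` otherwise.
    have m3 : ∀ j, |t' j| ^ p + t' j ^ 4 ≤
        max (ρ j n ^ 2) (ρ j n ^ 4) * (|t j| ^ p + t j ^ 4) := by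
      intro j
      have hr : |ρ j n| ^ p ≤ max (ρ j n ^ 2) (ρ j n ^ 4) := by
        rcases le_or_gt |ρ j n| 1 with h1 | h1
        · refine le_max_of_le_left ?_
          rw [← sq_abs, ← Real.rpow_natCast]
          rcases (abs_nonneg (ρ j n)).eq_or_lt with h0 | h0
          · rw [← h0, Real.zero_rpow (by linarith)]; positivity
          · exact Real.rpow_le_rpow_of_exponent_ge h0 h1 (by exact_mod_cast hp.le)
        · refine le_max_of_le_right ?_
          rw [← Even.pow_abs (by decide : Even 4), ← Real.rpow_natCast]
          exact Real.rpow_le_rpow_of_exponent_le h1.le (by push_cast; linarith)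
      have hr4 : ρ j n ^ 4 ≤ max (ρ j n ^ 2) (ρ j n ^ 4) := le_max_right _ _
      simp only [t', abs_mul, mul_pow]
      rw [Real.mul_rpow (abs_nonneg _) (abs_nonneg _), mul_add]
      have h1 : 0 ≤ |t j| ^ p := by positivity
      have h2 : 0 ≤ t j ^ 4 := by positivity
      nlinarith
    calc _ ≤ 4 * ((Fintype.card J : ℝ) ^ (p - 1) * ∑ j, |β j| ^ p * K) +
          (C2 * ∑ j, β j ^ 4) * 1 + 1 * ∑ j, η j n * (|t' j| ^ p + t' j ^ 4) := by
          refine (norm_add_le _ _).trans (add_le_add ((norm_add_le _ _).trans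
            (add_le_add (s1.trans ?_) ?_)) ?_)
          · gcongr
          · rw [norm_mul]
            exact mul_le_mul (s3.trans m2) hφ1 (norm_nonneg _) (by positivity)
          · rw [norm_mul]
            exact mul_le_mul s4 s2 (norm_nonneg _) zero_le_one
      _ = ∑ j, (C1 * |β j| ^ p + C2 * β j ^ 4 + η j n * (|t' j| ^ p + t' j ^ 4)) := by
          rw [Finset.sum_add_distrib, Finset.sum_add_distrib, ← Finset.mul_sum, ← Finset.mul_sum,
            ← Finset.sum_mul, hC1]
          ring
      _ ≤ ∑ j, η j (n + 1) * (|t j| ^ p + t j ^ 4) := by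
          refine Finset.sum_le_sum fun j _ => ?_
          rw [hη n hn]
          have a1 := mul_le_mul_of_nonneg_left (m3 j) (hη0 n hn j)
          have a2 : |β j| ^ p = |t j| ^ p * |b j n| ^ p := by
            simp only [β, abs_mul]; rw [Real.mul_rpow (abs_nonneg _) (abs_nonneg _)]
          have a3 : β j ^ 4 = t j ^ 4 * b j n ^ 4 := by simp only [β]; ring
          rw [a2, a3]
          have b1 : 0 ≤ |t j| ^ p := by positivity
          have b2 : 0 ≤ |b j n| ^ p := by positivity
          have b3 : 0 ≤ t j ^ 4 := by positivity
          have b4 : 0 ≤ b j n ^ 4 := by positivity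
          have c1 : 0 ≤ |t j| ^ p * |b j n| ^ p := by positivity
          have c2 : 0 ≤ |t j| ^ p * b j n ^ 4 := by positivity
          have c3 : 0 ≤ t j ^ 4 * |b j n| ^ p := by positivity
          have c4 : 0 ≤ t j ^ 4 * b j n ^ 4 := by positivity
          nlinarith [mul_nonneg hC1' c2, mul_nonneg hC1' c3, mul_nonneg hC1' c4,
            mul_nonneg hC2' c1, mul_nonneg hC2' c2, mul_nonneg hC2' c3]

/-- **Central limit theorem** for diagonal linear recursions, in terms of characteristic
functions. The steps of the components may be of different orders of magnitude. -/
theorem IsWhiteNoise.tendsto_charFun_linear [IsProbabilityMeasure P] (h : IsWhiteNoise P 𝓖 ξ v p)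
    (hv0 : ∀ j, 0 ≤ v j) {X : ℕ → J → Ω → ℝ} {ρ b γ : J → ℕ → ℝ} {lam β : J → ℝ}
    (hX1 : ∀ j, X 1 j = 0)
    (hX : ∀ n, 1 ≤ n → ∀ j ω, X (n + 1) j ω = ρ j n * X n j ω + b j n * ξ n j ω)
    (hγ : ∀ j, IsStep (γ j))
    (hρ : ∀ j, Tendsto (fun n => (1 - ρ j n) / γ j n) atTop (𝓝 (lam j))) (hlam : ∀ j, 0 < lam j)
    (hb : ∀ j, Tendsto (fun n => b j n ^ 2 / γ j n) atTop (𝓝 (β j))) (t : J → ℝ) :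
    Tendsto (fun n => ∫ ω, Complex.exp (((∑ j, t j * X n j ω : ℝ) : ℂ) * Complex.I) ∂P) atTop
      (𝓝 (Complex.exp (-((∑ j, t j ^ 2 * (β j * v j / (2 * lam j)) : ℝ) : ℂ) / 2))) := by
  have hp := h.two_lt
  have hVex : ∀ j, ∃ V : ℕ → ℝ, V 0 = 0 ∧ V 1 = 0 ∧ ∀ n, 1 ≤ n →
      V (n + 1) = ρ j n ^ 2 * V n + b j n ^ 2 * v j := fun j =>
    exists_seq_from_one 0 fun n y => ρ j n ^ 2 * y + b j n ^ 2 * v j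
  choose V _ hV1 hV using hVex
  obtain ⟨C, hC, hE⟩ := h.exists_charFun_error hv0 hX1 hX hV1 fun n hn j => hV j n hn
  have hηex : ∀ j, ∃ η : ℕ → ℝ, η 0 = 0 ∧ η 1 = 0 ∧ ∀ n, 1 ≤ n →
      η (n + 1) = max (ρ j n ^ 2) (ρ j n ^ 4) * η n + C * (|b j n| ^ p + b j n ^ 4) := fun j =>
    exists_seq_from_one 0 fun n y => max (ρ j n ^ 2) (ρ j n ^ 4) * y + C * (|b j n| ^ p + b j n ^ 4)
  choose η _ hη1 hη using hηex
  have hE := hE η hη1 fun n hn j => hη j n hn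
  have hρ0 : ∀ j, Tendsto (fun n => ρ j n) atTop (𝓝 1) := by
    intro j
    have := ((hρ j).mul (hγ j).tendsto_zero).const_sub 1
    simp only [mul_zero, sub_zero] at this
    refine this.congr' ?_
    filter_upwards [(hγ j).eventually_pos] with n hn
    field_simp; ring
  have hρ2 : ∀ j, Tendsto (fun n => (1 - ρ j n ^ 2) / γ j n) atTop (𝓝 (2 * lam j)) := by
    intro j
    have := (hρ j).mul ((hρ0 j).const_add 1)
    rw [one_add_one_eq_two, mul_comm] at this
    refine this.congr fun n => by ring
  have hVlim : ∀ j, Tendsto (V j) atTop (𝓝 (β j * v j / (2 * lam j))) := by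
    intro j
    have := tendsto_of_recursion (x := V j) (h := fun n => b j n ^ 2 * v j / γ j n) (hγ j)
      (RegVar.one _) (hρ2 j) (by have := hlam j; linarith) (h0 := β j * v j)
      (by simpa [mul_div_right_comm] using (hb j).mul_const (v j))
      (by
        filter_upwards [eventually_ge_atTop 1, (hγ j).eventually_pos] with n hn hg
        rw [hV j n hn]; field_simp)
    simpa using this
  have hblim : ∀ j, Tendsto (fun n => |b j n|) atTop (𝓝 0) := by
    intro j
    have h1 := (hb j).mul (hγ j).tendsto_zero
    rw [mul_zero] at h1
    have h2 : Tendsto (fun n => b j n ^ 2) atTop (𝓝 0) := by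
      refine h1.congr' ?_
      filter_upwards [(hγ j).eventually_pos] with n hn
      field_simp
    have h3 := (Real.continuous_sqrt.tendsto 0).comp h2
    rw [Real.sqrt_zero] at h3
    exact h3.congr fun n => Real.sqrt_sq_eq_abs _
  -- Here `b ^ 2` is of order `γ` while `|b| ^ (p - 2)` tends to zero, so the forcing of the error
  -- recursion is `o(γ)`. This is where a moment of order greater than two is needed.
  have hηlim : ∀ j, Tendsto (η j) atTop (𝓝 0) := by
    intro j
    have hp2 : Tendsto (fun n => |b j n| ^ (p - 2)) atTop (𝓝 0) := by
      have := (hblim j).rpow_const (p := p - 2) (Or.inr (by linarith))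
      rwa [Real.zero_rpow (by linarith)] at this
    have hh : Tendsto (fun n => C * (|b j n| ^ p + b j n ^ 4) / γ j n) atTop (𝓝 0) := by
      have h2 : Tendsto (fun n => |b j n| ^ 2) atTop (𝓝 0) := by simpa using (hblim j).pow 2
      have := ((hb j).mul (hp2.add h2)).const_mul C
      simp only [add_zero, mul_zero] at this
      refine this.congr fun n => ?_
      have e : |b j n| ^ p = b j n ^ 2 * |b j n| ^ (p - 2) := by
        rw [← sq_abs, ← Real.rpow_natCast, ← Real.rpow_add_of_nonneg (abs_nonneg _) (by norm_num)
          (by linarith)]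
        congr 1; push_cast; ring
      rw [e, sq_abs]; ring
    -- Eventually `ρ ^ 2 < 1`, so that the maximum is `ρ ^ 2`.
    have hmax : Tendsto (fun n => (1 - max (ρ j n ^ 2) (ρ j n ^ 4)) / γ j n) atTop
        (𝓝 (2 * lam j)) := by
      refine (hρ2 j).congr' ?_
      have hl := hlam j
      filter_upwards [(hγ j).eventually_pos, (hρ2 j).eventually (lt_mem_nhds
        (show (0 : ℝ) < 2 * lam j by linarith))] with n h1 h2
      rw [lt_div_iff₀ h1] at h2
      rw [max_eq_left]
      nlinarith [sq_nonneg (ρ j n)]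
    have := tendsto_of_recursion (x := η j) (h := fun n => C * (|b j n| ^ p + b j n ^ 4) / γ j n)
      (hγ j) (RegVar.one _) hmax (by have := hlam j; linarith) (h0 := 0) (by simpa using hh)
      (by
        filter_upwards [eventually_ge_atTop 1, (hγ j).eventually_pos] with n hn hg
        rw [hη j n hn]; field_simp)
    simpa using this
  have hg : Tendsto (fun n => Complex.exp (-((∑ j, t j ^ 2 * V j n : ℝ) : ℂ) / 2)) atTop
      (𝓝 (Complex.exp (-((∑ j, t j ^ 2 * (β j * v j / (2 * lam j)) : ℝ) : ℂ) / 2))) := by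
    refine (Complex.continuous_exp.tendsto _).comp ?_
    refine Tendsto.div_const (Tendsto.neg ?_) _
    refine (Complex.continuous_ofReal.tendsto _).comp ?_
    exact tendsto_finsetSum _ fun j _ => (hVlim j).const_mul _
  have hbd : Tendsto (fun n => ∑ j, η j n * (|t j| ^ p + t j ^ 4)) atTop (𝓝 0) := by
    have := tendsto_finsetSum Finset.univ fun j _ => (hηlim j).mul_const (|t j| ^ p + t j ^ 4)
    simpa using this
  have hdiff := squeeze_zero_norm' (f := fun n =>
    ∫ ω, Complex.exp (((∑ j, t j * X n j ω : ℝ) : ℂ) * Complex.I) ∂P -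
          Complex.exp (-((∑ j, t j ^ 2 * V j n : ℝ) : ℂ) / 2))
    ((eventually_ge_atTop 1).mono fun n hn => hE n hn t) hbd
  simpa using hdiff.add hg

end


/-! ### Conditional moments of the observation errors -/

section CondLaw

variable {Ω : Type*} {m mΩ : MeasurableSpace Ω} {P : Measure Ω} [IsProbabilityMeasure P]

lemma setIntegral_indicator_one_condExp (hm : m ≤ mΩ) {B : Set Ω} (hB : MeasurableSet B)
    {A : Set Ω} (hA : MeasurableSet[m] A) :
    ∫ ω in A, (P⟦B|m⟧) ω ∂P = P.real (B ∩ A) := by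
  rw [setIntegral_condExp hm ((integrable_const _).indicator hB) hA, integral_indicator hB,
    setIntegral_const, smul_eq_mul, mul_one, measureReal_restrict_apply hB]

/-- If `η` is the conditional law of `Z` given `m`, the law of `Z` on an event of `m` is a mixture
of the laws `η ω`. -/
lemma map_restrict_eq_comp (hm : m ≤ mΩ) {Z : Ω → ℝ} (hZ : Measurable Z) (η : Kernel Ω ℝ)
    [IsMarkovKernel η]
    (h : ∀ B, MeasurableSet B → P⟦Z ⁻¹' B|m⟧ =ᵐ[P] fun ω => (η ω).real B) {A : Set Ω}
    (hA : MeasurableSet[m] A) : (P.restrict A).map Z = η ∘ₘ (P.restrict A) := by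
  ext B hB
  rw [Measure.map_apply hZ hB, Measure.bind_apply hB η.aemeasurable]
  have h1 := setIntegral_indicator_one_condExp (P := P) hm (hZ hB) hA
  rw [setIntegral_congr_ae (hm _ hA) ((h B hB).mono fun ω hω _ => hω)] at h1
  have h2 : ∫⁻ ω in A, η ω B ∂P = ENNReal.ofReal (∫ ω in A, (η ω).real B ∂P) := by
    rw [ofReal_integral_eq_lintegral_ofReal]
    · simp
    · refine Integrable.of_bound (C := 1) ?_ (ae_of_all _ fun ω => ?_)
      · exact (η.measurable_coe hB).ennreal_toReal.aestronglyMeasurable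
      · rw [Real.norm_of_nonneg measureReal_nonneg]; exact measureReal_le_one
    · exact ae_of_all _ fun ω => measureReal_nonneg
  rw [h2, h1, Measure.restrict_apply (hZ hB)]
  simp

/-- Conditional probabilities of events determine conditional expectations: on each event of `m` the
law of `Z` is the mixture of the laws `η ω`, so integrals of `g` over that event agree. -/
lemma condExp_comp_of_condLaw (hm : m ≤ mΩ) {Z : Ω → ℝ} (hZ : Measurable Z) (η : Kernel Ω ℝ)
    [IsMarkovKernel η]
    (h : ∀ B, MeasurableSet B → P⟦Z ⁻¹' B|m⟧ =ᵐ[P] fun ω => (η ω).real B) {g : ℝ → ℝ}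
    (hg : Measurable g) (hgZ : Integrable (fun ω => g (Z ω)) P)
    (hgm : StronglyMeasurable[m] fun ω => ∫ z, g z ∂(η ω)) :
    P[fun ω => g (Z ω)|m] =ᵐ[P] fun ω => ∫ z, g z ∂(η ω) := by
  have key : ∀ A, MeasurableSet[m] A →
      Integrable g ((η ∘ₖ Kernel.const Unit (P.restrict A)) ()) := by
    intro A hA
    rw [← Measure.comp_eq_comp_const_apply, ← map_restrict_eq_comp hm hZ η h hA,
      integrable_map_measure hg.aestronglyMeasurable hZ.aemeasurable]
    exact hgZ.integrableOn
  refine (ae_eq_condExp_of_forall_setIntegral_eq hm hgZ ?_ ?_ hgm.aestronglyMeasurable).symm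
  · intro A hA _
    exact (key A hA).integral_comp
  · intro A hA _
    have e := Kernel.integral_comp (key A hA)
    rw [Kernel.const_apply, ← Measure.comp_eq_comp_const_apply,
      ← map_restrict_eq_comp hm hZ η h hA,
      integral_map hZ.aemeasurable hg.aestronglyMeasurable] at e
    exact e.symm

/-- Conditionally independent square integrable variables, one of which is conditionally centered,
are conditionally uncorrelated. -/
lemma condExp_mul_eq_zero_of_condIndep (hm : m ≤ mΩ) {U V : Ω → ℝ} (hU : Measurable U)
    (hV : Measurable V) (hU2 : MemLp U 2 P) (hV2 : MemLp V 2 P)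
    (hU0 : P[U|m] =ᵐ[P] fun _ => 0)
    (hind : ∀ B B', MeasurableSet B → MeasurableSet B' →
      P⟦U ⁻¹' B ∩ V ⁻¹' B'|m⟧ =ᵐ[P] fun ω => (P⟦U ⁻¹' B|m⟧) ω * (P⟦V ⁻¹' B'|m⟧) ω) :
    P[fun ω => U ω * V ω|m] =ᵐ[P] fun _ => 0 := by
  have hUi : Integrable U P := hU2.integrable (by norm_num)
  have hUV : Integrable (fun ω => U ω * V ω) P := hU2.integrable_mul hV2
  -- By factorization, the law of `U` on `A ∩ {V ∈ B'}` is its law on `A` weighted by the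
  -- conditional probability `h` of `{V ∈ B'}`. As `h` is `m`-measurable, the integral becomes that
  -- of `h` times the conditional mean of `U`, which vanishes.
  have claim : ∀ A, MeasurableSet[m] A → ∀ B', MeasurableSet B' →
      ∫ ω in A ∩ V ⁻¹' B', U ω ∂P = 0 := by
    intro A hA B' hB'
    set h : Ω → ℝ := P⟦V ⁻¹' B'|m⟧ with hh
    have hhm : StronglyMeasurable[m] h := stronglyMeasurable_condExp
    have hh0 : 0 ≤ᵐ[P] h := condExp_nonneg (ae_of_all _ fun ω =>
      Set.indicator_nonneg (fun _ _ => zero_le_one) _)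
    have hh1 : h ≤ᵐ[P] fun _ => 1 := by
      have := condExp_mono (m := m) (μ := P) ((integrable_const (1 : ℝ)).indicator (hV hB'))
        (integrable_const (1 : ℝ)) (ae_of_all _ fun ω =>
          Set.indicator_le_self' (fun _ _ => zero_le_one) ω)
      rwa [condExp_const hm] at this
    have hhb : ∀ᵐ ω ∂P, ‖h ω‖ ≤ 1 := by
      filter_upwards [hh0, hh1] with ω h0 h1
      rwa [Real.norm_of_nonneg h0]
    have hhm' : Measurable h := (hhm.mono hm).measurable
    have hhi : Integrable h P := integrable_condExp
    have hA' := hm _ hA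
    have hmeas : (P.restrict (A ∩ V ⁻¹' B')).map U =
        ((P.restrict A).withDensity fun ω => ENNReal.ofReal (h ω)).map U := by
      ext B hB
      rw [Measure.map_apply hU hB, Measure.map_apply hU hB, withDensity_apply _ (hU hB),
        Measure.restrict_restrict (hU hB), Measure.restrict_apply (hU hB),
        ← ofReal_integral_eq_lintegral_ofReal hhi.integrableOn (ae_restrict_of_ae hh0)]
      rw [← ENNReal.ofReal_toReal (measure_ne_top P (U ⁻¹' B ∩ (A ∩ V ⁻¹' B')))]
      congr 1
      have e1 : P.real (U ⁻¹' B ∩ (A ∩ V ⁻¹' B')) =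
          ∫ ω in A, (P⟦U ⁻¹' B ∩ V ⁻¹' B'|m⟧) ω ∂P := by
        rw [setIntegral_indicator_one_condExp hm ((hU hB).inter (hV hB')) hA]
        congr 1
        ext ω; simp only [Set.mem_inter_iff]; tauto
      have e2 : P[h * (U ⁻¹' B).indicator (fun _ => (1 : ℝ))|m] =ᵐ[P]
          h * P⟦U ⁻¹' B|m⟧ :=
        condExp_stronglyMeasurable_mul_of_bound hm hhm
          ((integrable_const _).indicator (hU hB)) 1 hhb
      have hint : Integrable (h * (U ⁻¹' B).indicator (fun _ => (1 : ℝ))) P :=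
        Integrable.bdd_mul (c := 1) ((integrable_const _).indicator (hU hB))
          hhm'.aestronglyMeasurable hhb
      have e3 : ∫ ω in A, (P⟦U ⁻¹' B ∩ V ⁻¹' B'|m⟧) ω ∂P =
          ∫ ω in A, (h * (U ⁻¹' B).indicator (fun _ => (1 : ℝ))) ω ∂P := by
        rw [← setIntegral_condExp hm hint hA]
        refine setIntegral_congr_ae hA' ?_
        filter_upwards [hind B B' hB hB', e2] with ω h1 h2 _
        rw [h1, h2, Pi.mul_apply, mul_comm]
      have e4 : ∫ ω in A, (h * (U ⁻¹' B).indicator (fun _ => (1 : ℝ))) ω ∂P =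
          ∫ ω in U ⁻¹' B ∩ A, h ω ∂P := by
        rw [← Measure.restrict_restrict (hU hB), ← integral_indicator (hU hB)]
        congr 1
        ext ω
        by_cases hω : ω ∈ U ⁻¹' B <;> simp [hω]
      change P.real _ = _
      rw [e1, e3, e4]
    have i1 : ∫ ω in A ∩ V ⁻¹' B', U ω ∂P = ∫ u, u ∂((P.restrict (A ∩ V ⁻¹' B')).map U) :=
      (integral_map hU.aemeasurable aestronglyMeasurable_id).symm
    have i2 : ∫ u, u ∂(((P.restrict A).withDensity fun ω => ENNReal.ofReal (h ω)).map U) =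
        ∫ ω in A, h ω * U ω ∂P := by
      rw [integral_map (f := fun u : ℝ => u) hU.aemeasurable aestronglyMeasurable_id,
        integral_withDensity_eq_integral_toReal_smul hhm'.ennreal_ofReal
          (ae_of_all _ fun ω => ENNReal.ofReal_lt_top)]
      refine integral_congr_ae ?_
      filter_upwards [ae_restrict_of_ae hh0] with ω hω
      rw [ENNReal.toReal_ofReal hω, smul_eq_mul]
    rw [i1, hmeas, i2]
    have hint : Integrable (h * U) P :=
      Integrable.bdd_mul (c := 1) hUi hhm'.aestronglyMeasurable hhb
    have e2 : P[h * U|m] =ᵐ[P] h * P[U|m] :=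
      condExp_stronglyMeasurable_mul_of_bound hm hhm hUi 1 hhb
    have e3 : ∫ ω in A, h ω * U ω ∂P = ∫ ω in A, (P[h * U|m]) ω ∂P :=
      (setIntegral_condExp hm hint hA).symm
    rw [e3, setIntegral_congr_ae (g := fun _ => (0 : ℝ)) hA']
    · simp
    · filter_upwards [e2, hU0] with ω h1 h2 _
      rw [h1, Pi.mul_apply, h2, mul_zero]
  refine (ae_eq_condExp_of_forall_setIntegral_eq hm hUV (fun _ _ _ => integrableOn_const) ?_
    aestronglyMeasurable_const).symm
  intro A hA _
  have hA' := hm _ hA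
  have hVm : MeasurableSpace.comap V inferInstance ≤ mΩ := hV.comap_le
  have hf : Integrable (A.indicator U) P := hUi.indicator hA'
  -- The claim says that `U`, restricted to `A`, is centered given `V`; it is therefore orthogonal
  -- to `V`.
  have hc : P[A.indicator U|MeasurableSpace.comap V inferInstance] =ᵐ[P] fun _ => 0 := by
    refine (ae_eq_condExp_of_forall_setIntegral_eq hVm hf (fun _ _ _ => integrableOn_const) ?_
      aestronglyMeasurable_const).symm
    rintro C ⟨B', hB', rfl⟩ _
    rw [setIntegral_indicator hA', Set.inter_comm, claim A hA B' hB']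
    simp
  have hfV : Integrable (A.indicator U • V) P := by
    have : A.indicator U • V = A.indicator (fun ω => U ω * V ω) := by
      ext ω; by_cases hω : ω ∈ A <;> simp [hω]
    rw [this]; exact hUV.indicator hA'
  have := integral_smul_of_condExp_const hVm hf hc (comap_measurable V).stronglyMeasurable hfV
  rw [zero_smul] at this
  rw [integral_zero, ← this, ← integral_indicator hA']
  congr 1
  ext ω; by_cases hω : ω ∈ A <;> simp [hω]

end CondLaw

/-! ### The observation errors as a white noise -/

section Noise

variable {Ω : Type*} {d δ : ℕ} {κ : Kernel (EuclideanSpace ℝ (Fin d)) ℝ} {a c a' : ℕ → ℝ}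
  {Z : ℕ → Label d δ → Ω → ℝ} {T : ℕ → Ω → EuclideanSpace ℝ (Fin d)} {M : ℕ → Ω → ℝ} {σ m : ℝ}

lemma measurable_regression (κ : Kernel (EuclideanSpace ℝ (Fin d)) ℝ) :
    Measurable (regression κ) :=
  (stronglyMeasurable_id.integral_kernel (κ := κ)).measurable

lemma measurable_queryPoint (h : ℝ) (s : Label d δ) :
    Measurable fun t : EuclideanSpace ℝ (Fin d) => queryPoint h t s := by
  rcases s with i | i | k
  · exact measurable_id.add_const _
  · exact measurable_id.sub_const _
  · exact measurable_id

lemma past_mono : Monotone (past κ c T Z) := by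
  intro n k hnk
  refine iSup_le fun p => ?_
  exact le_iSup (fun q : {q : ℕ // 1 ≤ q ∧ q < k} × Label d δ =>
    MeasurableSpace.comap (noise κ c T Z q.1 q.2) inferInstance)
    (⟨p.1.1, p.1.2.1, p.1.2.2.trans_le hnk⟩, p.2)

lemma measurable_noise_past {n : ℕ} (hn : 1 ≤ n) (s : Label d δ) :
    Measurable[past κ c T Z (n + 1)] (noise κ c T Z n s) := by
  refine (comap_measurable (noise κ c T Z n s)).mono ?_ le_rfl
  exact le_iSup (fun q : {q : ℕ // 1 ≤ q ∧ q < n + 1} × Label d δ =>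
    MeasurableSpace.comap (noise κ c T Z q.1 q.2) inferInstance) (⟨n, hn, n.lt_succ_self⟩, s)

variable [mΩ : MeasurableSpace Ω] {P : Measure Ω}

lemma IsCompanionAlgorithm.measurable_noise (hAlg : IsCompanionAlgorithm P κ a c a' Z T M) (n : ℕ)
    (s : Label d δ) : Measurable (noise κ c T Z n s) :=
  (hAlg.measurable_obs n s).sub
    ((measurable_regression κ).comp ((measurable_queryPoint _ s).comp (hAlg.measurable_T n)))

lemma IsCompanionAlgorithm.past_le (hAlg : IsCompanionAlgorithm P κ a c a' Z T M) (n : ℕ) :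
    past κ c T Z n ≤ mΩ :=
  iSup_le fun p => (hAlg.measurable_noise p.1 p.2).comap_le

lemma le_one_add_rpow {x q r : ℝ} (hx : 0 ≤ x) (hq : 0 ≤ q) (hqr : q ≤ r) : x ^ q ≤ 1 + x ^ r := by
  rcases le_or_gt x 1 with h | h
  · have := Real.rpow_le_one hx h hq
    have := Real.rpow_nonneg hx r
    linarith
  · have := Real.rpow_le_rpow_of_exponent_le h.le hqr
    linarith

/-- The supremum of the conditional moments. -/
lemma NoiseAssumption.exists_moment_bound (hA3 : NoiseAssumption P κ c Z T σ m) :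
    ∃ K : ℝ, 0 ≤ K ∧ ∀ x, ∫⁻ z, ENNReal.ofReal (|z| ^ m) ∂(κ x) ≤ ENNReal.ofReal K := by
  refine ⟨(⨆ x, ∫⁻ z, ENNReal.ofReal (|z| ^ m) ∂(κ x)).toReal, ENNReal.toReal_nonneg, fun x => ?_⟩
  rw [ENNReal.ofReal_toReal hA3.moment.ne]
  exact le_iSup (fun x => ∫⁻ z, ENNReal.ofReal (|z| ^ m) ∂(κ x)) x

lemma integrable_rpow_of_lintegral_le {Ω' : Type*} [MeasurableSpace Ω'] {μ : Measure Ω'}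
    {X : Ω' → ℝ} (hX : Measurable X) {K r : ℝ} (hK : 0 ≤ K)
    (h : ∫⁻ ω, ENNReal.ofReal (|X ω| ^ r) ∂μ ≤ ENNReal.ofReal K) :
    Integrable (fun ω => |X ω| ^ r) μ ∧ ∫ ω, |X ω| ^ r ∂μ ≤ K := by
  have hm : Measurable fun ω => |X ω| ^ r := (measurable_norm.comp hX).pow_const r
  have h0 : ∀ ω, 0 ≤ |X ω| ^ r := fun ω => by positivity
  have hi : Integrable (fun ω => |X ω| ^ r) μ := by
    refine ⟨hm.aestronglyMeasurable, ?_⟩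
    rw [hasFiniteIntegral_iff_ofReal (ae_of_all _ h0)]
    exact h.trans_lt ENNReal.ofReal_lt_top
  refine ⟨hi, ?_⟩
  rw [← ENNReal.ofReal_le_ofReal_iff hK, ofReal_integral_eq_lintegral_ofReal hi (ae_of_all _ h0)]
  exact h

lemma memLp_two_of_integrable_rpow {Ω' : Type*} [MeasurableSpace Ω'] {μ : Measure Ω'}
    [IsFiniteMeasure μ] {X : Ω' → ℝ} (hX : Measurable X) {r : ℝ} (hr : 2 ≤ r)
    (h : Integrable (fun ω => |X ω| ^ r) μ) : MemLp X 2 μ := by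
  rw [memLp_two_iff_integrable_sq hX.aestronglyMeasurable]
  refine Integrable.mono' ((integrable_const (1 : ℝ)).add h) (hX.pow_const 2).aestronglyMeasurable
    (ae_of_all _ fun ω => ?_)
  have := le_one_add_rpow (abs_nonneg (X ω)) zero_le_two hr
  rw [Real.norm_of_nonneg (sq_nonneg _), ← sq_abs]
  exact_mod_cast this

variable [IsProbabilityMeasure P] [IsMarkovKernel κ]

/-- The observation errors form a white noise with respect to the past. -/
theorem isWhiteNoise_noise (hAlg : IsCompanionAlgorithm P κ a c a' Z T M)
    (hA3 : NoiseAssumption P κ c Z T σ m) :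
    IsWhiteNoise P (past κ c T Z) (noise κ c T Z) (fun _ => σ ^ 2) (min m 3) := by
  have hm2 := hA3.two_lt_m
  obtain ⟨K, hK0, hK⟩ := hA3.exists_moment_bound
  have hκint : ∀ x, Integrable (fun z => |z| ^ m) (κ x) ∧ ∫ z, |z| ^ m ∂(κ x) ≤ K := fun x =>
    integrable_rpow_of_lintegral_le measurable_id hK0 (hK x)
  have hκ2 : ∀ x, MemLp (fun z : ℝ => z) 2 (κ x) := fun x =>
    memLp_two_of_integrable_rpow measurable_id hm2.le (hκint x).1
  -- The uniform moment bound makes the regression function globally bounded, so that errors inherit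
  -- the moments of observations although nothing confines the query points.
  have hfb : ∀ x, |regression κ x| ≤ 1 + K := by
    intro x
    change ‖∫ z, z ∂(κ x)‖ ≤ 1 + K
    refine (norm_integral_le_integral_norm (fun z : ℝ => z)).trans ?_
    have h1 : ∫ z, ‖z‖ ∂(κ x) ≤ ∫ z, (1 + |z| ^ m) ∂(κ x) := by
      refine integral_mono ((hκ2 x).integrable (by norm_num)).norm
        ((integrable_const _).add (hκint x).1) fun z => ?_
      have := le_one_add_rpow (abs_nonneg z) zero_le_one (show (1 : ℝ) ≤ m by linarith)
      rw [Real.rpow_one] at this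
      exact this
    refine h1.trans ?_
    rw [integral_add (integrable_const _) (hκint x).1]
    simpa using (hκint x).2
  have hsecond : ∀ x, ∫ z, z ^ 2 ∂(κ x) = σ ^ 2 + regression κ x ^ 2 := by
    intro x
    have h1 := variance_eq_sub (hκ2 x)
    rw [hA3.variance_eq x] at h1
    have h2 : ∫ z, ((fun z : ℝ => z) ^ 2) z ∂(κ x) = ∫ z, z ^ 2 ∂(κ x) := rfl
    rw [h2] at h1
    change _ = _ - regression κ x ^ 2 at h1
    linarith
  have hq : ∀ n (s : Label d δ), Measurable fun ω => queryPoint (c n) (T n ω) s := fun n s =>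
    (measurable_queryPoint _ s).comp (hAlg.measurable_T n)
  have hle : ∀ n, past κ c T Z n ⊔ MeasurableSpace.comap (T n) inferInstance ≤ mΩ := fun n =>
    sup_le (hAlg.past_le n) (hAlg.measurable_T n).comap_le
  have hqm : ∀ n (s : Label d δ),
      Measurable[past κ c T Z n ⊔ MeasurableSpace.comap (T n) inferInstance]
      fun ω => queryPoint (c n) (T n ω) s := fun n s =>
    (measurable_queryPoint _ s).comp ((comap_measurable (T n)).mono le_sup_right le_rfl)
  have hZmom : ∀ n, 1 ≤ n → ∀ s, Integrable (fun ω => |Z n s ω| ^ m) P ∧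
      ∫ ω, |Z n s ω| ^ m ∂P ≤ K := by
    intro n hn s
    refine integrable_rpow_of_lintegral_le (hAlg.measurable_obs n s) hK0 ?_
    have h1 := map_restrict_eq_comp (hle n) (hAlg.measurable_obs n s) (κ.comap _ (hq n s))
      (hAlg.obs_law n hn s) MeasurableSet.univ
    rw [Measure.restrict_univ] at h1
    have hmeas : Measurable fun z : ℝ => ENNReal.ofReal (|z| ^ m) :=
      ((measurable_norm.comp measurable_id).pow_const m).ennreal_ofReal
    rw [← lintegral_map (f := fun z => ENNReal.ofReal (|z| ^ m)) hmeas (hAlg.measurable_obs n s),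
      h1, Measure.lintegral_bind (Kernel.aemeasurable _) hmeas.aemeasurable]
    calc _ ≤ ∫⁻ _, ENNReal.ofReal K ∂P := lintegral_mono fun ω => hK _
      _ = _ := by simp
  have hZ2 : ∀ n, 1 ≤ n → ∀ s, MemLp (Z n s) 2 P := fun n hn s =>
    memLp_two_of_integrable_rpow (hAlg.measurable_obs n s) hm2.le (hZmom n hn s).1
  have hWle : ∀ n s ω, |noise κ c T Z n s ω| ^ m ≤
      2 ^ m * |Z n s ω| ^ m + 2 ^ m * (1 + K) ^ m := by
    intro n s ω
    have h1 : |noise κ c T Z n s ω| ≤ 2 * max |Z n s ω| (1 + K) := by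
      have := abs_sub (Z n s ω) (regression κ (queryPoint (c n) (T n ω) s))
      have h2 := hfb (queryPoint (c n) (T n ω) s)
      have h3 := le_max_left |Z n s ω| (1 + K)
      have h4 := le_max_right |Z n s ω| (1 + K)
      unfold noise
      linarith
    have hmx : 0 ≤ max |Z n s ω| (1 + K) := le_max_of_le_left (abs_nonneg _)
    refine (Real.rpow_le_rpow (abs_nonneg _) h1 (by linarith)).trans ?_
    rw [Real.mul_rpow zero_le_two hmx, ← mul_add]
    gcongr
    rcases max_choice |Z n s ω| (1 + K) with h | h <;> rw [h]
    · have : 0 ≤ (1 + K) ^ m := by positivity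
      linarith
    · have : 0 ≤ |Z n s ω| ^ m := by positivity
      linarith
  have hWmom : ∀ n, 1 ≤ n → ∀ s, Integrable (fun ω => |noise κ c T Z n s ω| ^ m) P ∧
      ∫ ω, |noise κ c T Z n s ω| ^ m ∂P ≤ 2 ^ m * K + 2 ^ m * (1 + K) ^ m := by
    intro n hn s
    have i1 : Integrable (fun ω => 2 ^ m * |Z n s ω| ^ m + 2 ^ m * (1 + K) ^ m) P :=
      ((hZmom n hn s).1.const_mul _).add (integrable_const _)
    have i2 : Integrable (fun ω => |noise κ c T Z n s ω| ^ m) P := by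
      refine i1.mono' (((measurable_norm.comp
        (hAlg.measurable_noise n s)).pow_const m).aestronglyMeasurable) (ae_of_all _ fun ω => ?_)
      rw [Real.norm_of_nonneg (by positivity)]
      exact hWle n s ω
    refine ⟨i2, (integral_mono i2 i1 (hWle n s)).trans ?_⟩
    rw [integral_add ((hZmom n hn s).1.const_mul _) (integrable_const _), integral_const_mul]
    simp only [integral_const, probReal_univ, one_smul]
    gcongr
    exact (hZmom n hn s).2
  have hW2 : ∀ n, 1 ≤ n → ∀ s, MemLp (noise κ c T Z n s) 2 P := fun n hn s =>
    memLp_two_of_integrable_rpow (hAlg.measurable_noise n s) hm2.le (hWmom n hn s).1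
  have hfq : ∀ n (s : Label d δ),
      StronglyMeasurable[past κ c T Z n ⊔ MeasurableSpace.comap (T n) inferInstance]
      fun ω => regression κ (queryPoint (c n) (T n ω) s) := fun n s =>
    ((measurable_regression κ).comp (hqm n s)).stronglyMeasurable
  have hfqb : ∀ n (s : Label d δ),
      ∀ᵐ ω ∂P, ‖regression κ (queryPoint (c n) (T n ω) s)‖ ≤ 1 + K := fun n s =>
    ae_of_all _ fun ω => hfb _
  have hfqi : ∀ n (s : Label d δ),
      Integrable (fun ω => regression κ (queryPoint (c n) (T n ω) s)) P := fun n s =>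
    Integrable.of_bound ((hfq n s).mono (hle n)).aestronglyMeasurable _ (hfqb n s)
  have hE1 : ∀ n, 1 ≤ n → ∀ s,
      P[Z n s|past κ c T Z n ⊔ MeasurableSpace.comap (T n) inferInstance] =ᵐ[P]
        fun ω => regression κ (queryPoint (c n) (T n ω) s) := fun n hn s =>
    condExp_comp_of_condLaw (hle n) (hAlg.measurable_obs n s) (κ.comap _ (hq n s))
      (hAlg.obs_law n hn s) measurable_id ((hZ2 n hn s).integrable (by norm_num)) (hfq n s)
  have hE2 : ∀ n, 1 ≤ n → ∀ s,
      P[fun ω => Z n s ω ^ 2|past κ c T Z n ⊔ MeasurableSpace.comap (T n) inferInstance] =ᵐ[P]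
        fun ω => σ ^ 2 + regression κ (queryPoint (c n) (T n ω) s) ^ 2 := by
    intro n hn s
    have e : (fun ω => ∫ z, z ^ 2 ∂(κ.comap _ (hq n s) ω)) =
        fun ω => σ ^ 2 + regression κ (queryPoint (c n) (T n ω) s) ^ 2 := by
      ext ω
      rw [Kernel.comap_apply]
      exact hsecond _
    rw [← e]
    refine condExp_comp_of_condLaw (hle n) (hAlg.measurable_obs n s) (κ.comap _ (hq n s))
      (hAlg.obs_law n hn s) (measurable_id.pow_const 2) (hZ2 n hn s).integrable_sq ?_
    simp only [id]
    rw [e]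
    exact stronglyMeasurable_const.add ((hfq n s).pow 2)
  -- Starting values may be random, so `T n` need not be measurable with respect to the errors
  -- alone. Conditional moments are computed in the σ-field enlarged by `T n`; being constants, they
  -- pass down to `past` by the tower property.
  have hcent : ∀ n, 1 ≤ n → ∀ s, P[noise κ c T Z n s|past κ c T Z n] =ᵐ[P] fun _ => 0 := by
    intro n hn s
    have h1 : P[noise κ c T Z n s|past κ c T Z n ⊔ MeasurableSpace.comap (T n) inferInstance]
        =ᵐ[P] fun _ => 0 := by
      have e : noise κ c T Z n s =
          Z n s - fun ω => regression κ (queryPoint (c n) (T n ω) s) := rfl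
      rw [e]
      refine (condExp_sub ((hZ2 n hn s).integrable (by norm_num)) (hfqi n s) _).trans ?_
      rw [condExp_of_stronglyMeasurable (hle n) (hfq n s) (hfqi n s)]
      filter_upwards [hE1 n hn s] with ω hω
      simp [hω]
    refine (condExp_condExp_of_le (le_sup_left) (hle n)).symm.trans ?_
    refine (condExp_congr_ae h1).trans ?_
    rw [condExp_const (hAlg.past_le n)]
  refine ⟨past_mono, hAlg.past_le, fun n hn s => measurable_noise_past hn s, hW2, hcent, ?_,
    lt_min hm2 (by norm_num), min_le_right _ _, ?_, ?_⟩
  · intro n hn s t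
    split_ifs with hst
    · subst hst
      have h1 : P[fun ω => noise κ c T Z n s ω * noise κ c T Z n s ω|
          past κ c T Z n ⊔ MeasurableSpace.comap (T n) inferInstance] =ᵐ[P] fun _ => σ ^ 2 := by
        set F : Ω → ℝ := fun ω => regression κ (queryPoint (c n) (T n ω) s) with hF
        have e : (fun ω => noise κ c T Z n s ω * noise κ c T Z n s ω) =
            ((fun ω => Z n s ω ^ 2) - ((2 : ℝ) • F) * Z n s) + F ^ 2 := by
          ext ω
          simp only [noise, Pi.add_apply, Pi.sub_apply, Pi.mul_apply, Pi.pow_apply, hF,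
            Pi.smul_apply, smul_eq_mul]
          ring
        have hZi := (hZ2 n hn s).integrable (q := 2) (by norm_num)
        have b1 : ∀ᵐ ω ∂P, ‖((2 : ℝ) • F) ω‖ ≤ 2 * (1 + K) := by
          filter_upwards [hfqb n s] with ω hω
          rw [Pi.smul_apply, norm_smul]
          simpa using hω
        have sm1 := (hfq n s).const_smul (2 : ℝ)
        have i1 : Integrable (((2 : ℝ) • F) * Z n s) P :=
          hZi.bdd_mul (sm1.mono (hle n)).aestronglyMeasurable b1
        have i2 : Integrable (F ^ 2) P := by
          have := (hfqi n s).bdd_mul ((hfq n s).mono (hle n)).aestronglyMeasurable (hfqb n s)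
          rw [pow_two]; exact this
        have i0 := (hZ2 n hn s).integrable_sq
        rw [e]
        refine (condExp_add (i0.sub i1) i2 _).trans ?_
        rw [condExp_of_stronglyMeasurable (hle n) ((hfq n s).pow 2) i2]
        filter_upwards [condExp_sub i0 i1
          (past κ c T Z n ⊔ MeasurableSpace.comap (T n) inferInstance), hE1 n hn s, hE2 n hn s,
          condExp_stronglyMeasurable_mul_of_bound (hle n) sm1 hZi _ b1] with ω g1 g2 g3 g4
        rw [Pi.add_apply, g1, Pi.sub_apply, g3, g4, Pi.mul_apply, g2]
        simp only [Pi.pow_apply, Pi.smul_apply, smul_eq_mul]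
        ring
      refine (condExp_condExp_of_le (le_sup_left) (hle n)).symm.trans ?_
      refine (condExp_congr_ae h1).trans ?_
      rw [condExp_const (hAlg.past_le n)]
    · refine condExp_mul_eq_zero_of_condIndep (hAlg.past_le n) (hAlg.measurable_noise n s)
        (hAlg.measurable_noise n t) (hW2 n hn s) (hW2 n hn t) (hcent n hn s) ?_
      intro B B' hB hB'
      -- Independence of the whole family is reduced to the pair `s`, `t` by leaving the other
      -- errors unconstrained.
      set C : Label d δ → Set ℝ := fun r => if r = s then B else if r = t then B' else Set.univ
      have hCs : C s = B := by simp [C]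
      have hCt : C t = B' := by simp [C, Ne.symm hst]
      have hC : ∀ r, r ≠ s ∧ r ≠ t → C r = Set.univ := fun r hr => by simp [C, hr.1, hr.2]
      have h1 := hA3.condIndep n hn C (fun r => by
        by_cases h1 : r = s
        · simpa [h1, hCs] using hB
        by_cases h2 : r = t
        · simpa [h2, hCt] using hB'
        rw [hC r ⟨h1, h2⟩]; exact MeasurableSet.univ)
      have e1 : ⋂ r, noise κ c T Z n r ⁻¹' C r =
          noise κ c T Z n s ⁻¹' B ∩ noise κ c T Z n t ⁻¹' B' := by
        ext ω
        simp only [Set.mem_iInter, Set.mem_inter_iff, Set.mem_preimage]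
        constructor
        · intro h
          exact ⟨hCs ▸ h s, hCt ▸ h t⟩
        · rintro ⟨h2, h3⟩ r
          by_cases g1 : r = s
          · rw [g1, hCs]; exact h2
          by_cases g2 : r = t
          · rw [g2, hCt]; exact h3
          rw [hC r ⟨g1, g2⟩]; trivial
      rw [e1] at h1
      refine h1.trans ?_
      filter_upwards with ω
      rw [Fintype.prod_eq_mul s t hst, hCs, hCt]
      intro r hr
      rw [hC r hr, Set.preimage_univ, Set.indicator_univ, condExp_const (hAlg.past_le n)]
  · intro n hn s
    have i1 : Integrable (fun ω => 1 + |noise κ c T Z n s ω| ^ m) P :=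
      (integrable_const _).add (hWmom n hn s).1
    refine i1.mono' (((measurable_norm.comp
      (hAlg.measurable_noise n s)).pow_const _).aestronglyMeasurable) (ae_of_all _ fun ω => ?_)
    rw [Real.norm_of_nonneg (by positivity)]
    exact le_one_add_rpow (abs_nonneg _) (le_min (by linarith) (by norm_num)) (min_le_left _ _)
  · refine ⟨1 + (2 ^ m * K + 2 ^ m * (1 + K) ^ m), by positivity, fun n hn s => ?_⟩
    have i1 : Integrable (fun ω => 1 + |noise κ c T Z n s ω| ^ m) P :=
      (integrable_const _).add (hWmom n hn s).1
    refine (integral_mono_of_nonneg (ae_of_all _ fun ω => by positivity) i1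
      (ae_of_all _ fun ω => le_one_add_rpow (abs_nonneg _) (le_min (by linarith) (by norm_num))
        (min_le_left _ _))).trans ?_
    rw [integral_add (integrable_const _) (hWmom n hn s).1]
    simp only [integral_const, probReal_univ, one_smul]
    have := (hWmom n hn s).2
    linarith

end Noise


/-! ### Local expansions of the regression function -/

section Calculus

/-- Integration of a power bound, applied three times in a row for the symmetric difference. -/
lemma norm_le_of_deriv_le_pow {g g' : ℝ → ℝ} {h K : ℝ} {k : ℕ} (h0 : g 0 = 0)
    (hg : ∀ s ∈ Set.Icc 0 h, HasDerivAt g (g' s) s)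
    (hb : ∀ s ∈ Set.Icc 0 h, |g' s| ≤ K * s ^ k) :
    ∀ s ∈ Set.Icc 0 h, |g s| ≤ K / (k + 1) * s ^ (k + 1) := by
  refine image_norm_le_of_norm_deriv_right_le_deriv_boundary (f' := g') (B' := fun s => K * s ^ k)
    (fun s hs => (hg s hs).continuousAt.continuousWithinAt)
    (fun s hs => (hg s (Set.Ico_subset_Icc_self hs)).hasDerivWithinAt) (by simp [h0]) ?_
    (fun s hs => hb s (Set.Ico_subset_Icc_self hs))
  intro s
  have := (hasDerivAt_pow (k + 1) s).const_mul (K / (k + 1))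
  refine this.congr_deriv ?_
  push_cast
  have : (k : ℝ) + 1 ≠ 0 := by positivity
  field_simp

variable {E : Type*} [NormedAddCommGroup E] [NormedSpace ℝ E] {f : E → ℝ} {θ : E}

lemma eventually_hasFDerivAt_of_contDiffAt {F : Type*} [NormedAddCommGroup F] [NormedSpace ℝ F]
    {g : E → F} (hg : ContDiffAt ℝ 1 g θ) : ∀ᶠ x in 𝓝 θ, HasFDerivAt g (fderiv ℝ g x) x := by
  filter_upwards [hg.eventually (by simp)] with x hx
  exact (hx.differentiableAt (by simp)).hasFDerivAt

/-- Differentiability of the second derivative at `θ` bounds its increment from `θ` linearly; the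
mean value inequality on the ball of radius `‖t - θ‖` adds one power. -/
lemma exists_quadratic_bound_gradient (hf : ContDiffAt ℝ 3 f θ) :
    ∃ C > 0, ∃ r > 0, ∀ t, ‖t - θ‖ < r →
      ‖fderiv ℝ f t - fderiv ℝ f θ - fderiv ℝ (fderiv ℝ f) θ (t - θ)‖ ≤ C * ‖t - θ‖ ^ 2 := by
  have h1 : ContDiffAt ℝ 2 (fderiv ℝ f) θ := hf.fderiv_right (by norm_num)
  have h2 : ContDiffAt ℝ 1 (fderiv ℝ (fderiv ℝ f)) θ := h1.fderiv_right (by norm_num)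
  obtain ⟨C, hC, hO⟩ := ((h2.differentiableAt (by simp)).hasFDerivAt.isBigO_sub).exists_pos
  obtain ⟨r, hr, hball⟩ := Metric.eventually_nhds_iff.1
    (hO.bound.and (eventually_hasFDerivAt_of_contDiffAt (h1.of_le (by norm_num))))
  refine ⟨C, hC, r, hr, fun t ht => ?_⟩
  have hsub : ∀ x ∈ Metric.closedBall θ ‖t - θ‖, dist x θ < r := fun x hx =>
    (Metric.mem_closedBall.1 hx).trans_lt ht
  have := (convex_closedBall θ ‖t - θ‖).norm_image_sub_le_of_norm_hasFDerivWithin_le'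
    (f := fderiv ℝ f) (f' := fderiv ℝ (fderiv ℝ f)) (φ := fderiv ℝ (fderiv ℝ f) θ)
    (C := C * ‖t - θ‖) (x := θ) (y := t)
    (fun x hx => (hball (hsub x hx)).2.hasFDerivWithinAt)
    (fun x hx => (hball (hsub x hx)).1.trans (by
      rw [← dist_eq_norm x θ]; gcongr; exact Metric.mem_closedBall.1 hx))
    (by simp) (by simp [dist_eq_norm])
  refine this.trans (le_of_eq ?_)
  ring

lemma exists_quadratic_bound (hf : ContDiffAt ℝ 3 f θ) (h0 : fderiv ℝ f θ = 0) :
    ∃ C > 0, ∃ r > 0, ∀ t, ‖t - θ‖ < r → |f t - f θ| ≤ C * ‖t - θ‖ ^ 2 := by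
  have h1 : ContDiffAt ℝ 2 (fderiv ℝ f) θ := hf.fderiv_right (by norm_num)
  obtain ⟨C, hC, hO⟩ := ((h1.differentiableAt (by simp)).hasFDerivAt.isBigO_sub).exists_pos
  obtain ⟨r, hr, hball⟩ := Metric.eventually_nhds_iff.1
    (hO.bound.and (eventually_hasFDerivAt_of_contDiffAt (hf.of_le (by norm_num))))
  refine ⟨C, hC, r, hr, fun t ht => ?_⟩
  have hsub : ∀ x ∈ Metric.closedBall θ ‖t - θ‖, dist x θ < r := fun x hx =>
    (Metric.mem_closedBall.1 hx).trans_lt ht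
  have := (convex_closedBall θ ‖t - θ‖).norm_image_sub_le_of_norm_hasFDerivWithin_le
    (f := f) (f' := fderiv ℝ f) (C := C * ‖t - θ‖) (x := θ) (y := t)
    (fun x hx => (hball (hsub x hx)).2.hasFDerivWithinAt)
    (fun x hx => by
      have := (hball (hsub x hx)).1
      rw [h0, sub_zero] at this
      refine this.trans ?_
      rw [← dist_eq_norm x θ]; gcongr; exact Metric.mem_closedBall.1 hx)
    (by simp) (by simp [dist_eq_norm])
  rw [Real.norm_eq_abs] at this
  refine this.trans (le_of_eq ?_)
  ring

/-- Even-order terms cancel in the symmetric difference, so the leading error is cubic. Continuity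
of the third derivative allows it to be evaluated at `θ` instead of `t`, uniformly for `t` near `θ`.
-/
lemma symmetric_difference_expansion (hf : ContDiffAt ℝ 3 f θ) {v : E} (hv : ‖v‖ = 1) {ε : ℝ}
    (hε : 0 < ε) :
    ∃ r > 0, ∀ t, ‖t - θ‖ < r → ∀ h, 0 < h → h < r →
      |(f (t + h • v) - f (t - h • v)) / (2 * h) - fderiv ℝ f t v -
        h ^ 2 / 6 * fderiv ℝ (fderiv ℝ (fderiv ℝ f)) θ v v v| ≤ ε * h ^ 2 := by
  have h1 : ContDiffAt ℝ 2 (fderiv ℝ f) θ := hf.fderiv_right (by norm_num)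
  have h2 : ContDiffAt ℝ 1 (fderiv ℝ (fderiv ℝ f)) θ := h1.fderiv_right (by norm_num)
  have h3 := h2.fderiv_right (m := 0) (by norm_num)
  set β : ℝ := fderiv ℝ (fderiv ℝ (fderiv ℝ f)) θ v v v
  have hc : ContinuousAt (fun x => fderiv ℝ (fderiv ℝ (fderiv ℝ f)) x v v v) θ :=
    ((h3.continuousAt.clm_apply continuousAt_const).clm_apply continuousAt_const).clm_apply
      continuousAt_const
  obtain ⟨r, hr, hball⟩ := Metric.eventually_nhds_iff.1
    ((hc.eventually (Metric.ball_mem_nhds _ hε)).and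
    ((eventually_hasFDerivAt_of_contDiffAt (hf.of_le (by norm_num))).and
    ((eventually_hasFDerivAt_of_contDiffAt (h1.of_le (by norm_num))).and
      (eventually_hasFDerivAt_of_contDiffAt h2))))
  -- Halving keeps both `t + s • v` and `t - s • v` within distance `r` of `θ`.
  refine ⟨r / 2, half_pos hr, fun t ht h hh0 hhr => ?_⟩
  have hplus : ∀ s ∈ Set.Icc 0 h, dist (t + s • v) θ < r := by
    intro s hs
    have e : t + s • v - θ = (t - θ) + s • v := by abel
    rw [dist_eq_norm, e]
    refine (norm_add_le _ _).trans_lt ?_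
    rw [norm_smul, hv, Real.norm_of_nonneg hs.1]
    linarith [hs.2]
  have hminus : ∀ s ∈ Set.Icc 0 h, dist (t - s • v) θ < r := by
    intro s hs
    have e : t - s • v - θ = (t - θ) - s • v := by abel
    rw [dist_eq_norm, e]
    refine (norm_sub_le _ _).trans_lt ?_
    rw [norm_smul, hv, Real.norm_of_nonneg hs.1]
    linarith [hs.2]
  have dplus : ∀ s : ℝ, HasDerivAt (fun s : ℝ => t + s • v) v s := fun s => by
    simpa using ((hasDerivAt_id s).smul_const v).const_add t
  have dminus : ∀ s : ℝ, HasDerivAt (fun s : ℝ => t - s • v) (-v) s := fun s => by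
    simpa using ((hasDerivAt_id s).smul_const v).const_sub t
  -- The functions of `d1`, `d2`, `d3` are successive derivatives in the width `s`, all zero at `s =
  -- 0`. The last derivative is at most `2 ε`, and three integrations give `ε h³ / 3`.
  have d3 : ∀ s ∈ Set.Icc 0 h, HasDerivAt (fun s => fderiv ℝ (fderiv ℝ f) (t + s • v) v v -
      fderiv ℝ (fderiv ℝ f) (t - s • v) v v - 2 * s * β)
      (fderiv ℝ (fderiv ℝ (fderiv ℝ f)) (t + s • v) v v v +
        fderiv ℝ (fderiv ℝ (fderiv ℝ f)) (t - s • v) v v v - 2 * β) s := by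
    intro s hs
    have a1 := (hball (hplus s hs)).2.2.2.comp_hasDerivAt s (dplus s)
    have a2 := (hball (hminus s hs)).2.2.2.comp_hasDerivAt s (dminus s)
    have b1 := (a1.clm_apply (hasDerivAt_const s v)).clm_apply (hasDerivAt_const s v)
    have b2 := (a2.clm_apply (hasDerivAt_const s v)).clm_apply (hasDerivAt_const s v)
    have b3 := ((hasDerivAt_id s).const_mul 2).mul_const β
    refine ((b1.sub b2).sub b3).congr_deriv ?_
    simp
  have d2 : ∀ s ∈ Set.Icc 0 h, HasDerivAt (fun s => fderiv ℝ f (t + s • v) v +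
      fderiv ℝ f (t - s • v) v - 2 * fderiv ℝ f t v - s ^ 2 * β)
      (fderiv ℝ (fderiv ℝ f) (t + s • v) v v -
      fderiv ℝ (fderiv ℝ f) (t - s • v) v v - 2 * s * β) s := by
    intro s hs
    have a1 := (hball (hplus s hs)).2.2.1.comp_hasDerivAt s (dplus s)
    have a2 := (hball (hminus s hs)).2.2.1.comp_hasDerivAt s (dminus s)
    have b1 := a1.clm_apply (hasDerivAt_const s v)
    have b2 := a2.clm_apply (hasDerivAt_const s v)
    have b3 := (hasDerivAt_pow 2 s).mul_const β
    refine (((b1.add b2).sub_const _).sub b3).congr_deriv ?_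
    simp; ring
  have d1 : ∀ s ∈ Set.Icc 0 h, HasDerivAt (fun s => f (t + s • v) - f (t - s • v) -
      s * (2 * fderiv ℝ f t v) - s ^ 3 * (β / 3))
      (fderiv ℝ f (t + s • v) v +
      fderiv ℝ f (t - s • v) v - 2 * fderiv ℝ f t v - s ^ 2 * β) s := by
    intro s hs
    have a1 := (hball (hplus s hs)).2.1.comp_hasDerivAt s (dplus s)
    have a2 := (hball (hminus s hs)).2.1.comp_hasDerivAt s (dminus s)
    have b2 := (hasDerivAt_id s).mul_const (2 * fderiv ℝ f t v)
    have b3 := (hasDerivAt_pow 3 s).mul_const (β / 3)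
    refine (((a1.sub a2).sub b2).sub b3).congr_deriv ?_
    simp; ring
  have c2 := norm_le_of_deriv_le_pow (k := 0) (K := 2 * ε) (by simp) d3 (fun s hs => by
    have e1 := (hball (hplus s hs)).1
    have e2 := (hball (hminus s hs)).1
    rw [Real.dist_eq] at e1 e2
    have e3 := abs_add_le (fderiv ℝ (fderiv ℝ (fderiv ℝ f)) (t + s • v) v v v - β)
      (fderiv ℝ (fderiv ℝ (fderiv ℝ f)) (t - s • v) v v v - β)
    have e4 : fderiv ℝ (fderiv ℝ (fderiv ℝ f)) (t + s • v) v v v - β +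
      (fderiv ℝ (fderiv ℝ (fderiv ℝ f)) (t - s • v) v v v - β) =
      fderiv ℝ (fderiv ℝ (fderiv ℝ f)) (t + s • v) v v v +
        fderiv ℝ (fderiv ℝ (fderiv ℝ f)) (t - s • v) v v v - 2 * β := by ring
    rw [e4] at e3
    rw [pow_zero, mul_one]
    linarith)
  have c1 := norm_le_of_deriv_le_pow (k := 1) (K := 2 * ε) (by simp; ring) d2 (fun s hs => by
    have := c2 s hs
    norm_num at this ⊢
    exact this)
  have c0 := norm_le_of_deriv_le_pow (k := 2) (K := ε) (by simp) d1 (fun s hs => by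
    refine (c1 s hs).trans (le_of_eq ?_)
    norm_num)
  have := c0 h ⟨hh0.le, le_rfl⟩
  have e : (f (t + h • v) - f (t - h • v)) / (2 * h) - fderiv ℝ f t v - h ^ 2 / 6 * β =
      (f (t + h • v) - f (t - h • v) - h * (2 * fderiv ℝ f t v) - h ^ 3 * (β / 3)) / (2 * h) := by
    field_simp
    ring
  rw [e, abs_div, abs_of_pos (show 0 < 2 * h by positivity), div_le_iff₀ (by positivity)]
  refine this.trans ?_
  have : 0 < ε * h ^ 3 := by positivity
  norm_num
  nlinarith

end Calculus

/-! ### Linearization at the maximizer and spectral coordinates -/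

section Regular

variable {d : ℕ} {f : EuclideanSpace ℝ (Fin d) → ℝ} {θ : EuclideanSpace ℝ (Fin d)} {L : ℝ}

/-- The linear map with the Hessian as its matrix. -/
noncomputable def hessianMap (f : EuclideanSpace ℝ (Fin d) → ℝ) (θ : EuclideanSpace ℝ (Fin d)) :
    EuclideanSpace ℝ (Fin d) →L[ℝ] EuclideanSpace ℝ (Fin d) :=
  Matrix.toEuclideanCLM (𝕜 := ℝ) (hessian f θ)

/-- The finite-difference approximation of the gradient. -/
noncomputable def diffQuotient (f : EuclideanSpace ℝ (Fin d) → ℝ) (h : ℝ)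
    (t : EuclideanSpace ℝ (Fin d)) : EuclideanSpace ℝ (Fin d) :=
  (1 / (2 * h)) • WithLp.toLp 2 fun i => f (t + h • basisVec i) - f (t - h • basisVec i)

/-- The leading coefficient of the bias of the finite-difference approximation. -/
noncomputable def biasVec (f : EuclideanSpace ℝ (Fin d) → ℝ) (θ : EuclideanSpace ℝ (Fin d)) :
    EuclideanSpace ℝ (Fin d) :=
  WithLp.toLp 2 ((1 / 6 : ℝ) • thirdPartials f θ)

lemma hessian_apply (f : EuclideanSpace ℝ (Fin d) → ℝ) (x : EuclideanSpace ℝ (Fin d))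
    (i j : Fin d) :
    hessian f x i j = fderiv ℝ (fderiv ℝ f) x (basisVec i) (basisVec j) := by
  rw [hessian, Matrix.of_apply, iteratedFDeriv_two_apply]
  rfl

lemma thirdPartials_apply (f : EuclideanSpace ℝ (Fin d) → ℝ) (x : EuclideanSpace ℝ (Fin d))
    (i : Fin d) :
    thirdPartials f x i =
      fderiv ℝ (fderiv ℝ (fderiv ℝ f)) x (basisVec i) (basisVec i) (basisVec i) := by
  rw [thirdPartials, iteratedFDeriv_succ_apply_right, iteratedFDeriv_two_apply]
  rfl

lemma norm_basisVec (i : Fin d) : ‖(basisVec i : EuclideanSpace ℝ (Fin d))‖ = 1 := by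
  simp [basisVec]

lemma sum_smul_basisVec (x : EuclideanSpace ℝ (Fin d)) : ∑ i, x i • basisVec i = x := by
  ext j
  simp [basisVec, Pi.single_apply]

lemma norm_le_sum_abs (x : EuclideanSpace ℝ (Fin d)) : ‖x‖ ≤ ∑ i, |x i| := by
  conv_lhs => rw [← sum_smul_basisVec x]
  refine (norm_sum_le _ _).trans (le_of_eq ?_)
  exact Finset.sum_congr rfl fun i _ => by rw [norm_smul, norm_basisVec, mul_one, Real.norm_eq_abs]

lemma RegularMaximum.contDiffAt (h : RegularMaximum f θ L) : ContDiffAt ℝ 3 f θ := by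
  obtain ⟨U, hU, hθ, hf⟩ := h.smooth
  exact hf.contDiffAt (hU.mem_nhds hθ)

lemma RegularMaximum.fderiv_eq_zero (h : RegularMaximum f θ L) : fderiv ℝ f θ = 0 := by
  refine IsLocalMax.fderiv_eq_zero (Eventually.of_forall fun x => ?_)
  rcases eq_or_ne x θ with rfl | hx
  · exact le_rfl
  · exact (h.unique_max x hx).le

lemma RegularMaximum.isHermitian (h : RegularMaximum f θ L) : (hessian f θ).IsHermitian := by
  have := h.neg_def.isHermitian.neg
  rwa [neg_neg] at this

lemma RegularMaximum.hessianMap_apply (h : RegularMaximum f θ L) (x : EuclideanSpace ℝ (Fin d))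
    (i : Fin d) : hessianMap f θ x i = fderiv ℝ (fderiv ℝ f) θ x (basisVec i) := by
  have e : hessianMap f θ x i = ∑ j, hessian f θ i j * x j := by
    rw [hessianMap, Matrix.ofLp_toEuclideanCLM]; rfl
  rw [e]
  conv_rhs => rw [← sum_smul_basisVec x]
  rw [map_sum, sum_apply]
  refine Finset.sum_congr rfl fun j _ => ?_
  have : hessian f θ i j = hessian f θ j i := by
    simpa using (h.isHermitian.apply i j).symm
  rw [this, hessian_apply, map_smul]
  simp [mul_comm]

/-- The quadratic constant `C` is fixed before `ε`; this order lets a single process with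
coefficient `C` dominate the remainder while the other error is `o(h²)`. -/
lemma RegularMaximum.exists_gradient_expansion (hf : RegularMaximum f θ L) :
    ∃ C > 0, ∀ ε > 0, ∃ r > 0, ∀ t, ‖t - θ‖ < r → ∀ h, 0 < h → h < r →
      ‖diffQuotient f h t - hessianMap f θ (t - θ) - h ^ 2 • biasVec f θ‖ ≤
        C * ‖t - θ‖ ^ 2 + ε * h ^ 2 := by
  obtain ⟨C, hC, r0, hr0, hgrad⟩ := exists_quadratic_bound_gradient hf.contDiffAt
  -- The norm is bounded by the sum of `d` coordinates. Adding `1` here, and dividing `ε` by `d + 1`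
  -- below, also covers `d = 0`.
  refine ⟨d * C + 1, by positivity, fun ε hε => ?_⟩
  have hex := fun i : Fin d => symmetric_difference_expansion hf.contDiffAt (norm_basisVec i)
    (show 0 < ε / (d + 1) by positivity)
  choose r hr hexp using hex
  obtain ⟨R, hR0, hR⟩ : ∃ R > 0, ∀ i, R ≤ r i := by
    rcases isEmpty_or_nonempty (Fin d) with hE | hE
    · exact ⟨1, one_pos, fun i => hE.elim i⟩
    · obtain ⟨i, hi⟩ := Finite.exists_min r
      exact ⟨r i, hr i, hi⟩
  refine ⟨min r0 R, lt_min hr0 hR0, fun t ht h h0 hh => ?_⟩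
  have ht0 := ht.trans_le (min_le_left _ _)
  have htR := ht.trans_le (min_le_right _ _)
  have hhR := hh.trans_le (min_le_right _ _)
  have hg := hgrad t ht0
  rw [hf.fderiv_eq_zero, sub_zero] at hg
  refine (norm_le_sum_abs _).trans ?_
  have hi : ∀ i ∈ Finset.univ, |(diffQuotient f h t - hessianMap f θ (t - θ) -
      h ^ 2 • biasVec f θ) i| ≤ C * ‖t - θ‖ ^ 2 + ε / (d + 1) * h ^ 2 := by
    intro i _
    have e1 := hexp i t (htR.trans_le (hR i)) h h0 (hhR.trans_le (hR i))
    have e2 : |fderiv ℝ f t (basisVec i) - fderiv ℝ (fderiv ℝ f) θ (t - θ) (basisVec i)| ≤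
        C * ‖t - θ‖ ^ 2 := by
      have := (fderiv ℝ f t - fderiv ℝ (fderiv ℝ f) θ (t - θ)).le_opNorm (basisVec i)
      rw [norm_basisVec, mul_one] at this
      exact this.trans hg
    have e3 : (diffQuotient f h t - hessianMap f θ (t - θ) - h ^ 2 • biasVec f θ) i =
        ((f (t + h • basisVec i) - f (t - h • basisVec i)) / (2 * h) - fderiv ℝ f t (basisVec i) -
        h ^ 2 / 6 * fderiv ℝ (fderiv ℝ (fderiv ℝ f)) θ (basisVec i) (basisVec i) (basisVec i)) +
        (fderiv ℝ f t (basisVec i) - fderiv ℝ (fderiv ℝ f) θ (t - θ) (basisVec i)) := by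
      simp only [PiLp.sub_apply, PiLp.smul_apply, hf.hessianMap_apply, diffQuotient, biasVec,
        Pi.smul_apply, thirdPartials_apply, smul_eq_mul]
      ring
    rw [e3]
    exact (abs_add_le _ _).trans (by linarith)
  refine (Finset.sum_le_sum hi).trans ?_
  rw [Finset.sum_const, Finset.card_univ, Fintype.card_fin, nsmul_eq_mul]
  have h1 : (d : ℝ) * (ε / (d + 1) * h ^ 2) ≤ ε * h ^ 2 := by
    have : (d : ℝ) * (ε / (d + 1)) ≤ ε := by
      rw [← mul_div_assoc, div_le_iff₀ (by positivity)]; nlinarith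
    nlinarith [sq_nonneg h]
  nlinarith [sq_nonneg ‖t - θ‖]

lemma RegularMaximum.exists_value_bound (hf : RegularMaximum f θ L) :
    ∃ C > 0, ∃ r > 0, ∀ t, ‖t - θ‖ < r → |f t - f θ| ≤ C * ‖t - θ‖ ^ 2 :=
  exists_quadratic_bound hf.contDiffAt hf.fderiv_eq_zero

/-- Diagonalization of the Hessian. -/
lemma RegularMaximum.exists_basis (hf : RegularMaximum f θ L) :
    ∃ (u : OrthonormalBasis (Fin d) ℝ (EuclideanSpace ℝ (Fin d))) (lam : Fin d → ℝ),
      (∀ j, L ≤ lam j) ∧ ∀ j x, inner ℝ (u j) (hessianMap f θ x) = -lam j * inner ℝ (u j) x := by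
  refine ⟨hf.isHermitian.eigenvectorBasis, fun j => -hf.isHermitian.eigenvalues j, fun j => ?_,
    fun j x => ?_⟩
  · have := hf.max_eigenvalue.2 (hf.isHermitian.eigenvalues_mem_spectrum_real j)
    linarith
  · rw [neg_neg]
    have h1 : hessianMap f θ (hf.isHermitian.eigenvectorBasis j) =
        hf.isHermitian.eigenvalues j • hf.isHermitian.eigenvectorBasis j := by
      ext i
      have := congrFun (hf.isHermitian.mulVec_eigenvectorBasis j) i
      rw [hessianMap, Matrix.ofLp_toEuclideanCLM]
      exact this
    have h2 : IsSelfAdjoint (hessianMap f θ) := IsSelfAdjoint.map hf.isHermitian _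
    have h3 := ContinuousLinearMap.isSelfAdjoint_iff_isSymmetric.1 h2
    have h4 := h3 (hf.isHermitian.eigenvectorBasis j) x
    simp only [ContinuousLinearMap.coe_coe] at h4
    rw [← h4, h1, real_inner_smul_left]

/-- Coordinates of the resolvent of the Hessian. -/
lemma RegularMaximum.inner_resolvent {u : OrthonormalBasis (Fin d) ℝ (EuclideanSpace ℝ (Fin d))}
    {lam : Fin d → ℝ} (hu : ∀ j x, inner ℝ (u j) (hessianMap f θ x) = -lam j * inner ℝ (u j) x)
    {s : ℝ} (hs : ∀ j, s < lam j) (x : Fin d → ℝ) (j : Fin d) :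
    inner ℝ (u j) (WithLp.toLp 2 ((hessian f θ + s • 1)⁻¹.mulVec x)) =
      inner ℝ (u j) (WithLp.toLp 2 x) / (s - lam j) := by
  set A : Matrix (Fin d) (Fin d) ℝ := hessian f θ + s • 1
  have hA : ∀ (y : Fin d → ℝ) j, inner ℝ (u j) (WithLp.toLp 2 (A.mulVec y)) =
      (s - lam j) * inner ℝ (u j) (WithLp.toLp 2 y) := by
    intro y j
    have e : WithLp.toLp 2 (A.mulVec y) =
        hessianMap f θ (WithLp.toLp 2 y) + s • WithLp.toLp 2 y := by
      rw [hessianMap, Matrix.toEuclideanCLM_toLp]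
      simp only [A, Matrix.add_mulVec, Matrix.smul_mulVec, Matrix.one_mulVec]
      rfl
    rw [e, inner_add_right, hu, real_inner_smul_right]
    ring
  -- In the eigenbasis `A` multiplies coordinate `j` by `s - lam j`, which is nonzero; hence the
  -- matrix inverse is a true inverse.
  have hinj : Function.Injective A.mulVec := by
    intro y z hyz
    have : WithLp.toLp 2 y = WithLp.toLp 2 z := by
      refine u.repr.injective ?_
      ext j
      rw [u.repr_apply_apply, u.repr_apply_apply]
      have h1 := hA y j
      rw [hyz, hA z j] at h1
      exact (mul_left_cancel₀ (sub_ne_zero.2 (hs j).ne) h1).symm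
    exact (WithLp.toLp_injective 2) this
  have hunit : IsUnit A := Matrix.mulVec_injective_iff_isUnit.1 hinj
  have hdet := (Matrix.isUnit_iff_isUnit_det _).1 hunit
  have := hA (A⁻¹.mulVec x) j
  rw [Matrix.mulVec_mulVec, Matrix.mul_nonsing_inv _ hdet, Matrix.one_mulVec] at this
  rw [this, mul_div_cancel_left₀ _ (sub_ne_zero.2 (hs j).ne)]

/-- Contraction of the linearized recursion. -/
lemma norm_add_smul_hessianMap_le {u : OrthonormalBasis (Fin d) ℝ (EuclideanSpace ℝ (Fin d))}
    {lam : Fin d → ℝ} (hu : ∀ j x, inner ℝ (u j) (hessianMap f θ x) = -lam j * inner ℝ (u j) x)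
    (hL : ∀ j, L ≤ lam j) {γ : ℝ} (hγ : 0 ≤ γ) (hγ1 : ∀ j, γ * lam j ≤ 1)
    (hγL : γ * L ≤ 1) (x : EuclideanSpace ℝ (Fin d)) :
    ‖x + γ • hessianMap f θ x‖ ≤ (1 - γ * L) * ‖x‖ := by
  refine abs_le_of_sq_le_sq' ?_ (mul_nonneg (by linarith) (norm_nonneg _)) |>.2
  rw [mul_pow, ← u.sum_sq_inner_right, ← u.sum_sq_inner_right x, Finset.mul_sum]
  refine Finset.sum_le_sum fun j _ => ?_
  have e : inner ℝ (u j) (x + γ • hessianMap f θ x) = (1 - γ * lam j) * inner ℝ (u j) x := by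
    rw [inner_add_right, real_inner_smul_right, hu]; ring
  rw [e, mul_pow]
  gcongr
  · linarith [hγ1 j]
  · exact hL j

end Regular


/-! ### Linear images and second moments of white noise -/

section

variable {Ω J J' : Type*} [DecidableEq J] [DecidableEq J'] {mΩ : MeasurableSpace Ω}
  {P : Measure Ω} {𝓖 : ℕ → MeasurableSpace Ω} {ξ : ℕ → J → Ω → ℝ} {v : J → ℝ} {p : ℝ}

/-- Linear combinations of a white noise with orthogonal coefficient vectors. -/
lemma IsWhiteNoise.linear [Fintype J] [Finite J'] [IsProbabilityMeasure P]
    (h : IsWhiteNoise P 𝓖 ξ v p) (A : J' → J → ℝ) {v' : J' → ℝ}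
    (hA : ∀ i k, ∑ s, A i s * A k s * v s = if i = k then v' i else 0) :
    IsWhiteNoise P 𝓖 (fun n i ω => ∑ s, A i s * ξ n s ω) v' p := by
  have hp := h.two_lt
  refine ⟨h.mono, h.le, fun n hn i => ?_, fun n hn i => ?_, fun n hn i => ?_, fun n hn i k => ?_,
    h.two_lt, h.le_three, fun n hn i => h.integrable_abs_sum_rpow (A i) hn, ?_⟩
  · exact Finset.measurable_sum _ fun s _ => (h.meas n hn s).const_mul _
  · exact memLp_finsetSum _ fun s _ => (h.memLp_two n hn s).const_mul _
  · have e : (fun ω => ∑ s, A i s * ξ n s ω) = ∑ s, A i s • ξ n s := by ext ω; simp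
    rw [e]
    refine (condExp_finsetSum (fun s _ => (h.integrable hn s).smul (A i s)) _).trans ?_
    have h1 := fun s => (condExp_smul (μ := P) (A i s) (ξ n s) (𝓖 n)).trans
      ((h.centered n hn s).const_smul (A i s))
    filter_upwards [eventually_all.2 h1] with ω hω
    simp [Finset.sum_apply, hω]
  · have e : (fun ω => (∑ s, A i s * ξ n s ω) * ∑ s, A k s * ξ n s ω) =
        ∑ s, ∑ t, (A i s * A k t) • (fun ω => ξ n s ω * ξ n t ω) := by
      ext ω
      simp only [Finset.sum_mul_sum, Finset.sum_apply, Pi.smul_apply, smul_eq_mul]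
      refine Finset.sum_congr rfl fun j _ => Finset.sum_congr rfl fun k _ => ?_
      ring
    rw [e]
    have i1 : ∀ s t, Integrable ((A i s * A k t) • (fun ω => ξ n s ω * ξ n t ω)) P :=
      fun s t => (h.integrable_mul hn s t).smul _
    refine (condExp_finsetSum (fun s _ => integrable_finsetSum' _ fun t _ => i1 s t) _).trans ?_
    have h1 : ∀ s, P[∑ t, (A i s * A k t) • (fun ω => ξ n s ω * ξ n t ω)|𝓖 n] =ᵐ[P]
        ∑ t, P[(A i s * A k t) • (fun ω => ξ n s ω * ξ n t ω)|𝓖 n] :=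
      fun s => condExp_finsetSum (fun t _ => i1 s t) _
    have h2 : ∀ s t, P[(A i s * A k t) • (fun ω => ξ n s ω * ξ n t ω)|𝓖 n] =ᵐ[P]
        fun _ => if s = t then A i s * A k s * v s else 0 := by
      intro s t
      refine (condExp_smul _ _ _).trans ?_
      filter_upwards [h.cov n hn s t] with ω hω
      simp only [Pi.smul_apply, hω, smul_eq_mul]
      split_ifs with hst
      · subst hst; ring
      · simp
    filter_upwards [eventually_all.2 h1, eventually_all.2 fun s => eventually_all.2 (h2 s)]
      with ω hω1 hω2
    simp [Finset.sum_apply, hω1, hω2, hA]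
  · obtain ⟨K, hK0, hK⟩ := h.moment
    have hb : ∀ i, ∃ C, ∀ n, 1 ≤ n → ∫ ω, |∑ s, A i s * ξ n s ω| ^ p ∂P ≤ C := by
      intro i
      refine ⟨(Fintype.card J : ℝ) ^ (p - 1) * ∑ s, |A i s| ^ p * K, fun n hn => ?_⟩
      have := integral_mono (h.integrable_abs_sum_rpow (A i) hn)
        ((integrable_finsetSum Finset.univ fun s _ =>
          (h.integrable_moment n hn s).const_mul (|A i s| ^ p)).const_mul
          ((Fintype.card J : ℝ) ^ (p - 1))) (fun ω => h.abs_sum_rpow_le (A i) n ω)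
      refine this.trans ?_
      rw [integral_const_mul, integral_finsetSum _ fun s _ =>
          (h.integrable_moment n hn s).const_mul (|A i s| ^ p)]
      gcongr with s
      rw [integral_const_mul]
      gcongr
      exact hK n hn s
    choose C hC using hb
    obtain ⟨M, hM⟩ := (Set.finite_range C).bddAbove
    refine ⟨max M 1, lt_max_of_lt_right one_pos, fun n hn i => ?_⟩
    exact (hC i n hn).trans ((hM ⟨i, rfl⟩).trans (le_max_left _ _))

/-- The second moment of a contracting linear recursion. -/
lemma IsWhiteNoise.exists_moment_bound_linear [IsProbabilityMeasure P]
    (h : IsWhiteNoise P 𝓖 ξ v p) {j : J} {x : ℕ → Ω → ℝ} {γ ρ b w : ℕ → ℝ} {lam κ K : ℝ}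
    (hx1 : x 1 = 0)
    (hx : ∀ n, 1 ≤ n → ∀ ω, x (n + 1) ω = ρ n * x n ω + b n * ξ n j ω) (hv : 0 ≤ v j)
    (hγ : IsStep γ) (hw : RegVar γ w κ)
    (hρ : Tendsto (fun n => (1 - ρ n) / γ n) atTop (𝓝 lam)) (hκ : κ < 2 * lam)
    (hb : ∀ n, 1 ≤ n → b n ^ 2 ≤ γ n * (K * w n)) :
    ∃ K' > 0, ∀ n, 1 ≤ n → ∫ ω, x n ω ^ 2 ∂P ≤ K' * w n := by
  have hρ1 : Tendsto (fun n => ρ n) atTop (𝓝 1) := by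
    have := (hρ.mul hγ.tendsto_zero).const_sub 1
    simp only [mul_zero, sub_zero] at this
    refine this.congr' ?_
    filter_upwards [hγ.eventually_pos] with n hn
    field_simp; ring
  have hρ2 : Tendsto (fun n => (1 - ρ n ^ 2) / γ n) atTop (𝓝 (2 * lam)) := by
    have := hρ.mul (hρ1.const_add 1)
    rw [one_add_one_eq_two, mul_comm] at this
    exact this.congr fun n => by ring
  refine bound_of_recursion (x := fun n => ∫ ω, x n ω ^ 2 ∂P) (K := K * v j) hγ hw hρ2 hκ ?_
  filter_upwards [eventually_ge_atTop 1] with n hn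
  rw [h.integral_sq_linear hx1 hx hn]
  have := mul_le_mul_of_nonneg_right (hb n hn) hv
  nlinarith

end

/-! ### Cauchy-Schwarz and convergence in probability -/

section Tools

variable {Ω : Type*} {mΩ : MeasurableSpace Ω} {P : Measure Ω}

lemma integral_mul_le_sqrt {f g : Ω → ℝ} (hf0 : ∀ ω, 0 ≤ f ω) (hg0 : ∀ ω, 0 ≤ g ω)
    (hf : MemLp f 2 P) (hg : MemLp g 2 P) :
    ∫ ω, f ω * g ω ∂P ≤ √(∫ ω, f ω ^ 2 ∂P) * √(∫ ω, g ω ^ 2 ∂P) := by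
  have := integral_mul_le_Lp_mul_Lq_of_nonneg (μ := P) Real.HolderConjugate.two_two
    (ae_of_all _ hf0) (ae_of_all _ hg0) (by simpa using hf) (by simpa using hg)
  simpa [Real.sqrt_eq_rpow] using this

/-- A sequence which exceeds an `L¹`-null sequence by an almost surely null amount tends to zero
in probability. -/
lemma tendstoInMeasure_of_excess [IsFiniteMeasure P] {F : Type*} [NormedAddCommGroup F]
    [MeasurableSpace F] [OpensMeasurableSpace F] {x : ℕ → Ω → F} {y : ℕ → Ω → ℝ}
    (hx : ∀ n, Measurable (x n)) (hy0 : ∀ n ω, 0 ≤ y n ω) (hym : ∀ n, Measurable (y n))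
    (hy : ∀ n, Integrable (y n) P) (hlim : Tendsto (fun n => ∫ ω, y n ω ∂P) atTop (𝓝 0))
    (hz : ∀ᵐ ω ∂P, Tendsto (fun n => max (‖x n ω‖ - y n ω) 0) atTop (𝓝 0)) :
    TendstoInMeasure P x atTop 0 := by
  have h1 : TendstoInMeasure P y atTop 0 := by
    refine tendstoInMeasure_of_tendsto_eLpNorm (p := 1) one_ne_zero
      (fun n => (hy n).aestronglyMeasurable) aestronglyMeasurable_const ?_
    have : ∀ n, eLpNorm (y n - 0) 1 P = ENNReal.ofReal (∫ ω, y n ω ∂P) := by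
      intro n
      rw [sub_zero, eLpNorm_one_eq_lintegral_enorm,
        ofReal_integral_eq_lintegral_ofReal (hy n) (ae_of_all _ (hy0 n))]
      exact lintegral_congr fun ω => Real.enorm_of_nonneg (hy0 n ω)
    simp_rw [this]
    simpa using ENNReal.tendsto_ofReal hlim
  have h2 : TendstoInMeasure P (fun n ω => max (‖x n ω‖ - y n ω) 0) atTop (fun _ => (0 : ℝ)) := by
    refine tendstoInMeasure_of_tendsto_ae (fun n => ?_) hz
    exact (((hx n).norm.sub (hym n)).max measurable_const).aestronglyMeasurable
  rw [tendstoInMeasure_iff_norm] at h1 h2 ⊢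
  intro ε hε
  have := (h1 (ε / 2) (half_pos hε)).add (h2 (ε / 2) (half_pos hε))
  rw [add_zero] at this
  refine tendsto_of_tendsto_of_tendsto_of_le_of_le tendsto_const_nhds this (fun _ => zero_le)
    fun n => ?_
  refine (measure_mono ?_).trans (measure_union_le _ _)
  intro ω hω
  simp only [Set.mem_ofPred_eq, Pi.zero_apply, sub_zero, Set.mem_union, Real.norm_eq_abs] at hω ⊢
  by_contra! hcon
  obtain ⟨g1, g2⟩ := hcon
  have g3 := le_abs_self (y n ω)
  have g4 := le_abs_self (max (‖x n ω‖ - y n ω) 0)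
  have g5 := le_max_left (‖x n ω‖ - y n ω) 0
  linarith

end Tools

/-! ### Consequences of the step-size assumptions -/

/-- The consequences of the assumptions on the step sizes: here `q` and `q'` are the limits of
`(n a_n)⁻¹` and `(n a'_n)⁻¹`. -/
structure Rates (a c a' : ℕ → ℝ) (L τ q q' : ℝ) : Prop where
  step : IsStep a
  step' : IsStep a'
  c_pos : ∀ n, 1 ≤ n → 0 < c n
  c_lim : Tendsto c atTop (𝓝 0)
  reg_s : RegVar a (fun n => √(a n) / c n) ((1 - 2 * τ) * q / 2)
  reg_s_sq : RegVar a (fun n => a n / c n ^ 2) ((1 - 2 * τ) * q)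
  reg_c_sq : RegVar a (fun n => c n ^ 2) (2 * τ * q)
  reg_sqrt : RegVar a' (fun n => √(a' n)) (q' / 2)
  lim_s : Tendsto (fun n => a n / c n ^ 2 / √(a' n)) atTop (𝓝 0)
  lim_c : Tendsto (fun n => c n ^ 4 / √(a' n)) atTop (𝓝 0)
  lt_two_L : (1 - 2 * τ) * q < 2 * L
  lt_L : 2 * τ * q < L
  lt_two : q' < 2

/-- It turns a lower bound on `lim n a_n` into a stability condition; for `l = ⊤` the inverse is
zero and the condition is trivial. -/
lemma inv_toReal_lt {l : EReal} {A B : ℝ} (hB : 0 < B) (h0 : 0 < l)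
    (h : ((A / B : ℝ) : EReal) < l) : A * l⁻¹.toReal < B := by
  induction l with
  | bot => simp at h0
  | coe x =>
    rw [← EReal.coe_inv, EReal.toReal_coe]
    have hx : 0 < x := by exact_mod_cast h0
    have h' : A / B < x := by exact_mod_cast h
    rw [div_lt_iff₀ hB] at h'
    rw [← div_eq_mul_inv, div_lt_iff₀ hx]; linarith
  | top => simpa using hB

/-- The exponents `α` and `α'` disappear from the drifts because `(1 - α) q = 0`: either the
exponent is one, or `q` vanishes. -/
lemma StepAssumption.rates {a c a' : ℕ → ℝ} {m L α τ α' : ℝ} {l l' : EReal} (hL : 0 < L)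
    (h : StepAssumption a c a' m L α τ α' l l') :
    Rates a c a' L τ l⁻¹.toReal l'⁻¹.toReal := by
  have hα : 0 < α := lt_of_le_of_lt (by positivity) ((le_max_left _ _).trans_lt h.alpha_mem.1)
  have hα' : 0 < α' := lt_of_le_of_lt (by positivity) ((le_max_left _ _).trans_lt h.alpha'_mem.1)
  have hl : 0 < l := by
    refine lt_of_le_of_lt ?_ h.lt_l
    have : (0 : ℝ) ≤ max ((1 - 2 * τ) / (2 * L)) (2 * τ / L) :=
      le_max_of_le_right (by have := h.tau_mem.1; positivity)
    exact_mod_cast this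
  have hl' : 0 < l' := by
    refine lt_of_le_of_lt ?_ h.lt_l'
    exact_mod_cast (by norm_num : (0 : ℝ) ≤ 1 / 2)
  have hs := isStep_of_ereal hα h.a_GS hl h.lim_a
  have hs' := isStep_of_ereal hα' h.a'_GS hl' h.lim_a'
  have hq := tendsto_inv_of_ereal hl h.lim_a
  have hq' := tendsto_inv_of_ereal hl' h.lim_a'
  have e1 := one_sub_mul_inv_limit h.alpha_mem.2 h.a_GS hq
  have e1' := one_sub_mul_inv_limit h.alpha'_mem.2 h.a'_GS hq'
  have g1 : GS (-α / 2 + τ) fun n => √(a n) / c n := by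
    have := h.a_GS.sqrt.mul h.c_GS.inv
    simpa only [neg_neg, div_eq_mul_inv] using this
  have g2 : GS (-α + 2 * τ) fun n => a n / c n ^ 2 := by
    have := h.a_GS.mul h.c_GS.sq.inv
    have e : -(2 * -τ) = 2 * τ := by ring
    simpa only [e, div_eq_mul_inv] using this
  -- The steps dominate a harmonic series, so their sums diverge and the logarithm eventually
  -- exceeds one; the rate with the logarithm then implies the rate without it.
  have hlog : ∀ᶠ n : ℕ in atTop, 1 ≤ Real.log (∑ k ∈ Finset.Icc 1 n, a k) := by
    have hdiv : Tendsto (fun n : ℕ => ∑ k ∈ Finset.Icc 1 n, a k) atTop atTop := by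
      have h1 : Tendsto (fun n : ℕ => ∑ k ∈ Finset.range n, a (k + 1)) atTop atTop := by
        refine (not_summable_iff_tendsto_nat_atTop_of_nonneg
          (fun k => (hs.pos (k + 1) (by omega)).le)).1 fun hsum => ?_
        have hsum' : Summable a := (summable_nat_add_iff 1).1 hsum
        obtain ⟨k, hk, hka⟩ := hs.lower
        have h2 : Summable fun n : ℕ => k / (n : ℝ) := by
          refine Summable.of_norm_bounded_eventually_nat hsum' ?_
          filter_upwards [hka] with n hn
          rwa [Real.norm_of_nonneg (by positivity)]
        have h3 : Summable fun i : ℕ => (1 : ℝ) / (i : ℝ) := by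
          refine (h2.mul_left k⁻¹).congr fun i => ?_
          field_simp
        exact Real.not_summable_one_div_natCast h3
      refine h1.congr fun n => ?_
      rw [Finset.range_eq_Ico, Finset.sum_Ico_add' (fun k => a k) 0 n 1]
      rfl
    filter_upwards [(Real.tendsto_log_atTop.comp hdiv).eventually_ge_atTop 1] with n hn using hn
  refine ⟨hs, hs', h.c_GS.1, h.c_GS.tendsto_zero h.tau_mem.1, ?_, ?_, ?_, ?_, ?_, ?_, ?_, ?_, ?_⟩
  · convert g1.regVar hs.pos hq using 1
    linear_combination (1 / 2) * e1
  · convert g2.regVar hs.pos hq using 1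
    linear_combination e1
  · convert h.c_GS.sq.regVar hs.pos hq using 1
    ring
  · convert h.a'_GS.sqrt.regVar hs'.pos hq' using 1
    linear_combination (1 / 2) * e1'
  · refine tendsto_of_tendsto_of_tendsto_of_le_of_le' tendsto_const_nhds h.rate_a ?_ ?_
    · filter_upwards [eventually_ge_atTop 1] with n hn
      have := hs.pos n hn
      positivity
    · filter_upwards [eventually_ge_atTop 1, hlog] with n hn h1
      have ha := hs.pos n hn
      have hc := h.c_GS.1 n hn
      have hr := Real.sqrt_pos.2 (hs'.pos n hn)
      rw [div_eq_inv_mul (a n / c n ^ 2)]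
      gcongr
      exact le_mul_of_one_le_right ha.le h1
  · have := (Real.continuous_sqrt.tendsto 0).comp h.rate_c
    rw [Real.sqrt_zero] at this
    refine this.congr' ?_
    filter_upwards [eventually_ge_atTop 1] with n hn
    have hc := h.c_GS.1 n hn
    simp only [Function.comp]
    rw [Real.sqrt_mul (inv_nonneg.2 (hs'.pos n hn).le), Real.sqrt_inv,
      show c n ^ 8 = (c n ^ 4) ^ 2 by ring, Real.sqrt_sq (by positivity)]
    field_simp
  · refine inv_toReal_lt (by positivity) hl (lt_of_le_of_lt ?_ h.lt_l)
    exact_mod_cast le_max_left _ _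
  · refine inv_toReal_lt hL hl (lt_of_le_of_lt ?_ h.lt_l)
    exact_mod_cast le_max_right _ _
  · have := inv_toReal_lt (A := 1) (B := 2) two_pos hl' h.lt_l'
    linarith


/-! ### Control of the nonlinear remainder -/

lemma Rates.c_sq_pos {a c a' : ℕ → ℝ} {L τ q q' : ℝ} (R : Rates a c a' L τ q q') :
    ∀ᶠ n in atTop, 0 < c n ^ 2 :=
  (eventually_ge_atTop 1).mono fun n hn => pow_pos (R.c_pos n hn) 2

/-- The absolute value keeps the dominating processes nonnegative from the start; it has no effect
once `γ n * k < 1`. -/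
lemma tendsto_one_sub_abs_div {γ : ℕ → ℝ} {k : ℝ} (hγ : IsStep γ) :
    Tendsto (fun n => (1 - |1 - γ n * k|) / γ n) atTop (𝓝 k) := by
  refine tendsto_const_nhds.congr' ?_
  have h : Tendsto (fun n => γ n * k) atTop (𝓝 0) := by simpa using hγ.tendsto_zero.mul_const k
  filter_upwards [hγ.eventually_pos, h.eventually (gt_mem_nhds one_pos)] with n h1 h2
  rw [abs_of_pos (by linarith)]
  field_simp; ring

/-! ### Comparison along a convergent trajectory -/

section Pathwise

variable {d : ℕ} {f : EuclideanSpace ℝ (Fin d) → ℝ} {θ : EuclideanSpace ℝ (Fin d)}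
  {a c a' : ℕ → ℝ} {L τ q q' : ℝ}

/-- Along a convergent trajectory, the remainder of the linearization exceeds the solution `D` of
a scalar linear recursion by a negligible amount. -/
lemma Rates.tendsto_excess_remainder (R : Rates a c a' L τ q q') (hf : RegularMaximum f θ L)
    {L' C : ℝ} (hL' : 2 * τ * q < L') (hL'L : L' < L) (hC : 0 < C)
    (hexp : ∀ ε > 0, ∃ r > 0, ∀ t, ‖t - θ‖ < r → ∀ h, 0 < h → h < r →
      ‖diffQuotient f h t - hessianMap f θ (t - θ) - h ^ 2 • biasVec f θ‖ ≤
        C * ‖t - θ‖ ^ 2 + ε * h ^ 2)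
    {t ell b ρ : ℕ → EuclideanSpace ℝ (Fin d)} {D : ℕ → ℝ} (ht : Tendsto t atTop (𝓝 θ))
    (hdec : ∀ n, 1 ≤ n → t n - θ = ell n + b n + ρ n)
    (hρ : ∀ n, 1 ≤ n → ρ (n + 1) = (ρ n + a n • hessianMap f θ (ρ n)) +
      a n • (diffQuotient f (c n) (t n) - hessianMap f θ (t n - θ) - c n ^ 2 • biasVec f θ))
    {K : ℝ} (hb : ∀ n, 1 ≤ n → ‖b n‖ ≤ K * c n ^ 2)
    (hD : ∀ n, 1 ≤ n → D (n + 1) = |1 - a n * L'| * D n +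
      a n * (C * (min ‖t n - θ‖ 1 * ‖ell n‖))) :
    Tendsto (fun n => max (‖ρ n‖ - D n) 0 / c n ^ 2) atTop (𝓝 0) := by
  obtain ⟨u, lam, hlam, hu⟩ := hf.exists_basis
  have hLpos := hf.L_pos
  set r : ℕ → EuclideanSpace ℝ (Fin d) := fun n =>
    diffQuotient f (c n) (t n) - hessianMap f θ (t n - θ) - c n ^ 2 • biasVec f θ with hr
  have he : Tendsto (fun n => ‖t n - θ‖) atTop (𝓝 0) := tendsto_iff_norm_sub_tendsto_zero.1 ht
  -- The part of the Taylor error not covered by the quadratic term. It is `o(c_n²)` because `ε` is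
  -- arbitrary in `hexp`.
  set δ : ℕ → ℝ := fun n => max (‖r n‖ - C * ‖t n - θ‖ ^ 2) 0 with hδ
  have hδ0 : Tendsto (fun n => δ n / c n ^ 2) atTop (𝓝 0) := by
    rw [Metric.tendsto_nhds]
    intro ε hε
    obtain ⟨s, hs, hs'⟩ := hexp (ε / 2) (half_pos hε)
    filter_upwards [he.eventually (gt_mem_nhds hs), R.c_lim.eventually (gt_mem_nhds hs),
      eventually_ge_atTop 1] with n h1 h2 h3
    have hc := R.c_pos n h3
    have := hs' (t n) h1 (c n) hc h2
    have hδn : δ n ≤ ε / 2 * c n ^ 2 := max_le (by simp only [hr]; linarith) (by positivity)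
    have hδ0 : 0 ≤ δ n := le_max_right _ _
    rw [Real.dist_eq, sub_zero, abs_of_nonneg (by positivity), div_lt_iff₀ (by positivity)]
    have : 0 < ε * c n ^ 2 := by positivity
    linarith
  set h : ℕ → ℝ := fun n => C * ‖t n - θ‖ * ‖b n‖ + δ n with hh
  have hh0 : Tendsto (fun n => h n / c n ^ 2) atTop (𝓝 0) := by
    have h1 : Tendsto (fun n => C * ‖t n - θ‖ * ‖b n‖ / c n ^ 2) atTop (𝓝 0) := by
      have h2 : Tendsto (fun n => C * ‖t n - θ‖ * K) atTop (𝓝 0) := by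
        simpa using (he.const_mul C).mul_const K
      refine tendsto_of_tendsto_of_tendsto_of_le_of_le' tendsto_const_nhds h2 ?_ ?_
      · exact Eventually.of_forall fun n => by positivity
      · filter_upwards [eventually_ge_atTop 1] with n hn
        have hc := R.c_pos n hn
        rw [div_le_iff₀ (by positivity), mul_assoc _ K]
        exact mul_le_mul_of_nonneg_left (hb n hn) (by positivity)
    have := h1.add hδ0
    rw [add_zero] at this
    exact this.congr fun n => by simp only [hh]; ring
  have haj : ∀ j, ∀ᶠ n in atTop, a n * lam j ≤ 1 := fun j => by
    have : Tendsto (fun n => a n * lam j) atTop (𝓝 0) := by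
      simpa using R.step.tendsto_zero.mul_const (lam j)
    exact (this.eventually (gt_mem_nhds one_pos)).mono fun _ h => h.le
  have haL : ∀ k : ℝ, ∀ᶠ n in atTop, a n * k ≤ 1 := fun k => by
    have : Tendsto (fun n => a n * k) atTop (𝓝 0) := by
      simpa using R.step.tendsto_zero.mul_const k
    exact (this.eventually (gt_mem_nhds one_pos)).mono fun _ h => h.le
  -- Once `‖t n - θ‖` is below this threshold, the quadratic error involving `ρ` uses up at most the
  -- surplus `L - L'` of the contraction.
  have hη : 0 < (L - L') / C := div_pos (by linarith) hC
  have hrec : ∀ᶠ n in atTop, ‖ρ (n + 1)‖ - D (n + 1) ≤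
      |1 - a n * L'| * (‖ρ n‖ - D n) + a n * h n := by
    filter_upwards [eventually_all.2 haj, haL L, haL L', he.eventually (gt_mem_nhds hη),
      he.eventually (gt_mem_nhds one_pos), eventually_ge_atTop 1] with n h1 h2 h3 h4 h5 h6
    have ha := R.step.pos n h6
    have g1 := norm_add_smul_hessianMap_le hu hlam ha.le h1 h2 (ρ n)
    have g2 : ‖r n‖ ≤ C * ‖t n - θ‖ ^ 2 + δ n := by
      have := le_max_left (‖r n‖ - C * ‖t n - θ‖ ^ 2) 0
      simp only [hδ]; linarith
    have g3 : ‖t n - θ‖ ≤ ‖ell n‖ + ‖b n‖ + ‖ρ n‖ := by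
      rw [hdec n h6]; exact norm_add₃_le
    -- Only one of the two factors is split. The term with `ell` is exactly the forcing of `D` and
    -- cancels in `‖ρ n‖ - D n`.
    have g4 : C * ‖t n - θ‖ ^ 2 ≤ C * (‖t n - θ‖ * ‖ell n‖) + C * ‖t n - θ‖ * ‖b n‖ +
        (L - L') * ‖ρ n‖ := by
      rw [lt_div_iff₀ hC] at h4
      have k1 : C * ‖t n - θ‖ ^ 2 ≤ C * ‖t n - θ‖ * (‖ell n‖ + ‖b n‖ + ‖ρ n‖) := by
        rw [sq, ← mul_assoc]
        exact mul_le_mul_of_nonneg_left g3 (by positivity)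
      have k2 : C * ‖t n - θ‖ * ‖ρ n‖ ≤ (L - L') * ‖ρ n‖ :=
        mul_le_mul_of_nonneg_right (by linarith) (norm_nonneg _)
      linarith
    have g5 : ‖ρ (n + 1)‖ ≤ (1 - a n * L) * ‖ρ n‖ + a n * ‖r n‖ := by
      rw [hρ n h6]
      refine (norm_add_le _ _).trans (add_le_add g1 (le_of_eq ?_))
      rw [norm_smul, Real.norm_of_nonneg ha.le]
    rw [hD n h6, min_eq_left h5.le, abs_of_nonneg (by linarith)]
    have g6 := mul_le_mul_of_nonneg_left (g2.trans (add_le_add_left g4 (δ n))) ha.le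
    simp only [hh]
    linarith
  rw [Metric.tendsto_nhds]
  intro ε hε
  have := eventually_le_of_recursion (x := fun n => ‖ρ n‖ - D n) R.step R.reg_c_sq
    (tendsto_one_sub_abs_div R.step) hL' hh0 hrec (half_pos hε)
  filter_upwards [this, R.c_sq_pos] with n h1 h2
  rw [zero_div, zero_add, div_le_iff₀ h2] at h1
  rw [Real.dist_eq, sub_zero, abs_of_nonneg (div_nonneg (le_max_right _ _) h2.le),
    div_lt_iff₀ h2]
  have : 0 < ε * c n ^ 2 := by positivity
  exact max_lt (by linarith) this

/-- The companion algorithm: the effect of the nonlinearity exceeds the solution of a scalar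
linear recursion by a negligible amount. -/
lemma Rates.tendsto_excess_value (R : Rates a c a' L τ q q') {C : ℝ} (hC : 0 < C)
    {r : ℝ} (hr : 0 < r) (hval : ∀ t, ‖t - θ‖ < r → |f t - f θ| ≤ C * ‖t - θ‖ ^ 2)
    {t ell b ρ : ℕ → EuclideanSpace ℝ (Fin d)} {D y Q : ℕ → ℝ} (ht : Tendsto t atTop (𝓝 θ))
    (hdec : ∀ n, 1 ≤ n → t n - θ = ell n + b n + ρ n)
    {K : ℝ} (hb : ∀ n, 1 ≤ n → ‖b n‖ ≤ K * c n ^ 2)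
    (hex : Tendsto (fun n => max (‖ρ n‖ - D n) 0 / c n ^ 2) atTop (𝓝 0))
    (hy : ∀ n, 1 ≤ n → y (n + 1) = (1 - a' n) * y n + a' n * (f (t n) - f θ))
    (hQ : ∀ n, 1 ≤ n → Q (n + 1) = |1 - a' n| * Q n +
      a' n * (4 * C * (‖ell n‖ ^ 2 + D n ^ 2))) :
    Tendsto (fun n => max (|y n| - Q n) 0 / √(a' n)) atTop (𝓝 0) := by
  set z : ℕ → ℝ := fun n => max (‖ρ n‖ - D n) 0 with hz
  have he : Tendsto (fun n => ‖t n - θ‖) atTop (𝓝 0) := tendsto_iff_norm_sub_tendsto_zero.1 ht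
  set h : ℕ → ℝ := fun n => 4 * C * (‖b n‖ ^ 2 + z n ^ 2) with hh
  have hh0 : Tendsto (fun n => h n / √(a' n)) atTop (𝓝 0) := by
    have h1 : Tendsto (fun n => 4 * C * (K ^ 2 + (z n / c n ^ 2) ^ 2) * (c n ^ 4 / √(a' n)))
        atTop (𝓝 0) := by
      have := (((hex.pow 2).const_add (K ^ 2)).const_mul (4 * C)).mul R.lim_c
      simpa using this
    refine tendsto_of_tendsto_of_tendsto_of_le_of_le' tendsto_const_nhds h1 ?_ ?_
    · exact Eventually.of_forall fun n => by positivity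
    · filter_upwards [eventually_ge_atTop 1] with n hn
      have hc := R.c_pos n hn
      have hs := Real.sqrt_pos.2 (R.step'.pos n hn)
      have e : 4 * C * (K ^ 2 + (z n / c n ^ 2) ^ 2) * (c n ^ 4 / √(a' n)) =
          4 * C * ((K * c n ^ 2) ^ 2 + z n ^ 2) / √(a' n) := by
        field_simp
      rw [e]
      simp only [hh]
      gcongr
      exact hb n hn
  have hrec : ∀ᶠ n in atTop, |y (n + 1)| - Q (n + 1) ≤
      |1 - a' n * 1| * (|y n| - Q n) + a' n * h n := by
    filter_upwards [he.eventually (gt_mem_nhds hr), eventually_ge_atTop 1] with n h1 h2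
    have ha := R.step'.pos n h2
    have g1 := hval (t n) h1
    have g3 : ‖t n - θ‖ ≤ ‖ell n‖ + ‖b n‖ + (D n + z n) := by
      have := le_max_left (‖ρ n‖ - D n) 0
      have h3 : ‖ρ n‖ ≤ D n + z n := by simp only [hz]; linarith
      have h4 : ‖t n - θ‖ ≤ ‖ell n‖ + ‖b n‖ + ‖ρ n‖ := by rw [hdec n h2]; exact norm_add₃_le
      linarith
    -- The factor `4` comes from squaring a sum of four terms. The first two drive `Q`; the last two
    -- are `O(c_n⁴)`, hence `o(√a'_n)`.
    have g4 : ‖t n - θ‖ ^ 2 ≤ 4 * (‖ell n‖ ^ 2 + D n ^ 2 + (‖b n‖ ^ 2 + z n ^ 2)) := by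
      have h3 : ‖t n - θ‖ ^ 2 ≤ (‖ell n‖ + ‖b n‖ + (D n + z n)) ^ 2 :=
        pow_le_pow_left₀ (norm_nonneg _) g3 2
      nlinarith [sq_nonneg (‖ell n‖ - ‖b n‖), sq_nonneg (‖ell n‖ - D n),
        sq_nonneg (‖ell n‖ - z n), sq_nonneg (‖b n‖ - D n), sq_nonneg (‖b n‖ - z n),
        sq_nonneg (D n - z n)]
    have g5 : |y (n + 1)| ≤ |1 - a' n| * |y n| + a' n * |f (t n) - f θ| := by
      rw [hy n h2]
      refine (abs_add_le _ _).trans (le_of_eq ?_)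
      rw [abs_mul, abs_mul, abs_of_pos ha]
    have g6 := mul_le_mul_of_nonneg_left (g1.trans (mul_le_mul_of_nonneg_left g4 hC.le)) ha.le
    rw [hQ n h2, mul_one]
    simp only [hh]
    linarith
  rw [Metric.tendsto_nhds]
  intro ε hε
  have := eventually_le_of_recursion (x := fun n => |y n| - Q n) R.step' R.reg_sqrt
    (tendsto_one_sub_abs_div R.step') (by have := R.lt_two; linarith) hh0 hrec (half_pos hε)
  filter_upwards [this, eventually_ge_atTop 1] with n h1 hn
  have h2 := Real.sqrt_pos.2 (R.step'.pos n hn)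
  rw [zero_div, zero_add, div_le_iff₀ h2] at h1
  rw [Real.dist_eq, sub_zero, abs_of_nonneg (div_nonneg (le_max_right _ _) h2.le),
    div_lt_iff₀ h2]
  have : 0 < ε * √(a' n) := by positivity
  exact max_lt (by linarith) this

end Pathwise

/-! ### Moments of the dominating processes -/

section Dominating

variable {Ω : Type*} {mΩ : MeasurableSpace Ω} {P : Measure Ω}
  {a c a' : ℕ → ℝ} {L τ q q' : ℝ}

/-- Measurability and integrability of the process dominating the remainder. -/
lemma dominating_basic {a ρ : ℕ → ℝ} (ha : ∀ n, 1 ≤ n → 0 < a n) {C : ℝ} (hC : 0 ≤ C)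
    {e ell D : ℕ → Ω → ℝ} (he : ∀ n, Measurable (e n)) (he0 : ∀ n ω, 0 ≤ e n ω)
    (he1 : ∀ n ω, e n ω ≤ 1) (hell0 : ∀ n ω, 0 ≤ ell n ω)
    (hell : ∀ n, Measurable (ell n)) (hell2 : ∀ n, MemLp (ell n) 2 P)
    (hD0 : D 0 = 0) (hD1 : D 1 = 0)
    (hD : ∀ n, 1 ≤ n → ∀ ω, D (n + 1) ω = |ρ n| * D n ω + a n * (C * (e n ω * ell n ω))) (n : ℕ) :
    (∀ ω, 0 ≤ D n ω) ∧ Measurable (D n) ∧ MemLp (D n) 2 P := by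
  rcases Nat.eq_zero_or_pos n with rfl | hn
  · rw [hD0]
    exact ⟨fun _ => le_rfl, measurable_const, MemLp.zero⟩
  induction n, hn using Nat.le_induction with
  | base =>
    rw [show Nat.succ 0 = 1 from rfl, hD1]
    exact ⟨fun _ => le_rfl, measurable_const, MemLp.zero⟩
  | succ n hn ih =>
    have eq : D (n + 1) = fun ω => |ρ n| * D n ω + a n * (C * (e n ω * ell n ω)) :=
      funext (hD n hn)
    refine ⟨fun ω => ?_, ?_, ?_⟩
    · rw [hD n hn]
      have := ih.1 ω
      have := ha n hn
      have := he0 n ω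
      have := hell0 n ω
      positivity
    · rw [eq]
      exact (ih.2.1.const_mul _).add ((((he n).mul (hell n)).const_mul _).const_mul _)
    · rw [eq]
      refine (ih.2.2.const_mul _).add (MemLp.const_mul (MemLp.const_mul ?_ _) _)
      refine (hell2 n).mono ((he n).mul (hell n)).aestronglyMeasurable (ae_of_all _ fun ω => ?_)
      rw [norm_mul, Real.norm_of_nonneg (he0 n ω)]
      exact mul_le_of_le_one_left (norm_nonneg _) (he1 n ω)

/-- First moments of the process dominating the remainder. -/
lemma Rates.tendsto_integral_dominating [IsProbabilityMeasure P]
    (R : Rates a c a' L τ q q') {L' C K : ℝ}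
    (hL' : (1 - 2 * τ) * q / 2 < L') (hC : 0 ≤ C) (hK : 0 ≤ K)
    {e ell D : ℕ → Ω → ℝ} (he : ∀ n, Measurable (e n)) (he0 : ∀ n ω, 0 ≤ e n ω)
    (he1 : ∀ n ω, e n ω ≤ 1) (helim : Tendsto (fun n => ∫ ω, e n ω ^ 2 ∂P) atTop (𝓝 0))
    (hell0 : ∀ n ω, 0 ≤ ell n ω)
    (hell : ∀ n, Measurable (ell n)) (hell2 : ∀ n, MemLp (ell n) 2 P)
    (hellK : ∀ n, 1 ≤ n → ∫ ω, ell n ω ^ 2 ∂P ≤ K * (a n / c n ^ 2))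
    (hD0 : D 0 = 0) (hD1 : D 1 = 0)
    (hD : ∀ n, 1 ≤ n → ∀ ω, D (n + 1) ω = |1 - a n * L'| * D n ω +
      a n * (C * (e n ω * ell n ω))) :
    Tendsto (fun n => (∫ ω, D n ω ∂P) / (√(a n) / c n)) atTop (𝓝 0) := by
  have hbas := fun n => dominating_basic R.step.pos hC he he0 he1 hell0 hell hell2 hD0 hD1 hD n
  have heL : ∀ n, MemLp (e n) 2 P := fun n => MemLp.of_bound (he n).aestronglyMeasurable 1
    (ae_of_all _ fun ω => by rw [Real.norm_of_nonneg (he0 n ω)]; exact he1 n ω)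
  refine tendsto_zero_of_recursion (x := fun n => ∫ ω, D n ω ∂P)
    (h := fun n => C * ∫ ω, e n ω * ell n ω ∂P) R.step R.reg_s
    (tendsto_one_sub_abs_div R.step) hL' ?_ (fun n => integral_nonneg (hbas n).1) ?_
  -- Cauchy-Schwarz separates the factor `e`, whose second moment tends to zero, from `ell`, whose
  -- root mean square is at most `√K` times `√(a n) / c n`.
  · have h1 : Tendsto (fun n => C * (√(∫ ω, e n ω ^ 2 ∂P) * √K)) atTop (𝓝 0) := by
      have := ((Real.continuous_sqrt.tendsto 0).comp helim)
      rw [Real.sqrt_zero] at this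
      simpa using (this.mul_const √K).const_mul C
    refine tendsto_of_tendsto_of_tendsto_of_le_of_le' tendsto_const_nhds h1 ?_ ?_
    · filter_upwards [R.reg_s.eventually_pos] with n hn
      have : 0 ≤ ∫ ω, e n ω * ell n ω ∂P :=
        integral_nonneg fun ω => mul_nonneg (he0 n ω) (hell0 n ω)
      positivity
    · filter_upwards [eventually_ge_atTop 1] with n hn
      have hs := R.reg_s.pos n hn
      have hc := R.c_pos n hn
      rw [div_le_iff₀ hs, mul_assoc C]
      gcongr
      refine (integral_mul_le_sqrt (he0 n) (hell0 n) (heL n) (hell2 n)).trans ?_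
      rw [mul_assoc]
      gcongr
      refine (Real.sqrt_le_sqrt (hellK n hn)).trans (le_of_eq ?_)
      rw [Real.sqrt_mul hK, Real.sqrt_div (R.step.pos n hn).le, Real.sqrt_sq hc.le]
  · filter_upwards [eventually_ge_atTop 1] with n hn
    have i1 : Integrable (D n) P := (hbas n).2.2.integrable (by norm_num)
    have i2 : Integrable (fun ω => e n ω * ell n ω) P := (heL n).integrable_mul (hell2 n)
    simp_rw [hD n hn]
    rw [integral_add (i1.const_mul _) ((i2.const_mul _).const_mul _), integral_const_mul,
      integral_const_mul, integral_const_mul]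

/-- Second moments of the process dominating the remainder. -/
lemma Rates.exists_integral_sq_dominating [IsProbabilityMeasure P]
    (R : Rates a c a' L τ q q') {L' C K : ℝ}
    (hL' : (1 - 2 * τ) * q / 2 < L') (hC : 0 ≤ C)
    {e ell D : ℕ → Ω → ℝ} (he : ∀ n, Measurable (e n)) (he0 : ∀ n ω, 0 ≤ e n ω)
    (he1 : ∀ n ω, e n ω ≤ 1) (hell0 : ∀ n ω, 0 ≤ ell n ω)
    (hell : ∀ n, Measurable (ell n)) (hell2 : ∀ n, MemLp (ell n) 2 P)
    (hellK : ∀ n, 1 ≤ n → ∫ ω, ell n ω ^ 2 ∂P ≤ K * (a n / c n ^ 2))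
    (hD0 : D 0 = 0) (hD1 : D 1 = 0)
    (hD : ∀ n, 1 ≤ n → ∀ ω, D (n + 1) ω = |1 - a n * L'| * D n ω +
      a n * (C * (e n ω * ell n ω))) :
    ∃ K' > 0, ∀ n, 1 ≤ n → ∫ ω, D n ω ^ 2 ∂P ≤ K' * (a n / c n ^ 2) := by
  have hbas := fun n => dominating_basic R.step.pos hC he he0 he1 hell0 hell hell2 hD0 hD1 hD n
  -- `η` is the weight in Young's inequality for the cross term. It reduces the contraction rate of
  -- the squares from `2 L'` to `2 L' - η`, which still exceeds `(1 - 2 τ) q`.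
  set η : ℝ := L' - (1 - 2 * τ) * q / 2 with hη
  have hη0 : 0 < η := by linarith
  have hp : Tendsto (fun n => (1 - (1 + η * a n) * (1 - a n * L') ^ 2) / a n) atTop
      (𝓝 (2 * L' - η)) := by
    have h0 := R.step.tendsto_zero
    have h1 : Tendsto (fun n => (2 * L' - a n * L' ^ 2) - η * (1 - a n * L') ^ 2) atTop
        (𝓝 ((2 * L' - 0 * L' ^ 2) - η * (1 - 0 * L') ^ 2)) :=
      ((h0.mul_const _).const_sub _).sub ((((h0.mul_const _).const_sub _).pow 2).const_mul _)
    simp only [zero_mul, sub_zero, one_pow, mul_one] at h1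
    refine h1.congr' ?_
    filter_upwards [R.step.eventually_pos] with n hn
    field_simp; ring
  have hsmall : ∀ᶠ n in atTop, a n ≤ 1 :=
    (R.step.tendsto_zero.eventually (gt_mem_nhds one_pos)).mono fun _ h => h.le
  refine bound_of_recursion (x := fun n => ∫ ω, D n ω ^ 2 ∂P) (K := (1 + 1 / η) * C ^ 2 * K)
    R.step R.reg_s_sq hp (by linarith) ?_
  filter_upwards [eventually_ge_atTop 1, hsmall] with n hn hn1
  have ha := R.step.pos n hn
  have i1 : Integrable (fun ω => D n ω ^ 2) P := (hbas n).2.2.integrable_sq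
  have i2 : Integrable (fun ω => ell n ω ^ 2) P := (hell2 n).integrable_sq
  have key : ∀ ω, D (n + 1) ω ^ 2 ≤ (1 + η * a n) * (1 - a n * L') ^ 2 * D n ω ^ 2 +
      a n * ((1 + 1 / η) * C ^ 2) * ell n ω ^ 2 := by
    intro ω
    rw [hD n hn]
    set g : ℝ := C * (e n ω * ell n ω) with hg
    set X : ℝ := |1 - a n * L'| * D n ω with hX
    have k1 : (X + a n * g) ^ 2 ≤ (1 + η * a n) * X ^ 2 + a n * (1 + 1 / η) * g ^ 2 := by
      have h1 : 2 * X * g ≤ η * X ^ 2 + 1 / η * g ^ 2 := by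
        have : η * X ^ 2 + 1 / η * g ^ 2 - 2 * X * g = (η * X - g) ^ 2 / η := by
          field_simp; ring
        have h2 : 0 ≤ (η * X - g) ^ 2 / η := by positivity
        linarith
      have h2 : a n ^ 2 * g ^ 2 ≤ a n * g ^ 2 :=
        mul_le_mul_of_nonneg_right (by nlinarith) (sq_nonneg _)
      nlinarith [mul_le_mul_of_nonneg_left h1 ha.le]
    have k2 : g ^ 2 ≤ C ^ 2 * ell n ω ^ 2 := by
      rw [hg, mul_pow, mul_pow]
      have : e n ω ^ 2 ≤ 1 := pow_le_one₀ (he0 n ω) (he1 n ω)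
      have h3 : e n ω ^ 2 * ell n ω ^ 2 ≤ ell n ω ^ 2 :=
        mul_le_of_le_one_left (sq_nonneg _) this
      exact mul_le_mul_of_nonneg_left h3 (sq_nonneg _)
    have k3 : X ^ 2 = (1 - a n * L') ^ 2 * D n ω ^ 2 := by rw [hX, mul_pow, sq_abs]
    rw [k3] at k1
    have k4 := mul_le_mul_of_nonneg_left k2 (show 0 ≤ a n * (1 + 1 / η) by positivity)
    linarith
  have i3 : Integrable (fun ω => (1 + η * a n) * (1 - a n * L') ^ 2 * D n ω ^ 2 +
      a n * ((1 + 1 / η) * C ^ 2) * ell n ω ^ 2) P := (i1.const_mul _).add (i2.const_mul _)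
  refine (integral_mono (hbas (n + 1)).2.2.integrable_sq i3 key).trans ?_
  rw [integral_add (i1.const_mul _) (i2.const_mul _), integral_const_mul, integral_const_mul]
  have := mul_le_mul_of_nonneg_left (hellK n hn)
    (show 0 ≤ a n * ((1 + 1 / η) * C ^ 2) by positivity)
  linarith

/-- Moments of the process dominating the effect of the nonlinearity on the companion
algorithm. -/
lemma Rates.tendsto_integral_dominating_value (R : Rates a c a' L τ q q') {C K K' : ℝ}
    (hC : 0 ≤ C) {ell D Q : ℕ → Ω → ℝ}
    (hell : ∀ n, Measurable (ell n)) (hell2 : ∀ n, MemLp (ell n) 2 P)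
    (hellK : ∀ n, 1 ≤ n → ∫ ω, ell n ω ^ 2 ∂P ≤ K * (a n / c n ^ 2))
    (hDm : ∀ n, Measurable (D n)) (hD2 : ∀ n, MemLp (D n) 2 P)
    (hDK : ∀ n, 1 ≤ n → ∫ ω, D n ω ^ 2 ∂P ≤ K' * (a n / c n ^ 2))
    (hQ0 : Q 0 = 0) (hQ1 : Q 1 = 0)
    (hQ : ∀ n, 1 ≤ n → ∀ ω, Q (n + 1) ω = |1 - a' n| * Q n ω +
      a' n * (C * (ell n ω ^ 2 + D n ω ^ 2))) :
    (∀ n, (∀ ω, 0 ≤ Q n ω) ∧ Measurable (Q n) ∧ Integrable (Q n) P) ∧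
      Tendsto (fun n => (∫ ω, Q n ω ∂P) / √(a' n)) atTop (𝓝 0) := by
  have hi : ∀ n, Integrable (fun ω => ell n ω ^ 2 + D n ω ^ 2) P := fun n =>
    (hell2 n).integrable_sq.add (hD2 n).integrable_sq
  have hbas : ∀ n, (∀ ω, 0 ≤ Q n ω) ∧ Measurable (Q n) ∧ Integrable (Q n) P := by
    intro n
    rcases Nat.eq_zero_or_pos n with rfl | hn
    · rw [hQ0]
      exact ⟨fun _ => le_rfl, measurable_const, integrable_zero _ _ _⟩
    induction n, hn using Nat.le_induction with
    | base =>
      rw [show Nat.succ 0 = 1 from rfl, hQ1]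
      exact ⟨fun _ => le_rfl, measurable_const, integrable_zero _ _ _⟩
    | succ n hn ih =>
      have eq : Q (n + 1) = fun ω => |1 - a' n| * Q n ω +
          a' n * (C * (ell n ω ^ 2 + D n ω ^ 2)) := funext (hQ n hn)
      refine ⟨fun ω => ?_, ?_, ?_⟩
      · rw [hQ n hn]
        have := ih.1 ω
        have := R.step'.pos n hn
        positivity
      · rw [eq]
        exact (ih.2.1.const_mul _).add (((((hell n).pow_const 2).add
          ((hDm n).pow_const 2)).const_mul _).const_mul _)
      · rw [eq]
        exact (ih.2.2.const_mul _).add (((hi n).const_mul _).const_mul _)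
  refine ⟨hbas, ?_⟩
  refine tendsto_zero_of_recursion (x := fun n => ∫ ω, Q n ω ∂P)
    (h := fun n => C * ((K + K') * (a n / c n ^ 2))) R.step' R.reg_sqrt
    (tendsto_one_sub_abs_div (k := 1) R.step') (by have := R.lt_two; linarith) ?_
    (fun n => integral_nonneg (hbas n).1) ?_
  · have := R.lim_s.const_mul (C * (K + K'))
    rw [mul_zero] at this
    exact this.congr fun n => by ring
  · filter_upwards [eventually_ge_atTop 1] with n hn
    simp_rw [hQ n hn]
    rw [integral_add ((hbas n).2.2.const_mul _) (((hi n).const_mul _).const_mul _),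
      integral_const_mul, integral_const_mul, integral_const_mul,
      integral_add (hell2 n).integrable_sq (hD2 n).integrable_sq, mul_one]
    have h1 := hellK n hn
    have h2 := hDK n hn
    have ha := R.step'.pos n hn
    gcongr
    linarith

end Dominating


/-! ### The limiting bias and covariance -/

section Limits

variable {d : ℕ} {f : EuclideanSpace ℝ (Fin d) → ℝ} {θ : EuclideanSpace ℝ (Fin d)}
  {a c a' : ℕ → ℝ} {L τ q q' : ℝ}

/-- The deterministic bias is asymptotically equivalent to `c_n² Δ^(θ)`. -/
lemma Rates.tendsto_bias {l : EReal} (R : Rates a c a' L τ l⁻¹.toReal q')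
    (hf : RegularMaximum f θ L) {b : ℕ → EuclideanSpace ℝ (Fin d)}
    (hb : ∀ n, 1 ≤ n → b (n + 1) = (b n + a n • hessianMap f θ (b n)) +
      (a n * c n ^ 2) • biasVec f θ) :
    Tendsto (fun n => (c n ^ 2)⁻¹ • b n) atTop (𝓝 (biasTheta f θ τ l)) := by
  obtain ⟨u, lam, hlam, hu⟩ := hf.exists_basis
  have hs : ∀ j, 4 * τ * l⁻¹.toReal / 2 < lam j := fun j => by
    have := R.lt_L
    have := hlam j
    linarith
  have hj : ∀ j, Tendsto (fun n => inner ℝ (u j) (b n) / c n ^ 2) atTop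
      (𝓝 (inner ℝ (u j) (biasTheta f θ τ l))) := by
    intro j
    have hp : Tendsto (fun n => (1 - (1 - a n * lam j)) / a n) atTop (𝓝 (lam j)) := by
      refine tendsto_const_nhds.congr' ?_
      filter_upwards [R.step.eventually_pos] with n hn
      field_simp; ring
    have := tendsto_of_recursion (x := fun n => inner ℝ (u j) (b n))
      (h := fun n => c n ^ 2 * inner ℝ (u j) (biasVec f θ)) (h0 := inner ℝ (u j) (biasVec f θ))
      R.step R.reg_c_sq hp (by have := hs j; linarith) ?_ ?_
    · convert this using 2
      rw [biasTheta, WithLp.toLp_smul, real_inner_smul_right,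
        RegularMaximum.inner_resolvent hu hs, biasVec,
        WithLp.toLp_smul, real_inner_smul_right]
      have h1 := hs j
      have h2 : 4 * τ * l⁻¹.toReal / 2 - lam j ≠ 0 := by linarith
      have h3 : lam j - 2 * τ * l⁻¹.toReal ≠ 0 := by
        intro h; apply h2; linarith
      have h4 : 4 * τ * l⁻¹.toReal / 2 - lam j = -(lam j - 2 * τ * l⁻¹.toReal) := by ring
      rw [h4, div_neg]
      ring
    · refine tendsto_const_nhds.congr' ?_
      filter_upwards [R.c_sq_pos] with n hn
      rw [mul_div_cancel_left₀ _ hn.ne']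
    · filter_upwards [eventually_ge_atTop 1] with n hn
      rw [hb n hn, inner_add_right, inner_add_right, real_inner_smul_right, real_inner_smul_right,
        hu]
      ring
  rw [← u.sum_repr' (biasTheta f θ τ l)]
  refine (tendsto_finsetSum _ fun j _ => (hj j).smul_const (u j)).congr fun n => ?_
  rw [← u.sum_repr' ((c n ^ 2)⁻¹ • b n)]
  refine Finset.sum_congr rfl fun j _ => ?_
  rw [real_inner_smul_right, div_eq_inv_mul]

/-- The covariance is diagonal in the eigenbasis of the Hessian, which allows comparison with the
variances found coordinate by coordinate. -/
lemma dotProduct_covTheta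
    {u : OrthonormalBasis (Fin d) ℝ (EuclideanSpace ℝ (Fin d))} {lam : Fin d → ℝ}
    (hu : ∀ j x, inner ℝ (u j) (hessianMap f θ x) = -lam j * inner ℝ (u j) x) {σ : ℝ} {l : EReal}
    (hs : ∀ j, (1 - 2 * τ) * l⁻¹.toReal / 2 < lam j) (x : Fin d → ℝ) :
    x ⬝ᵥ (covTheta f θ σ τ l).mulVec x = ∑ j, inner ℝ (u j) (WithLp.toLp 2 x) ^ 2 *
      (σ ^ 2 / (4 * (lam j - (1 - 2 * τ) * l⁻¹.toReal / 2))) := by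
  have e : x ⬝ᵥ (covTheta f θ σ τ l).mulVec x =
      inner ℝ (WithLp.toLp 2 x) (WithLp.toLp 2 ((covTheta f θ σ τ l).mulVec x)) := by
    simp [PiLp.inner_apply, dotProduct, mul_comm]
  rw [e, ← u.sum_inner_mul_inner]
  refine Finset.sum_congr rfl fun j _ => ?_
  rw [covTheta, Matrix.smul_mulVec, WithLp.toLp_smul, real_inner_smul_right,
    RegularMaximum.inner_resolvent hu hs, real_inner_comm]
  have h1 := hs j
  have h3 : lam j - (1 - 2 * τ) * l⁻¹.toReal / 2 ≠ 0 := by linarith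
  rw [← neg_sub, div_neg]
  field_simp

/-- Needed for the characteristic function of `multivariateGaussian` to be the expected one;
positivity is the stability condition `ξ / 2 < L`. -/
lemma posSemidef_covTheta {l : EReal} (R : Rates a c a' L τ l⁻¹.toReal q')
    (hf : RegularMaximum f θ L) (σ : ℝ) : (covTheta f θ σ τ l).PosSemidef := by
  obtain ⟨u, lam, hlam, hu⟩ := hf.exists_basis
  have hs : ∀ j, (1 - 2 * τ) * l⁻¹.toReal / 2 < lam j := fun j => by
    have := R.lt_two_L
    have := hlam j
    linarith
  refine Matrix.PosSemidef.of_dotProduct_mulVec_nonneg ?_ fun x => ?_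
  · have h1 : (hessian f θ + ((1 - 2 * τ) * l⁻¹.toReal / 2) •
        (1 : Matrix (Fin d) (Fin d) ℝ)).IsHermitian :=
      hf.isHermitian.add (Matrix.isHermitian_one.smul (IsSelfAdjoint.all _))
    exact h1.inv.smul (IsSelfAdjoint.all _)
  · rw [star_trivial, dotProduct_covTheta hu hs]
    refine Finset.sum_nonneg fun j _ => mul_nonneg (sq_nonneg _) (div_nonneg (sq_nonneg _) ?_)
    have := hs j
    linarith

lemma dotProduct_blockCov (S : Matrix (Fin d) (Fin d) ℝ) (v : ℝ) (x : Fin d ⊕ Unit → ℝ) :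
    x ⬝ᵥ (blockCov S v).mulVec x =
      (x ∘ Sum.inl) ⬝ᵥ S.mulVec (x ∘ Sum.inl) + v * x (Sum.inr ()) ^ 2 := by
  rw [blockCov, Matrix.fromBlocks_mulVec]
  simp [dotProduct, Matrix.mulVec, Fintype.sum_sum_type]
  ring

lemma posSemidef_blockCov {S : Matrix (Fin d) (Fin d) ℝ} (hS : S.PosSemidef) {v : ℝ} (hv : 0 ≤ v) :
    (blockCov S v).PosSemidef := by
  refine Matrix.PosSemidef.of_dotProduct_mulVec_nonneg ?_ fun x => ?_
  · ext i j
    rcases i with i | i <;> rcases j with j | j <;> simp [blockCov]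
    exact hS.isHermitian.apply i j
  · have := hS.dotProduct_mulVec_nonneg (x ∘ Sum.inl)
    simp only [star_trivial] at this ⊢
    rw [dotProduct_blockCov]
    positivity

end Limits

/-! ### Coordinates of the noise -/

section Noise

variable {Ω : Type*} {d δ : ℕ}

/-- The coefficients of the observation errors in the coordinates of the error of the gradient
estimate, and in the error of the value estimate. -/
noncomputable def noiseCoeff (δ : ℕ) (u : OrthonormalBasis (Fin d) ℝ (EuclideanSpace ℝ (Fin d))) :
    Fin d ⊕ Unit → Label d δ → ℝ
  | Sum.inl j, Sum.inl i => u j i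
  | Sum.inl j, Sum.inr (Sum.inl i) => -u j i
  | Sum.inl _, Sum.inr (Sum.inr _) => 0
  | Sum.inr _, Sum.inl _ => 0
  | Sum.inr _, Sum.inr (Sum.inl _) => 0
  | Sum.inr _, Sum.inr (Sum.inr _) => 1 / (δ : ℝ)

/-- An orthonormal change of basis preserves a scalar covariance. Differences of two errors double
the variance, the average divides it by `δ`, and the two blocks use disjoint sets of observations.
-/
lemma sum_noiseCoeff_mul (hδ : 1 ≤ δ)
    (u : OrthonormalBasis (Fin d) ℝ (EuclideanSpace ℝ (Fin d))) (v : ℝ) (i k : Fin d ⊕ Unit) :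
    ∑ s, noiseCoeff δ u i s * noiseCoeff δ u k s * v =
      if i = k then Sum.elim (fun _ => 2 * v) (fun _ => v / δ) i else 0 := by
  have hδ' : (δ : ℝ) ≠ 0 := by positivity
  have horth : ∀ i k, ∑ s, u i s * u k s = if i = k then 1 else 0 := by
    intro i k
    rw [← orthonormal_iff_ite.1 u.orthonormal i k, PiLp.inner_apply]
    exact Finset.sum_congr rfl fun s _ => by simp [mul_comm]
  rcases i with i | i <;> rcases k with k | k
  · simp only [Fintype.sum_sum_type, noiseCoeff, ← Finset.sum_mul, neg_mul_neg, horth,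
      Sum.inl.injEq, Sum.elim_inl]
    split_ifs
    · ring
    · simp
  · simp [Fintype.sum_sum_type, noiseCoeff]
  · simp [Fintype.sum_sum_type, noiseCoeff]
  · simp only [Fintype.sum_sum_type, noiseCoeff]
    simp
    field_simp

variable {κ : Kernel (EuclideanSpace ℝ (Fin d)) ℝ} {c : ℕ → ℝ}
  {T : ℕ → Ω → EuclideanSpace ℝ (Fin d)} {Z : ℕ → Label d δ → Ω → ℝ}

lemma gradEstimate_eq (u : OrthonormalBasis (Fin d) ℝ (EuclideanSpace ℝ (Fin d))) (n : ℕ) (ω : Ω) :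
    gradEstimate c Z n ω = diffQuotient (regression κ) (c n) (T n ω) +
      (1 / (2 * c n)) • ∑ j, (∑ s, noiseCoeff δ u (Sum.inl j) s * noise κ c T Z n s ω) • u j := by
  have e : ∀ j, ∑ s, noiseCoeff δ u (Sum.inl j) s * noise κ c T Z n s ω =
      inner ℝ (u j) (WithLp.toLp 2 fun i => noise κ c T Z n (Label.plus i) ω -
        noise κ c T Z n (Label.minus i) ω) := by
    intro j
    simp only [Fintype.sum_sum_type, noiseCoeff, PiLp.inner_apply, zero_mul, Finset.sum_const_zero,
      add_zero, ← Finset.sum_add_distrib]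
    refine Finset.sum_congr rfl fun i _ => ?_
    simp only [RCLike.inner_apply, conj_trivial]
    ring
  simp_rw [e, u.sum_repr', gradEstimate, diffQuotient]
  rw [← smul_add, ← WithLp.toLp_add]
  congr 2
  ext i
  simp only [Pi.add_apply, noise, queryPoint]
  ring

lemma valueEstimate_eq (hδ : 1 ≤ δ)
    (u : OrthonormalBasis (Fin d) ℝ (EuclideanSpace ℝ (Fin d))) (n : ℕ) (ω : Ω) :
    valueEstimate Z n ω = regression κ (T n ω) +
      ∑ s, noiseCoeff δ u (Sum.inr ()) s * noise κ c T Z n s ω := by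
  have hδ' : (δ : ℝ) ≠ 0 := by positivity
  simp only [Fintype.sum_sum_type, noiseCoeff, zero_mul, Finset.sum_const_zero, zero_add,
    valueEstimate, noise, queryPoint, ← Finset.mul_sum, Finset.sum_sub_distrib, Finset.sum_const,
    Finset.card_univ, Fintype.card_fin, nsmul_eq_mul]
  field_simp
  ring

end Noise

/-! ### The central limit theorem after normalization -/

section Normalized

variable {Ω J : Type*} [DecidableEq J] [Fintype J] {mΩ : MeasurableSpace Ω}
  {P : Measure Ω} {𝓖 : ℕ → MeasurableSpace Ω} {ξ : ℕ → J → Ω → ℝ} {v : J → ℝ} {p : ℝ}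

/-- Central limit theorem for linear recursions with regularly varying normalizations. -/
theorem IsWhiteNoise.tendsto_charFun_normalized [IsProbabilityMeasure P]
    (h : IsWhiteNoise P 𝓖 ξ v p)
    (hv0 : ∀ j, 0 ≤ v j) {y : ℕ → J → Ω → ℝ} {ρ b γ s : J → ℕ → ℝ} {lam κ β : J → ℝ}
    (hy1 : ∀ j, y 1 j = 0)
    (hy : ∀ n, 1 ≤ n → ∀ j ω, y (n + 1) j ω = ρ j n * y n j ω + b j n * ξ n j ω)
    (hγ : ∀ j, IsStep (γ j)) (hs : ∀ j, RegVar (γ j) (s j) (κ j))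
    (hρ : ∀ j, Tendsto (fun n => (1 - ρ j n) / γ j n) atTop (𝓝 (lam j)))
    (hlam : ∀ j, κ j < lam j)
    (hb : ∀ j, Tendsto (fun n => b j n ^ 2 / (γ j n * s j n ^ 2)) atTop (𝓝 (β j))) (t : J → ℝ) :
    Tendsto (fun n => ∫ ω, Complex.exp (((∑ j, t j * (y n j ω / s j n) : ℝ) : ℂ) * Complex.I) ∂P)
      atTop (𝓝 (Complex.exp
        (-((∑ j, t j ^ 2 * (β j * v j / (2 * (lam j - κ j))) : ℝ) : ℂ) / 2))) := by
  refine h.tendsto_charFun_linear hv0 (X := fun n j ω => y n j ω / s j n)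
    (ρ := fun j n => ρ j n * (s j n / s j (n + 1))) (b := fun j n => b j n / s j (n + 1))
    (γ := γ) (lam := fun j => lam j - κ j) (β := β) (fun j => ?_) (fun n hn j ω => ?_) hγ
    (fun j => ?_) (fun j => sub_pos.2 (hlam j)) (fun j => ?_) t
  · ext ω
    simp [hy1]
  · have h1 := ((hs j).pos n hn).ne'
    have h2 := ((hs j).pos (n + 1) (by omega)).ne'
    simp only [hy n hn]
    field_simp
  -- Dividing by `s` multiplies `ρ j n` by `s j n / s j (n + 1)`, which lowers the contraction rate
  -- by the drift `κ j`.
  · have h1 := (hρ j).sub (((hs j).lim).mul (((hρ j).mul (hγ j).tendsto_zero).const_sub 1))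
    simp only [mul_zero, sub_zero, mul_one] at h1
    refine h1.congr' ?_
    filter_upwards [(hγ j).eventually_pos] with n hn
    field_simp
    ring
  · have h1 := (hb j).mul (((hs j).tendsto_ratio (hγ j)).pow 2)
    simp only [one_pow, mul_one] at h1
    refine h1.congr' ?_
    filter_upwards [(hγ j).eventually_pos, eventually_ge_atTop 1] with n hn hn1
    have h1 := ((hs j).pos n hn1).ne'
    have h2 := ((hs j).pos (n + 1) (by omega)).ne'
    field_simp

end Normalized


/-! ### Linearization of the algorithm -/

section Remainder

variable {Ω : Type*} [mΩ : MeasurableSpace Ω] {P : Measure Ω} [IsProbabilityMeasure P] {d δ : ℕ}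
  {κ : Kernel (EuclideanSpace ℝ (Fin d)) ℝ} {θ : EuclideanSpace ℝ (Fin d)} {a c a' : ℕ → ℝ}
  {Z : ℕ → Label d δ → Ω → ℝ} {T : ℕ → Ω → EuclideanSpace ℝ (Fin d)} {M : ℕ → Ω → ℝ}
  {L τ q q' : ℝ}

/-- The difference between the double algorithm and its linearization is dominated, up to an
almost surely negligible excess, by processes which are negligible in mean. -/
lemma Rates.exists_dominating (R : Rates a c a' L τ q q') (hδ : 1 ≤ δ)
    (hAlg : IsCompanionAlgorithm P κ a c a' Z T M)
    (hA1 : ∀ᵐ ω ∂P, Tendsto (fun n => T n ω) atTop (𝓝 θ))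
    (hf : RegularMaximum (regression κ) θ L)
    (u : OrthonormalBasis (Fin d) ℝ (EuclideanSpace ℝ (Fin d)))
    {ell : ℕ → Ω → EuclideanSpace ℝ (Fin d)} {Lam : ℕ → Ω → ℝ} {b : ℕ → EuclideanSpace ℝ (Fin d)}
    (hell : ∀ n, 1 ≤ n → ∀ ω, ell (n + 1) ω =
      (ell n ω + a n • hessianMap (regression κ) θ (ell n ω)) +
        (a n / (2 * c n)) •
          ∑ j, (∑ s, noiseCoeff δ u (Sum.inl j) s * noise κ c T Z n s ω) • u j)
    (hLam : ∀ n, 1 ≤ n → ∀ ω, Lam (n + 1) ω = (1 - a' n) * Lam n ω +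
      a' n * ∑ s, noiseCoeff δ u (Sum.inr ()) s * noise κ c T Z n s ω)
    (hb : ∀ n, 1 ≤ n → b (n + 1) = (b n + a n • hessianMap (regression κ) θ (b n)) +
      (a n * c n ^ 2) • biasVec (regression κ) θ)
    {K : ℝ} (hbK : ∀ n, 1 ≤ n → ‖b n‖ ≤ K * c n ^ 2)
    (hellm : ∀ n, Measurable (ell n)) (hell2 : ∀ n, MemLp (ell n) 2 P)
    {K₁ : ℝ} (hK₁ : 0 ≤ K₁) (hellK : ∀ n, 1 ≤ n → ∫ ω, ‖ell n ω‖ ^ 2 ∂P ≤ K₁ * (a n / c n ^ 2)) :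
    ∃ D Q : ℕ → Ω → ℝ,
      (∀ n, (∀ ω, 0 ≤ D n ω) ∧ Measurable (D n) ∧ Integrable (D n) P) ∧
      (∀ n, (∀ ω, 0 ≤ Q n ω) ∧ Measurable (Q n) ∧ Integrable (Q n) P) ∧
      Tendsto (fun n => (∫ ω, D n ω ∂P) / (√(a n) / c n)) atTop (𝓝 0) ∧
      Tendsto (fun n => (∫ ω, Q n ω ∂P) / √(a' n)) atTop (𝓝 0) ∧
      ∀ᵐ ω ∂P,
        Tendsto (fun n => max (‖T n ω - θ - ell n ω - b n‖ - D n ω) 0 / c n ^ 2) atTop (𝓝 0) ∧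
        Tendsto (fun n => max (|M n ω - regression κ θ - Lam n ω| - Q n ω) 0 / √(a' n)) atTop
          (𝓝 0) := by
  -- The reduced rate `L'` must exceed the drift of `√a_n / c_n`, for the moments of `D`, and that
  -- of `c_n²`, for the pathwise excess; it stays below `L` to leave room for absorbing the
  -- quadratic error.
  obtain ⟨L', hL', hL'L⟩ : ∃ L', max ((1 - 2 * τ) * q / 2) (2 * τ * q) < L' ∧ L' < L :=
    exists_between (max_lt (by have := R.lt_two_L; linarith) R.lt_L)
  obtain ⟨C, hC, hexp⟩ := hf.exists_gradient_expansion
  obtain ⟨C₂, hC₂, r, hr, hval⟩ := hf.exists_value_bound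
  -- Truncation turns almost sure convergence into convergence of second moments, by dominated
  -- convergence, and is eventually without effect on each convergent trajectory.
  set e : ℕ → Ω → ℝ := fun n ω => min ‖T n ω - θ‖ 1 with he
  have hem : ∀ n, Measurable (e n) := fun n =>
    ((hAlg.measurable_T n).sub_const θ).norm.min measurable_const
  have he0 : ∀ n ω, 0 ≤ e n ω := fun n ω => le_min (norm_nonneg _) zero_le_one
  have he1 : ∀ n ω, e n ω ≤ 1 := fun n ω => min_le_right _ _
  have helim : Tendsto (fun n => ∫ ω, e n ω ^ 2 ∂P) atTop (𝓝 0) := by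
    have := tendsto_integral_of_dominated_convergence (μ := P) (F := fun n ω => e n ω ^ 2)
      (f := fun _ => (0 : ℝ)) (fun _ => 1) (fun n => ((hem n).pow_const 2).aestronglyMeasurable)
      (integrable_const _) (fun n => ae_of_all _ fun ω => ?_) ?_
    · simpa using this
    · rw [Real.norm_of_nonneg (sq_nonneg _)]
      exact pow_le_one₀ (he0 n ω) (he1 n ω)
    · filter_upwards [hA1] with ω hω
      have h1 : Tendsto (fun n => ‖T n ω - θ‖) atTop (𝓝 0) :=
        tendsto_iff_norm_sub_tendsto_zero.1 hω
      have h2 := ((h1.min tendsto_const_nhds : Tendsto (fun n => min ‖T n ω - θ‖ 1) atTop _)).pow 2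
      simpa using h2
  have hnm : ∀ n, Measurable fun ω => ‖ell n ω‖ := fun n => (hellm n).norm
  have hn2 : ∀ n, MemLp (fun ω => ‖ell n ω‖) 2 P := fun n => (hell2 n).norm
  obtain ⟨D, hD0, hD1, hD⟩ := exists_seq_from_one (0 : Ω → ℝ) fun n D ω =>
    |1 - a n * L'| * D ω + a n * (C * (e n ω * ‖ell n ω‖))
  obtain ⟨Q, hQ0, hQ1, hQ⟩ := exists_seq_from_one (0 : Ω → ℝ) fun n Q ω =>
    |1 - a' n| * Q ω + a' n * (4 * C₂ * (‖ell n ω‖ ^ 2 + D n ω ^ 2))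
  replace hD : ∀ n, 1 ≤ n → ∀ ω, D (n + 1) ω =
    |1 - a n * L'| * D n ω + a n * (C * (e n ω * ‖ell n ω‖)) := fun n hn ω => congrFun (hD n hn) ω
  replace hQ : ∀ n, 1 ≤ n → ∀ ω, Q (n + 1) ω =
    |1 - a' n| * Q n ω + a' n * (4 * C₂ * (‖ell n ω‖ ^ 2 + D n ω ^ 2)) :=
    fun n hn ω => congrFun (hQ n hn) ω
  have hL1 := (le_max_left _ _).trans_lt hL'
  have hbas := fun n => dominating_basic R.step.pos hC.le hem he0 he1 (fun n ω => norm_nonneg _)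
    hnm hn2 hD0 hD1 hD n
  obtain ⟨K₂, hK₂, hDK⟩ := R.exists_integral_sq_dominating (K := K₁) hL1 hC.le hem he0 he1
    (fun n ω => norm_nonneg _) hnm hn2 hellK hD0 hD1 hD
  obtain ⟨hQbas, hQlim⟩ := R.tendsto_integral_dominating_value (K := K₁) (K' := K₂)
    (C := 4 * C₂) (by positivity) hnm hn2 hellK (fun n => (hbas n).2.1) (fun n => (hbas n).2.2)
    hDK hQ0 hQ1 hQ
  refine ⟨D, Q, fun n => ⟨(hbas n).1, (hbas n).2.1, (hbas n).2.2.integrable (by norm_num)⟩, hQbas,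
    R.tendsto_integral_dominating hL1 hC.le hK₁ hem he0 he1 helim (fun n ω => norm_nonneg _) hnm
      hn2 hellK hD0 hD1 hD, hQlim, ?_⟩
  filter_upwards [hA1] with ω hω
  have hdec : ∀ n, 1 ≤ n → T n ω - θ = ell n ω + b n + (T n ω - θ - ell n ω - b n) :=
    fun n _ => by abel
  have hex := R.tendsto_excess_remainder hf ((le_max_right _ _).trans_lt hL') hL'L hC hexp
    (t := fun n => T n ω) (ell := fun n => ell n ω) (b := b)
    (ρ := fun n => T n ω - θ - ell n ω - b n) (D := fun n => D n ω) hω hdec (fun n hn => ?_) hbK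
    (fun n hn => hD n hn ω)
  · refine ⟨hex, ?_⟩
    refine R.tendsto_excess_value hC₂ hr hval (t := fun n => T n ω) (ell := fun n => ell n ω)
      (b := b) (ρ := fun n => T n ω - θ - ell n ω - b n) (D := fun n => D n ω)
      (y := fun n => M n ω - regression κ θ - Lam n ω) (Q := fun n => Q n ω) hω hdec hbK hex
      (fun n hn => ?_) (fun n hn => hQ n hn ω)
    rw [hAlg.step_M n hn, hLam n hn, valueEstimate_eq hδ u n ω]
    ring
  · have hc := (R.c_pos n hn).ne'
    rw [hAlg.step_T n hn, hell n hn, hb n hn, gradEstimate_eq (κ := κ) (T := T) u n ω]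
    have e1 : a n / (2 * c n) = a n * (1 / (2 * c n)) := by ring
    rw [e1]
    simp only [smul_add, smul_sub, map_sub, mul_smul]
    abel

end Remainder

lemma RegVar.sq {γ v : ℕ → ℝ} {κ : ℝ} (h : RegVar γ v κ) (hγ : IsStep γ) :
    RegVar γ (fun n => v n ^ 2) (2 * κ) := by
  refine ⟨fun n hn => pow_pos (h.pos n hn) 2, ?_⟩
  have := h.lim.mul ((h.tendsto_ratio hγ).add_const 1)
  rw [one_add_one_eq_two, mul_comm κ] at this
  refine this.congr fun n => ?_
  rw [← div_pow]
  ring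

section Processes

variable {Ω : Type*} [mΩ : MeasurableSpace Ω] {P : Measure Ω} [IsProbabilityMeasure P] {J : Type*}
  [DecidableEq J] [Fintype J] {𝓖 : ℕ → MeasurableSpace Ω} {ξ : ℕ → J → Ω → ℝ} {v : J → ℝ} {p : ℝ}

/-- The solution of a diagonal linear recursion driven by a white noise. -/
lemma IsWhiteNoise.exists_linear (h : IsWhiteNoise P 𝓖 ξ v p) (hv0 : ∀ j, 0 ≤ v j)
    {b γ s : J → ℕ → ℝ} {lam κ β : J → ℝ}
    (hγ : ∀ j, IsStep (γ j)) (hs : ∀ j, RegVar (γ j) (s j) (κ j)) (hlam : ∀ j, κ j < lam j)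
    (hb : ∀ j n, 1 ≤ n → b j n ^ 2 = γ j n * (β j * s j n ^ 2)) :
    ∃ y : ℕ → J → Ω → ℝ,
      (∀ n, 1 ≤ n → ∀ j ω, y (n + 1) j ω = (1 - γ j n * lam j) * y n j ω + b j n * ξ n j ω) ∧
      (∀ n j, Measurable (y n j) ∧ MemLp (y n j) 2 P) ∧
      (∃ K > 0, ∀ n, 1 ≤ n → ∀ j, ∫ ω, y n j ω ^ 2 ∂P ≤ K * s j n ^ 2) ∧
      ∀ t : J → ℝ, Tendsto
        (fun n => ∫ ω, Complex.exp (((∑ j, t j * (y n j ω / s j n) : ℝ) : ℂ) * Complex.I) ∂P)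
        atTop (𝓝 (Complex.exp
          (-((∑ j, t j ^ 2 * (β j * v j / (2 * (lam j - κ j))) : ℝ) : ℂ) / 2))) := by
  have hex : ∀ j, ∃ y : ℕ → Ω → ℝ, y 0 = 0 ∧ y 1 = 0 ∧ ∀ n, 1 ≤ n → y (n + 1) =
      fun ω => (1 - γ j n * lam j) * y n ω + b j n * ξ n j ω := fun j =>
    exists_seq_from_one (0 : Ω → ℝ) fun n y ω => (1 - γ j n * lam j) * y ω + b j n * ξ n j ω
  choose y hy0 hy1 hy using hex
  replace hy : ∀ j n, 1 ≤ n → ∀ ω, y j (n + 1) ω =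
    (1 - γ j n * lam j) * y j n ω + b j n * ξ n j ω := fun j n hn ω => congrFun (hy j n hn) ω
  have hρ : ∀ j, Tendsto (fun n => (1 - (1 - γ j n * lam j)) / γ j n) atTop (𝓝 (lam j)) := by
    intro j
    refine tendsto_const_nhds.congr' ?_
    filter_upwards [(hγ j).eventually_pos] with n hn
    field_simp; ring
  refine ⟨fun n j => y j n, fun n hn j ω => hy j n hn ω, fun n j => ?_, ?_, fun t => ?_⟩
  · rcases Nat.eq_zero_or_pos n with rfl | hn
    · simp only [hy0]
      exact ⟨measurable_const, MemLp.zero⟩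
    · exact ⟨(h.measurable_linear (hy1 j) (hy j) hn).mono (h.le n) le_rfl,
        h.memLp_linear (hy1 j) (hy j) hn⟩
  · have hK := fun j => h.exists_moment_bound_linear (hy1 j) (hy j) (hv0 j) (hγ j)
      ((hs j).sq (hγ j)) (hρ j) (by have := hlam j; linarith) (K := β j)
      (fun n hn => (hb j n hn).le)
    choose K hK0 hK using hK
    have hsum : 0 ≤ ∑ j, K j := Finset.sum_nonneg fun j _ => (hK0 j).le
    refine ⟨∑ j, K j + 1, by linarith, fun n hn j => (hK j n hn).trans ?_⟩
    gcongr
    have := Finset.single_le_sum (fun j _ => (hK0 j).le) (Finset.mem_univ j)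
    linarith
  · refine h.tendsto_charFun_normalized hv0 hy1 (fun n hn j ω => hy j n hn ω) hγ hs hρ hlam
      (fun j => ?_) t
    refine tendsto_const_nhds.congr' ?_
    filter_upwards [eventually_ge_atTop 1] with n hn
    have h1 := ((hγ j).pos n hn).ne'
    have h2 := ((hs j).pos n hn).ne'
    rw [hb j n hn]
    field_simp

end Processes


/-! ### Convergence in distribution -/

section Stack

variable {d : ℕ}

lemma stack_sub (x x' : EuclideanSpace ℝ (Fin d)) (y y' : ℝ) :
    stack x y - stack x' y' = stack (x - x') (y - y') := by
  ext i
  rcases i with i | i <;> simp [stack]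

lemma inner_stack (x : EuclideanSpace ℝ (Fin d)) (y : ℝ) (t : EuclideanSpace ℝ (Fin d ⊕ Unit)) :
    inner ℝ (stack x y) t =
      inner ℝ x (WithLp.toLp 2 fun i => t (Sum.inl i)) + y * t (Sum.inr ()) := by
  simp [stack, PiLp.inner_apply, Fintype.sum_sum_type, mul_comm]

lemma norm_stack_le (x : EuclideanSpace ℝ (Fin d)) (y : ℝ) : ‖stack x y‖ ≤ ‖x‖ + |y| := by
  refine abs_le_of_sq_le_sq' ?_ (by positivity) |>.2
  have e : ‖stack x y‖ ^ 2 = ‖x‖ ^ 2 + |y| ^ 2 := by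
    simp [EuclideanSpace.norm_sq_eq, stack, Fintype.sum_sum_type]
  rw [e]
  nlinarith [norm_nonneg x, abs_nonneg y]

lemma continuous_stack : Continuous fun p : EuclideanSpace ℝ (Fin d) × ℝ => stack p.1 p.2 := by
  refine (PiLp.continuous_toLp 2 _).comp (continuous_pi fun i => ?_)
  rcases i with i | i
  · exact (continuous_apply i).comp ((PiLp.continuous_ofLp 2 _).comp continuous_fst)
  · exact continuous_snd

lemma Measurable.stack {Ω : Type*} [MeasurableSpace Ω] {x : Ω → EuclideanSpace ℝ (Fin d)}
    {y : Ω → ℝ} (hx : Measurable x) (hy : Measurable y) :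
    Measurable fun ω => KieferWolfowitz.stack (x ω) (y ω) :=
  continuous_stack.measurable.comp (hx.prodMk hy)

end Stack

/-- Characteristic functions determine convergence in distribution. -/
lemma tendstoInDistribution_of_charFun {Ω Ω' E : Type*} [MeasurableSpace Ω] [MeasurableSpace Ω']
    {P : Measure Ω} [IsProbabilityMeasure P] {P' : Measure Ω'} [IsProbabilityMeasure P']
    [NormedAddCommGroup E] [InnerProductSpace ℝ E] [FiniteDimensional ℝ E] [MeasurableSpace E]
    [BorelSpace E] {X : ℕ → Ω → E} {V : Ω' → E} (hX : ∀ n, Measurable (X n)) (hV : Measurable V)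
    (h : ∀ t, Tendsto (fun n => ∫ ω, Complex.exp ((inner ℝ (X n ω) t : ℝ) * Complex.I) ∂P) atTop
      (𝓝 (charFun (P'.map V) t))) :
    TendstoInDistribution X atTop V (fun _ => P) P' where
  forall_aemeasurable n := (hX n).aemeasurable
  aemeasurable_limit := hV.aemeasurable
  tendsto := by
    refine ProbabilityMeasure.tendsto_iff_tendsto_charFun.2 fun t => ?_
    refine (h t).congr fun n => ?_
    rw [ProbabilityMeasure.coe_mk, charFun_apply, integral_map (hX n).aemeasurable]
    exact (Continuous.aestronglyMeasurable (by fun_prop))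

lemma integral_le_sqrt_integral_sq {Ω : Type*} [MeasurableSpace Ω] {P : Measure Ω}
    [IsProbabilityMeasure P] {g : Ω → ℝ} (hg0 : ∀ ω, 0 ≤ g ω) (hg : MemLp g 2 P) :
    ∫ ω, g ω ∂P ≤ √(∫ ω, g ω ^ 2 ∂P) := by
  simpa using integral_mul_le_sqrt (f := fun _ => 1) (fun _ => zero_le_one) hg0 (memLp_const 1) hg

section Auxiliary

variable {Ω : Type*} [mΩ : MeasurableSpace Ω] {P : Measure Ω} {d : ℕ}
  {s s' : ℕ → ℝ}

/-- The scalar product with `t` is a linear form in the normalized coordinates, with frequencies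
`q`, plus a deterministic shift whose phase factors out. The joint convergence thus reduces to
`hclt` at `q`. -/
lemma tendsto_integral_exp_inner_stack
    (u : OrthonormalBasis (Fin d) ℝ (EuclideanSpace ℝ (Fin d))) {y : ℕ → Fin d ⊕ Unit → Ω → ℝ}
    {V : Fin d ⊕ Unit → ℝ} {S : Fin d ⊕ Unit → ℕ → ℝ}
    (hclt : ∀ t : Fin d ⊕ Unit → ℝ, Tendsto
      (fun n => ∫ ω, Complex.exp (((∑ j, t j * (y n j ω / S j n) : ℝ) : ℂ) * Complex.I) ∂P) atTop
      (𝓝 (Complex.exp (-((∑ j, t j ^ 2 * V j : ℝ) : ℂ) / 2))))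
    (hs : ∀ j n, S (Sum.inl j) n = s n) (hs' : ∀ n, S (Sum.inr ()) n = s' n)
    (A A' : ℝ) (β : EuclideanSpace ℝ (Fin d)) (t : EuclideanSpace ℝ (Fin d ⊕ Unit)) :
    Tendsto (fun n => ∫ ω, Complex.exp ((inner ℝ (stack
      ((A * (s n)⁻¹) • (∑ j, y n (Sum.inl j) ω • u j) + β) (A' / s' n * y n (Sum.inr ()) ω)) t : ℝ)
        * Complex.I) ∂P) atTop
      (𝓝 (Complex.exp ((inner ℝ (stack β 0) t : ℝ) * Complex.I -
        ((A ^ 2 * (∑ j, inner ℝ (u j) (WithLp.toLp 2 (t.ofLp ∘ Sum.inl)) ^ 2 * V (Sum.inl j)) +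
          A' ^ 2 * V (Sum.inr ()) * t (Sum.inr ()) ^ 2 : ℝ) : ℂ) / 2))) := by
  set tl : EuclideanSpace ℝ (Fin d) := WithLp.toLp 2 (t.ofLp ∘ Sum.inl) with htl
  set q : Fin d ⊕ Unit → ℝ :=
    Sum.elim (fun j => A * inner ℝ (u j) tl) (fun _ => A' * t (Sum.inr ())) with hq
  have hinner : ∀ n ω, inner ℝ (stack ((A * (s n)⁻¹) • (∑ j, y n (Sum.inl j) ω • u j) + β)
      (A' / s' n * y n (Sum.inr ()) ω)) t =
      inner ℝ (stack β 0) t + ∑ i, q i * (y n i ω / S i n) := by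
    intro n ω
    rw [inner_stack, inner_stack]
    change inner ℝ _ tl + _ = inner ℝ _ tl + _ + _
    simp only [Fintype.sum_sum_type, hq, Sum.elim_inl, Sum.elim_inr,
      Finset.univ_unique, Finset.sum_singleton, PUnit.default_eq_unit, hs, hs']
    rw [inner_add_left, real_inner_smul_left, sum_inner, Finset.mul_sum]
    have e1 : ∀ j, A * (s n)⁻¹ * inner ℝ (y n (Sum.inl j) ω • u j) tl =
        A * inner ℝ (u j) tl * (y n (Sum.inl j) ω / s n) := fun j => by
      rw [real_inner_smul_left]
      ring
    simp_rw [e1]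
    ring
  have hsplit : ∀ n, ∫ ω, Complex.exp ((inner ℝ (stack
      ((A * (s n)⁻¹) • (∑ j, y n (Sum.inl j) ω • u j) + β) (A' / s' n * y n (Sum.inr ()) ω)) t : ℝ)
        * Complex.I) ∂P = Complex.exp ((inner ℝ (stack β 0) t : ℝ) * Complex.I) *
      ∫ ω, Complex.exp (((∑ i, q i * (y n i ω / S i n) : ℝ) : ℂ) * Complex.I) ∂P := by
    intro n
    rw [← integral_const_mul]
    refine integral_congr_ae (ae_of_all _ fun ω => ?_)
    simp only
    rw [hinner, Complex.ofReal_add, add_mul, Complex.exp_add]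
  simp_rw [hsplit]
  have e2 : ∑ i, q i ^ 2 * V i = A ^ 2 * (∑ j, inner ℝ (u j) tl ^ 2 * V (Sum.inl j)) +
      A' ^ 2 * V (Sum.inr ()) * t (Sum.inr ()) ^ 2 := by
    simp only [Fintype.sum_sum_type, hq, Sum.elim_inl, Sum.elim_inr, Finset.univ_unique,
      Finset.sum_singleton, PUnit.default_eq_unit, Finset.mul_sum, mul_pow, mul_assoc]
    ring
  have := (hclt q).const_mul (Complex.exp ((inner ℝ (stack β 0) t : ℝ) * Complex.I))
  rwa [← Complex.exp_add, e2, neg_div, ← sub_eq_add_neg] at this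

/-- Comparison of the normalized algorithm with its linearization. -/
lemma tendstoInMeasure_stack_sub [IsProbabilityMeasure P] {w w' k : ℕ → ℝ} {A B A' : ℝ}
    (hs : ∀ n, 1 ≤ n → 0 < s n) (hk : ∀ n, 1 ≤ n → 0 < k n) (hs' : ∀ n, 1 ≤ n → 0 < s' n)
    (hA : Tendsto (fun n => w n * s n) atTop (𝓝 A))
    (hB : Tendsto (fun n => w n * k n) atTop (𝓝 B))
    (hA' : Tendsto (fun n => w' n * s' n) atTop (𝓝 A'))
    {x ell : ℕ → Ω → EuclideanSpace ℝ (Fin d)} {z Lam D Q : ℕ → Ω → ℝ}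
    {b : ℕ → EuclideanSpace ℝ (Fin d)} {β : EuclideanSpace ℝ (Fin d)} {K : ℝ}
    (hx : ∀ n, Measurable (x n)) (hz : ∀ n, Measurable (z n))
    (hellm : ∀ n, Measurable (ell n)) (hell2 : ∀ n, MemLp (ell n) 2 P)
    (hellK : ∀ n, 1 ≤ n → ∫ ω, ‖ell n ω‖ ^ 2 ∂P ≤ K * s n ^ 2)
    (hLamm : ∀ n, Measurable (Lam n)) (hLam2 : ∀ n, MemLp (Lam n) 2 P)
    (hLamK : ∀ n, 1 ≤ n → ∫ ω, Lam n ω ^ 2 ∂P ≤ K * s' n ^ 2)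
    (hb : Tendsto (fun n => (k n)⁻¹ • b n) atTop (𝓝 β))
    (hD : ∀ n, (∀ ω, 0 ≤ D n ω) ∧ Measurable (D n) ∧ Integrable (D n) P)
    (hQ : ∀ n, (∀ ω, 0 ≤ Q n ω) ∧ Measurable (Q n) ∧ Integrable (Q n) P)
    (hDlim : Tendsto (fun n => (∫ ω, D n ω ∂P) / s n) atTop (𝓝 0))
    (hQlim : Tendsto (fun n => (∫ ω, Q n ω ∂P) / s' n) atTop (𝓝 0))
    (hae : ∀ᵐ ω ∂P,
      Tendsto (fun n => max (‖x n ω - ell n ω - b n‖ - D n ω) 0 / k n) atTop (𝓝 0) ∧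
      Tendsto (fun n => max (|z n ω - Lam n ω| - Q n ω) 0 / s' n) atTop (𝓝 0)) :
    TendstoInMeasure P (fun n ω => stack (w n • x n ω) (w' n * z n ω) -
      stack ((A * (s n)⁻¹) • ell n ω + B • β) (A' / s' n * Lam n ω)) atTop 0 := by
  -- `Y` gathers what is small in mean: the dominating processes, and the mismatch between `w`, `w'`
  -- and their asymptotic forms `A / s`, `A' / s'`. The rest, namely the excesses and `w n • b n - B
  -- • β`, is small almost surely.
  set Y : ℕ → Ω → ℝ := fun n ω => |w n| * D n ω + |w n - A * (s n)⁻¹| * ‖ell n ω‖ +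
    (|w' n| * Q n ω + |w' n - A' / s' n| * |Lam n ω|) with hY
  have hi1 : ∀ n, Integrable (fun ω => ‖ell n ω‖) P := fun n =>
    ((hell2 n).integrable (by norm_num)).norm
  have hi2 : ∀ n, Integrable (fun ω => |Lam n ω|) P := fun n =>
    ((hLam2 n).integrable (by norm_num)).abs
  have hj1 : ∀ n, Integrable
      (fun ω => |w n| * D n ω + |w n - A * (s n)⁻¹| * ‖ell n ω‖) P := fun n =>
    ((hD n).2.2.const_mul _).add ((hi1 n).const_mul _)
  have hj2 : ∀ n, Integrable
      (fun ω => |w' n| * Q n ω + |w' n - A' / s' n| * |Lam n ω|) P := fun n =>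
    ((hQ n).2.2.const_mul _).add ((hi2 n).const_mul _)
  refine tendstoInMeasure_of_excess (y := Y) (fun n => ?_) (fun n ω => ?_) (fun n => ?_)
    (fun n => (hj1 n).add (hj2 n)) ?_ ?_
  · have hx := hx n
    have hz := hz n
    have hellm := hellm n
    have hLamm := hLamm n
    have m1 : Measurable fun ω => stack (w n • x n ω) (w' n * z n ω) :=
      Measurable.stack (by fun_prop) (by fun_prop)
    have m2 : Measurable fun ω =>
        stack ((A * (s n)⁻¹) • ell n ω + B • β) (A' / s' n * Lam n ω) :=
      Measurable.stack (by fun_prop) (by fun_prop)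
    exact m1.sub m2
  · have := (hD n).1 ω
    have := (hQ n).1 ω
    positivity
  · exact (((hD n).2.1.const_mul _).add ((hellm n).norm.const_mul _)).add
      (((hQ n).2.1.const_mul _).add ((hLamm n).norm.const_mul _))
  · have e : ∀ n, ∫ ω, Y n ω ∂P =
        |w n| * ∫ ω, D n ω ∂P + |w n - A * (s n)⁻¹| * ∫ ω, ‖ell n ω‖ ∂P +
        (|w' n| * ∫ ω, Q n ω ∂P + |w' n - A' / s' n| * ∫ ω, |Lam n ω| ∂P) := by
      intro n
      simp only [hY]
      rw [integral_add (hj1 n) (hj2 n), integral_add ((hD n).2.2.const_mul _)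
        ((hi1 n).const_mul _), integral_add ((hQ n).2.2.const_mul _) ((hi2 n).const_mul _)]
      simp only [integral_const_mul]
    have lim := ((hA.abs.mul hDlim).add (((hA.sub_const A).abs).mul_const √K)).add
      ((hA'.abs.mul hQlim).add (((hA'.sub_const A').abs).mul_const √K))
    simp only [mul_zero, sub_self, abs_zero, zero_mul, add_zero] at lim
    refine tendsto_of_tendsto_of_tendsto_of_le_of_le' tendsto_const_nhds lim
      (Eventually.of_forall fun n => ?_) ?_
    · refine integral_nonneg fun ω => ?_
      have := (hD n).1 ω
      have := (hQ n).1 ω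
      simp only [hY, Pi.zero_apply]
      positivity
    · filter_upwards [eventually_ge_atTop 1] with n hn
      have h1 := hs n hn
      have h2 := hs' n hn
      have k1 : (∫ ω, ‖ell n ω‖ ∂P) / s n ≤ √K := by
        rw [div_le_iff₀ h1]
        refine (integral_le_sqrt_integral_sq (fun _ => norm_nonneg _) (hell2 n).norm).trans ?_
        refine (Real.sqrt_le_sqrt (hellK n hn)).trans (le_of_eq ?_)
        rw [Real.sqrt_mul' _ (sq_nonneg _), Real.sqrt_sq h1.le]
      have k2 : (∫ ω, |Lam n ω| ∂P) / s' n ≤ √K := by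
        rw [div_le_iff₀ h2]
        refine (integral_le_sqrt_integral_sq (fun _ => abs_nonneg _) (hLam2 n).abs).trans ?_
        simp only [sq_abs]
        refine (Real.sqrt_le_sqrt (hLamK n hn)).trans (le_of_eq ?_)
        rw [Real.sqrt_mul' _ (sq_nonneg _), Real.sqrt_sq h2.le]
      have m1 : w n - A * (s n)⁻¹ = (w n * s n - A) / s n := by
        field_simp
      have m2 : w' n - A' / s' n = (w' n * s' n - A') / s' n := by
        field_simp
      rw [e]
      refine add_le_add (add_le_add (le_of_eq ?_) ?_) (add_le_add (le_of_eq ?_) ?_)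
      · rw [abs_mul, abs_of_pos h1]
        field_simp
      · rw [m1, abs_div, abs_of_pos h1, div_mul_eq_mul_div, mul_div_assoc]
        exact mul_le_mul_of_nonneg_left k1 (abs_nonneg _)
      · rw [abs_mul, abs_of_pos h2]
        field_simp
      · rw [m2, abs_div, abs_of_pos h2, div_mul_eq_mul_div, mul_div_assoc]
        exact mul_le_mul_of_nonneg_left k2 (abs_nonneg _)
  · filter_upwards [hae] with ω hω
    have l0 : Tendsto (fun n => ‖w n • b n - B • β‖) atTop (𝓝 0) := by
      rw [← tendsto_iff_norm_sub_tendsto_zero]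
      refine (hB.smul hb).congr' ?_
      filter_upwards [eventually_ge_atTop 1] with n hn
      rw [smul_smul, mul_assoc, mul_inv_cancel₀ (hk n hn).ne', mul_one]
    have lim := ((hB.abs.mul hω.1).add l0).add (hA'.abs.mul hω.2)
    simp only [mul_zero, add_zero] at lim
    refine tendsto_of_tendsto_of_tendsto_of_le_of_le' tendsto_const_nhds lim
      (Eventually.of_forall fun n => le_max_right _ _) ?_
    filter_upwards [eventually_ge_atTop 1] with n hn
    have hc := hk n hn
    have h2 := hs' n hn
    rw [abs_mul, abs_of_pos hc, abs_mul, abs_of_pos h2, mul_assoc, mul_div_cancel₀ _ hc.ne',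
      mul_assoc, mul_div_cancel₀ _ h2.ne']
    refine max_le ?_ (by positivity)
    have n1 := mul_le_mul_of_nonneg_left
      (le_max_left (‖x n ω - ell n ω - b n‖ - D n ω) 0) (abs_nonneg (w n))
    have n2 := mul_le_mul_of_nonneg_left
      (le_max_left (|z n ω - Lam n ω| - Q n ω) 0) (abs_nonneg (w' n))
    simp only [hY, stack_sub]
    have n3 : ‖w n • x n ω - ((A * (s n)⁻¹) • ell n ω + B • β)‖ ≤
        |w n| * ‖x n ω - ell n ω - b n‖ + |w n - A * (s n)⁻¹| * ‖ell n ω‖ +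
        ‖w n • b n - B • β‖ := by
      have e : w n • x n ω - ((A * (s n)⁻¹) • ell n ω + B • β) =
          w n • (x n ω - ell n ω - b n) + (w n - A * (s n)⁻¹) • ell n ω +
          (w n • b n - B • β) := by
        module
      rw [e]
      refine norm_add₃_le.trans (le_of_eq ?_)
      rw [norm_smul, norm_smul, Real.norm_eq_abs, Real.norm_eq_abs]
    have n4 : |w' n * z n ω - A' / s' n * Lam n ω| ≤
        |w' n| * |z n ω - Lam n ω| + |w' n - A' / s' n| * |Lam n ω| := by
      rw [← abs_mul, ← abs_mul]
      refine le_of_eq_of_le ?_ (abs_add_le _ _)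
      congr 1
      ring
    have n5 := norm_stack_le (w n • x n ω - ((A * (s n)⁻¹) • ell n ω + B • β))
        (w' n * z n ω - A' / s' n * Lam n ω)
    linarith

end Auxiliary

/-! ### The limit theorem for general normalizations -/

section Main

variable {Ω : Type*} [mΩ : MeasurableSpace Ω] {P : Measure Ω} [IsProbabilityMeasure P] {d δ : ℕ}
  {κ : Kernel (EuclideanSpace ℝ (Fin d)) ℝ} {θ : EuclideanSpace ℝ (Fin d)} {a c a' : ℕ → ℝ}
  {Z : ℕ → Label d δ → Ω → ℝ} {T : ℕ → Ω → EuclideanSpace ℝ (Fin d)} {M : ℕ → Ω → ℝ}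
  {L τ σ m : ℝ} {l l' : EReal}

/-- The double algorithm under arbitrary normalizations `w` and `w'`. -/
theorem tendstoInDistribution_normalized (R : Rates a c a' L τ l⁻¹.toReal l'⁻¹.toReal) (hδ : 1 ≤ δ)
    [IsMarkovKernel κ] (hAlg : IsCompanionAlgorithm P κ a c a' Z T M)
    (hA1 : ∀ᵐ ω ∂P, Tendsto (fun n => T n ω) atTop (𝓝 θ))
    (hf : RegularMaximum (regression κ) θ L) (hA3 : NoiseAssumption P κ c Z T σ m)
    {w w' : ℕ → ℝ} {A B A' : ℝ} (hA : Tendsto (fun n => w n * (√(a n) / c n)) atTop (𝓝 A))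
    (hB : Tendsto (fun n => w n * c n ^ 2) atTop (𝓝 B))
    (hA' : Tendsto (fun n => w' n * √(a' n)) atTop (𝓝 A'))
    {Ω' : Type*} [MeasurableSpace Ω'] {P' : Measure Ω'} [IsProbabilityMeasure P']
    {V : Ω' → EuclideanSpace ℝ (Fin d ⊕ Unit)} (hV : Measurable V)
    (hVt : ∀ t : EuclideanSpace ℝ (Fin d ⊕ Unit), charFun (P'.map V) t =
      Complex.exp ((inner ℝ (stack (B • biasTheta (regression κ) θ τ l) 0) t : ℝ) * Complex.I -
        ((t.ofLp ⬝ᵥ (blockCov (A ^ 2 • covTheta (regression κ) θ σ τ l)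
          (A' ^ 2 * varMu δ σ l')).mulVec t.ofLp : ℝ) : ℂ) / 2)) :
    TendstoInDistribution
      (fun n ω => stack (w n • (T n ω - θ)) (w' n * (M n ω - regression κ θ))) atTop V
      (fun _ => P) P' := by
  obtain ⟨u, lam, hlam, hu⟩ := hf.exists_basis
  have hs1 : ∀ j, (1 - 2 * τ) * l⁻¹.toReal / 2 < lam j := fun j => by
    have := R.lt_two_L
    have := hlam j
    linarith
  have hs2 : l'⁻¹.toReal / 2 < 1 := by have := R.lt_two; linarith
  have hnoise := (isWhiteNoise_noise hAlg hA3).linear (noiseCoeff δ u)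
    (sum_noiseCoeff_mul hδ u (σ ^ 2))
  set ξ : ℕ → Fin d ⊕ Unit → Ω → ℝ :=
    fun n i ω => ∑ s, noiseCoeff δ u i s * noise κ c T Z n s ω with hξ
  -- The value `1 / 4` of `β` is the square of the `1 / 2` in the difference quotient: `(a / (2 c))²
  -- = a · (1 / 4) · (√a / c)²`. With noise variance `2 σ²` the coordinates of `ell` get the
  -- variance `σ² / (4 (lam j - ξ / 2))`.
  obtain ⟨y, hy, hym, ⟨K, hK, hyK⟩, hclt⟩ := hnoise.exists_linear
    (by rintro (j | j) <;> simp only [Sum.elim_inl, Sum.elim_inr] <;> positivity)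
    (γ := Sum.elim (fun _ => a) fun _ => a')
    (b := Sum.elim (fun _ n => a n / (2 * c n)) fun _ => a')
    (s := Sum.elim (fun _ n => √(a n) / c n) fun _ n => √(a' n))
    (lam := Sum.elim lam fun _ => 1)
    (κ := Sum.elim (fun _ => (1 - 2 * τ) * l⁻¹.toReal / 2) fun _ => l'⁻¹.toReal / 2)
    (β := Sum.elim (fun _ => 1 / 4) fun _ => 1)
    (by rintro (j | j); exacts [R.step, R.step'])
    (by rintro (j | j); exacts [R.reg_s, R.reg_sqrt])
    (by rintro (j | j); exacts [hs1 j, hs2])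
    (by
      rintro (j | j) n hn
      · have h1 := R.step.pos n hn
        have h2 := R.c_pos n hn
        simp only [Sum.elim_inl]
        rw [div_pow, div_pow, Real.sq_sqrt h1.le]
        field_simp; norm_num
      · have h1 := R.step'.pos n hn
        simp only [Sum.elim_inr]
        rw [Real.sq_sqrt h1.le]
        ring)
  set ell : ℕ → Ω → EuclideanSpace ℝ (Fin d) := fun n ω => ∑ j, y n (Sum.inl j) ω • u j with hell
  set Lam : ℕ → Ω → ℝ := fun n => y n (Sum.inr ()) with hLam
  have hellj : ∀ n ω j, inner ℝ (u j) (ell n ω) = y n (Sum.inl j) ω := fun n ω j => by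
    simp only [hell]
    exact u.orthonormal.inner_right_fintype _ j
  have hellm : ∀ n, Measurable (ell n) := fun n =>
    Finset.measurable_sum _ fun j _ => (hym n (Sum.inl j)).1.smul_const _
  have hell2 : ∀ n, MemLp (ell n) 2 P := fun n =>
    memLp_finsetSum _ fun j _ => (memLp_top_const (u j)).smul (hym n (Sum.inl j)).2
  have hellK : ∀ n, 1 ≤ n → ∫ ω, ‖ell n ω‖ ^ 2 ∂P ≤ (d * K) * (√(a n) / c n) ^ 2 := by
    intro n hn
    have e : ∀ ω, ‖ell n ω‖ ^ 2 = ∑ j, y n (Sum.inl j) ω ^ 2 := fun ω => by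
      rw [← u.sum_sq_inner_right]
      exact Finset.sum_congr rfl fun j _ => by rw [hellj]
    simp_rw [e]
    rw [integral_finsetSum _ fun j _ => (hym n (Sum.inl j)).2.integrable_sq]
    refine (Finset.sum_le_sum fun j _ => hyK n hn (Sum.inl j)).trans (le_of_eq ?_)
    simp only [Sum.elim_inl, Finset.sum_const, Finset.card_univ, Fintype.card_fin, nsmul_eq_mul]
    ring
  obtain ⟨b, _, -, hb⟩ := exists_seq_from_one (0 : EuclideanSpace ℝ (Fin d)) fun n b =>
    (b + a n • hessianMap (regression κ) θ b) + (a n * c n ^ 2) • biasVec (regression κ) θ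
  have hblim := R.tendsto_bias hf hb
  obtain ⟨K₀, hK₀⟩ := hblim.norm.bddAbove_range
  have hbK : ∀ n, 1 ≤ n → ‖b n‖ ≤ K₀ * c n ^ 2 := by
    intro n hn
    have h1 : ‖(c n ^ 2)⁻¹ • b n‖ ≤ K₀ := hK₀ ⟨n, rfl⟩
    have h2 : 0 < c n ^ 2 := pow_pos (R.c_pos n hn) 2
    rw [norm_smul, norm_inv, Real.norm_of_nonneg h2.le, inv_mul_le_iff₀ h2] at h1
    linarith
  have hrec : ∀ n, 1 ≤ n → ∀ ω, ell (n + 1) ω =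
      (ell n ω + a n • hessianMap (regression κ) θ (ell n ω)) +
        (a n / (2 * c n)) • ∑ j, ξ n (Sum.inl j) ω • u j := by
    intro n hn ω
    refine InnerProductSpace.ext_inner_left_basis u.toBasis fun j => ?_
    rw [u.coe_toBasis]
    rw [hellj, hy n hn, inner_add_right, inner_add_right, real_inner_smul_right,
      real_inner_smul_right, hu, hellj, u.orthonormal.inner_right_fintype]
    simp only [Sum.elim_inl]
    ring
  obtain ⟨D, Q, hD, hQ, hDlim, hQlim, hae⟩ := R.exists_dominating hδ hAlg hA1 hf u hrec
    (Lam := Lam) (fun n hn ω => by simp only [hLam]; rw [hy n hn]; simp [hξ]) hb hbK hellm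
    hell2 (K₁ := d * K) (by positivity) fun n hn => by
      have := hellK n hn
      rwa [div_pow, Real.sq_sqrt (R.step.pos n hn).le] at this
  have hKd : K ≤ d * K + K := by nlinarith [Nat.cast_nonneg (α := ℝ) d]
  have hlim := tendstoInMeasure_stack_sub R.reg_s.pos (fun n hn => pow_pos (R.c_pos n hn) 2)
    R.reg_sqrt.pos hA hB hA' (fun n => (hAlg.measurable_T n).sub_const θ)
    (fun n => (hAlg.measurable_M n).sub_const (regression κ θ)) (K := d * K + K) hellm hell2
    (fun n hn => (hellK n hn).trans (mul_le_mul_of_nonneg_right (by linarith) (sq_nonneg _)))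
    (fun n => (hym n _).1) (fun n => (hym n _).2)
    (fun n hn => (hyK n hn (Sum.inr ())).trans (mul_le_mul_of_nonneg_right hKd (sq_nonneg _)))
    hblim hD hQ hDlim hQlim hae
  have hXm : ∀ n, Measurable fun ω => stack ((A * (√(a n) / c n)⁻¹) • ell n ω +
      B • biasTheta (regression κ) θ τ l) (A' / √(a' n) * Lam n ω) := fun n => by
    have h1 := hellm n
    have h2 : Measurable (Lam n) := (hym n _).1
    exact Measurable.stack (by fun_prop) (by fun_prop)
  have hVm : ∀ n, Measurable fun ω =>
      stack (w n • (T n ω - θ)) (w' n * (M n ω - regression κ θ)) := fun n => by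
    have h1 := hAlg.measurable_T n
    have h2 := hAlg.measurable_M n
    exact Measurable.stack (by fun_prop) (by fun_prop)
  -- Slutsky's lemma: the limit of the linearized process carries over to the algorithm.
  refine tendstoInDistribution_of_tendstoInMeasure_sub _ V
    (tendstoInDistribution_of_charFun hXm hV fun t => ?_) hlim fun n => (hVm n).aemeasurable
  have hchar := tendsto_integral_exp_inner_stack u hclt (s := fun n => √(a n) / c n)
    (s' := fun n => √(a' n)) (fun _ _ => rfl) (fun _ => rfl) A A'
    (B • biasTheta (regression κ) θ τ l) t
  rw [hVt, dotProduct_blockCov, Matrix.smul_mulVec, dotProduct_smul, dotProduct_covTheta hu hs1]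
  convert hchar using 5
  rw [smul_eq_mul, Complex.ofReal_inj]
  congr 1
  · congr 1
    refine Finset.sum_congr rfl fun j _ => ?_
    have h1 : lam j - (1 - 2 * τ) * l⁻¹.toReal / 2 ≠ 0 := (sub_pos.2 (hs1 j)).ne'
    simp only [Sum.elim_inl]
    generalize lam j - (1 - 2 * τ) * l⁻¹.toReal / 2 = z at h1
    field_simp
  · have h1 : (2 : ℝ) - l'⁻¹.toReal ≠ 0 := by have := R.lt_two; linarith
    have h2 : (δ : ℝ) ≠ 0 := by positivity
    have e3 : 2 * (1 - l'⁻¹.toReal / 2) = 2 - l'⁻¹.toReal := by ring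
    simp only [Sum.elim_inr]
    rw [e3, varMu]
    field_simp

end Main


/-! ### Characteristic functions of the limit laws and conclusion -/

lemma charFun_map_stack_gaussianReal {d : ℕ} (x : EuclideanSpace ℝ (Fin d)) {v : ℝ} (hv : 0 ≤ v)
    (t : EuclideanSpace ℝ (Fin d ⊕ Unit)) :
    charFun ((gaussianReal 0 v.toNNReal).map (stack x)) t =
      Complex.exp ((inner ℝ (stack x 0) t : ℝ) * Complex.I -
        ((v * t (Sum.inr ()) ^ 2 : ℝ) : ℂ) / 2) := by
  have hm : Measurable (stack x) := Measurable.stack measurable_const measurable_id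
  rw [charFun_apply, integral_map hm.aemeasurable
    (Continuous.aestronglyMeasurable (by fun_prop))]
  have e : ∀ z : ℝ, Complex.exp ((inner ℝ (stack x z) t : ℝ) * Complex.I) =
      Complex.exp ((inner ℝ (stack x 0) t : ℝ) * Complex.I) *
        Complex.exp (t (Sum.inr ()) * z * Complex.I) := by
    intro z
    rw [← Complex.exp_add, inner_stack, inner_stack]
    congr 1
    push_cast
    ring
  rw [integral_congr_ae (ae_of_all _ e), integral_const_mul, ← charFun_apply_real,
    charFun_gaussianReal, ← Complex.exp_add]
  congr 1
  rw [Real.coe_toNNReal _ hv]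
  push_cast
  ring

lemma charFun_map_id_multivariateGaussian {d : ℕ} {S : Matrix (Fin d) (Fin d) ℝ}
    (hS : S.PosSemidef) {v : ℝ} (hv : 0 ≤ v) (x t : EuclideanSpace ℝ (Fin d ⊕ Unit)) :
    charFun ((multivariateGaussian x (blockCov S v)).map id) t =
      Complex.exp ((inner ℝ x t : ℝ) * Complex.I -
        ((t.ofLp ⬝ᵥ (blockCov S v).mulVec t.ofLp : ℝ) : ℂ) / 2) := by
  rw [Measure.map_id, charFun_multivariateGaussian (posSemidef_blockCov hS hv), real_inner_comm]

lemma varMu_nonneg {a c a' : ℕ → ℝ} {L τ q : ℝ} {l' : EReal} (R : Rates a c a' L τ q l'⁻¹.toReal)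
    (δ : ℕ) (σ : ℝ) : 0 ≤ varMu δ σ l' := by
  have := R.lt_two
  exact div_nonneg (sq_nonneg _) (mul_nonneg (Nat.cast_nonneg _) (by linarith))

end KieferWolfowitz

theorem theorem2 {Ω : Type*} [MeasurableSpace Ω] (P : Measure Ω) [IsProbabilityMeasure P]
    {d δ : ℕ} (hδ : 1 ≤ δ)
    (κ : Kernel (EuclideanSpace ℝ (Fin d)) ℝ) [IsMarkovKernel κ]
    (θ : EuclideanSpace ℝ (Fin d)) (a c a' : ℕ → ℝ)
    (Z : ℕ → KieferWolfowitz.Label d δ → Ω → ℝ)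
    (T : ℕ → Ω → EuclideanSpace ℝ (Fin d)) (M : ℕ → Ω → ℝ)
    (σ m L α τ α' : ℝ) (l l' : EReal)
    (hAlg : KieferWolfowitz.IsCompanionAlgorithm P κ a c a' Z T M)
    (hA1 : ∀ᵐ ω ∂P, Tendsto (fun n => T n ω) atTop (𝓝 θ))
    (hA2 : KieferWolfowitz.RegularMaximum (KieferWolfowitz.regression κ) θ L)
    (hA3 : KieferWolfowitz.NoiseAssumption P κ c Z T σ m)
    (hA4 : KieferWolfowitz.StepAssumption a c a' m L α τ α' l l') :
    (Tendsto (fun n => (a n)⁻¹ * c n ^ 6) atTop atTop →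
      TendstoInDistribution
        (fun n ω => KieferWolfowitz.stack ((c n ^ 2)⁻¹ • (T n ω - θ))
          (√((a' n)⁻¹) * (M n ω - KieferWolfowitz.regression κ θ)))
        atTop
        (fun z : ℝ => KieferWolfowitz.stack
          (KieferWolfowitz.biasTheta (KieferWolfowitz.regression κ) θ τ l) z)
        (fun _ => P)
        (gaussianReal 0 (KieferWolfowitz.varMu δ σ l').toNNReal)) ∧
    (∀ γ₁ : ℝ, 0 ≤ γ₁ → Tendsto (fun n => (a n)⁻¹ * c n ^ 6) atTop (𝓝 γ₁) →
      TendstoInDistribution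
        (fun n ω => KieferWolfowitz.stack (√((a n)⁻¹ * c n ^ 2) • (T n ω - θ))
          (√((a' n)⁻¹) * (M n ω - KieferWolfowitz.regression κ θ)))
        atTop id (fun _ => P)
        (multivariateGaussian
          (KieferWolfowitz.stack
            (√γ₁ • KieferWolfowitz.biasTheta (KieferWolfowitz.regression κ) θ τ l) 0)
          (KieferWolfowitz.blockCov
            (KieferWolfowitz.covTheta (KieferWolfowitz.regression κ) θ σ τ l)
            (KieferWolfowitz.varMu δ σ l')))) ∧
    (∀ a₀ c₀ a₀' : ℝ, 0 < a₀ → 0 < c₀ → 0 < a₀' →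
      (∀ n : ℕ, 1 ≤ n → a n = a₀ * (n : ℝ)⁻¹) →
      (∀ n : ℕ, 1 ≤ n → c n = c₀ * (n : ℝ) ^ (-(1 / 6) : ℝ)) →
      (∀ n : ℕ, 1 ≤ n → a' n = a₀' * (n : ℝ)⁻¹) →
      TendstoInDistribution
        (fun (n : ℕ) ω => KieferWolfowitz.stack ((n : ℝ) ^ (1 / 3 : ℝ) • (T n ω - θ))
          (√(n : ℝ) * (M n ω - KieferWolfowitz.regression κ θ)))
        atTop id (fun _ => P)
        (multivariateGaussian
          (KieferWolfowitz.stack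
            (c₀ ^ 2 • KieferWolfowitz.biasTheta (KieferWolfowitz.regression κ) θ τ l) 0)
          (KieferWolfowitz.blockCov
            ((a₀ * (c₀ ^ 2)⁻¹) •
              KieferWolfowitz.covTheta (KieferWolfowitz.regression κ) θ σ τ l)
            (a₀' * KieferWolfowitz.varMu δ σ l')))) := by
  have R := hA4.rates hA2.L_pos
  have hv := KieferWolfowitz.varMu_nonneg R δ σ
  have hS := KieferWolfowitz.posSemidef_covTheta R hA2 σ
  have hw' : Tendsto (fun n => √((a' n)⁻¹) * √(a' n)) atTop (𝓝 1) := by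
    refine tendsto_const_nhds.congr' ?_
    filter_upwards [eventually_ge_atTop 1] with n hn
    rw [Real.sqrt_inv, inv_mul_cancel₀ (R.reg_sqrt.pos n hn).ne']
  have hroot : ∀ n, 1 ≤ n → √((a n)⁻¹ * c n ^ 6) = c n ^ 2 / (√(a n) / c n) := fun n hn => by
    have hc := R.c_pos n hn
    rw [Real.sqrt_mul (inv_nonneg.2 (R.step.pos n hn).le), Real.sqrt_inv,
      show c n ^ 6 = (c n ^ 3) ^ 2 by ring, Real.sqrt_sq (by positivity)]
    field_simp
  refine ⟨fun hlim => ?_, fun γ₁ hγ₁ hlim => ?_, fun a₀ c₀ a₀' ha₀ hc₀ ha₀' ha hc ha' => ?_⟩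
  -- The bias dominates: normalized by `c_n²`, the noise part has size `(a_n⁻¹ c_n⁶)^(-1/2)` and
  -- disappears, so the first block of the limit is deterministic.
  · refine KieferWolfowitz.tendstoInDistribution_normalized (A := 0) (B := 1) (A' := 1) R hδ hAlg
      hA1 hA2 hA3 ?_ ?_ hw' (KieferWolfowitz.Measurable.stack measurable_const measurable_id)
      fun t => ?_
    · refine (tendsto_inv_atTop_zero.comp (Real.tendsto_sqrt_atTop.comp hlim)).congr' ?_
      filter_upwards [eventually_ge_atTop 1] with n hn
      simp only [Function.comp]
      rw [hroot n hn, inv_div, div_eq_inv_mul]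
    · refine tendsto_const_nhds.congr' ?_
      filter_upwards [R.c_sq_pos] with n hn
      rw [inv_mul_cancel₀ hn.ne']
    · rw [KieferWolfowitz.charFun_map_stack_gaussianReal _ hv, KieferWolfowitz.dotProduct_blockCov]
      simp
  · refine KieferWolfowitz.tendstoInDistribution_normalized (A := 1) (B := √γ₁) (A' := 1) R hδ hAlg
      hA1 hA2 hA3 ?_ ?_ hw' measurable_id fun t => ?_
    · refine tendsto_const_nhds.congr' ?_
      filter_upwards [eventually_ge_atTop 1] with n hn
      have h1 := R.step.pos n hn
      have h2 := R.c_pos n hn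
      have h3 := Real.sqrt_pos.2 h1
      rw [Real.sqrt_mul (inv_nonneg.2 h1.le), Real.sqrt_inv, Real.sqrt_sq h2.le]
      field_simp
    · refine ((Real.continuous_sqrt.tendsto γ₁).comp hlim).congr' ?_
      filter_upwards [eventually_ge_atTop 1] with n hn
      have h1 := R.step.pos n hn
      have h2 := R.c_pos n hn
      have h3 := Real.sqrt_pos.2 h1
      simp only [Function.comp]
      rw [hroot n hn, Real.sqrt_mul (inv_nonneg.2 h1.le), Real.sqrt_inv, Real.sqrt_sq h2.le]
      field_simp
    · rw [KieferWolfowitz.charFun_map_id_multivariateGaussian hS hv]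
      simp
  -- Here `√a_n / c_n = (√a₀ / c₀) n^(-1/3)` and `c_n² = c₀² n^(-1/3)`: noise and bias have the same
  -- order, and the constants are the limits after multiplication by `n^(1/3)`.
  · refine KieferWolfowitz.tendstoInDistribution_normalized (A := √a₀ / c₀) (B := c₀ ^ 2)
      (A' := √a₀') R hδ hAlg hA1 hA2 hA3 ?_ ?_ ?_ measurable_id fun t => ?_
    · refine tendsto_const_nhds.congr' ?_
      filter_upwards [eventually_ge_atTop 1] with n hn
      have hn0 : (0 : ℝ) < n := by exact_mod_cast hn
      rw [ha n hn, hc n hn, Real.sqrt_mul ha₀.le, Real.sqrt_eq_rpow (n : ℝ)⁻¹,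
        ← Real.rpow_neg_one, ← Real.rpow_mul hn0.le, mul_div_mul_comm, ← Real.rpow_sub hn0,
        mul_left_comm, ← Real.rpow_add hn0]
      norm_num
    · refine tendsto_const_nhds.congr' ?_
      filter_upwards [eventually_ge_atTop 1] with n hn
      have hn0 : (0 : ℝ) < n := by exact_mod_cast hn
      rw [hc n hn, mul_pow, ← Real.rpow_natCast (_ ^ _), ← Real.rpow_mul hn0.le, mul_left_comm,
        ← Real.rpow_add hn0]
      norm_num
    · refine tendsto_const_nhds.congr' ?_
      filter_upwards [eventually_ge_atTop 1] with n hn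
      have hn0 : (0 : ℝ) < n := by exact_mod_cast hn
      rw [ha' n hn, ← Real.sqrt_mul hn0.le]
      congr 1
      field_simp
    · rw [KieferWolfowitz.charFun_map_id_multivariateGaussian (hS.smul (by positivity))
        (by positivity), div_pow, Real.sq_sqrt ha₀.le, Real.sq_sqrt ha₀'.le, div_eq_mul_inv a₀]
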